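/- Let $\mathfrak h$ be a separable complex Hilbert space with a complex conjugation $\mathcal C$ (an antilinear map with $\mathcal C^2=\mathbf 1$ and $\langle \mathcal Cf,\mathcal Cg\rangle=\langle g,f\rangle$), and write $X^\top=\mathcal C X^*\mathcal C$ for the transpose of an operator $X$ on $\mathfrak h$. Let $\mathcal B(\mathfrak h)$ be the bounded operators and $\mathcal L^2(\mathfrak h)$ the Hilbert–Schmidt operators on $\mathfrak h$, the latter with the norm $\|X\|_2=\sqrt{\mathrm{tr}(X^*X)}$. Let $\Upsilon_0=\Upsilon_0^*$ be a (possibly unbounded) self-adjoint operator with $\Upsilon_0\ge-\mu\mathbf 1$ for some $\mu\in\mathbb R$, and let $D_0\in\mathcal L^2(\mathfrak h)$, $D_0\ne0$. Consider the elliptic operator-valued flow $$\begin{cases}\partial_t\Delta_t=16\,D_tD_t^*, & \Delta_0=0,\quad t\ge 0,\\ \partial_tD_t=-2\big((\Delta_t+\Upsilon_0)D_t+D_t(\Delta_t+\Upsilon_0)^\top\big), & D_{t=0}=D_0,\quad t>0,\end{cases}$$ where the second equation includes the requirement $D_t\varphi\in\mathcal D(\Upsilon_0)$ for all $\varphi\in\mathcal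 D(\Upsilon_0^\top)$ and its right-hand side is understood on the domain $\mathcal D(\Upsilon_0^\top)$ of $\Upsilon_0^\top$. Then the flow has a unique solution $(\Delta,D)$ among pairs of strongly continuous maps $[0,\infty)\to\mathcal B(\mathfrak h)$, where the derivatives are taken strongly, i.e. pointwise on every $\varphi\in\mathfrak h$ in the first equation and on every $\varphi\in\mathcal D(\Upsilon_0^\top)$ in the second. Moreover $(\Delta,D)\in C([0,\infty);\mathcal L^2(\mathfrak h)^2)$, and $(\Delta,D)$ is the unique element of $C([0,\infty);\mathcal L^2(\mathfrak h)^2)$ that solves the flow in $\mathcal L^2(\mathfrak h)$, i.e. with the derivatives $\partial_t\Delta_t$ ($t\ge0$, one-sided at $t=0$) and $\partial_tD_t$ ($t>0$) taken in the Hilbert–Schmidt norm and equal to the (Hilbert–Schmidt extensions of the) operators on the right-hand sides. For this solution and every $t>0$ both terms of the second equation are Hilbert–Schmidt: $D_t\mathfrak h\subseteq\mathcal D(\Upsilon_0)$, $(\Delta_t+\Upsilon_0)D_t\in\mathcal L^2(\mathfrak h)$, and $D_t(\Delta_t+\Upsilon_0)^\top$ extends to an operator in $\mathcal L^2(\mathfrak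 h)$. -/

import Mathlib

open Set
open scoped ComplexConjugate InnerProductSpace

/-- A complex conjugation on a complex Hilbert space: an antiunitary involution. -/
structure Conjugation (h : Type*) [NormedAddCommGroup h] [InnerProductSpace ℂ h]
    extends h →ₗ⋆[ℂ] h where
  involutive' : ∀ f : h, toFun (toFun f) = f
  inner_map' : ∀ f g : h, ⟪toFun f, toFun g⟫_ℂ = ⟪g, f⟫_ℂ

namespace LinearPMap

/-- The transpose `X^⊤ = 𝒞 X* 𝒞` of a (possibly unbounded) operator `X`, with its natural domain
`{φ | 𝒞 φ ∈ D(X*)}`. -/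
noncomputable def transposeOp {h : Type*} [NormedAddCommGroup h] [InnerProductSpace ℂ h]
    [CompleteSpace h] (C : Conjugation h) (X : h →ₗ.[ℂ] h) : h →ₗ.[ℂ] h where
  domain := X.adjoint.domain.comap C.toLinearMap
  toFun :=
    { toFun := fun φ => C.toLinearMap (X.adjoint ⟨C.toLinearMap φ, φ.2⟩)
      map_add' := fun φ ψ => by
        have : (⟨C.toLinearMap ((φ + ψ : X.adjoint.domain.comap C.toLinearMap) : h), (φ + ψ).2⟩ :
            X.adjoint.domain) = ⟨C.toLinearMap φ, φ.2⟩ + ⟨C.toLinearMap ψ, ψ.2⟩ := by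
          ext
          simp
        rw [this, LinearPMap.map_add, LinearMap.map_add]
      map_smul' := fun c φ => by
        have : (⟨C.toLinearMap ((c • φ : X.adjoint.domain.comap C.toLinearMap) : h), (c • φ).2⟩ :
            X.adjoint.domain) = (conj c) • ⟨C.toLinearMap φ, φ.2⟩ := by
          ext
          simp
        rw [this, LinearPMap.map_smul, LinearMap.map_smulₛₗ]
        simp }

end LinearPMap

section HilbertSchmidt

/-- Some orthonormal basis of `h`, fixed once and for all. -/
noncomputable def stdHilbertBasis (h : Type*) [NormedAddCommGroup h] [InnerProductSpace ℂ h]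
    [CompleteSpace h] :
    HilbertBasis (exists_hilbertBasis ℂ h).choose ℂ h :=
  (exists_hilbertBasis ℂ h).choose_spec.choose

/-- The Hilbert-Schmidt operators on `h`, as a subspace of the bounded operators: those `X` for
which `tr (X* X) = ∑ i, ‖X (e i)‖ ^ 2` is finite. -/
noncomputable def hilbertSchmidtSubmodule (h : Type*) [NormedAddCommGroup h]
    [InnerProductSpace ℂ h] [CompleteSpace h] : Submodule ℂ (h →L[ℂ] h) where
  carrier := {X | Memℓp (fun i => X (stdHilbertBasis h i)) 2}
  zero_mem' := zero_memℓp
  add_mem' hX hY := hX.add hY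
  smul_mem' c _ hX := hX.const_smul c

/-- The space `ℒ²(h)` of Hilbert-Schmidt operators on `h` (a type of its own, because it carries
the Hilbert-Schmidt norm and not the operator norm). -/
def HilbertSchmidt (h : Type*) [NormedAddCommGroup h] [InnerProductSpace ℂ h]
    [CompleteSpace h] : Type _ := hilbertSchmidtSubmodule h

namespace HilbertSchmidt

variable {h : Type*} [NormedAddCommGroup h] [InnerProductSpace ℂ h] [CompleteSpace h]

noncomputable instance : AddCommGroup (HilbertSchmidt h) :=
  inferInstanceAs (AddCommGroup (hilbertSchmidtSubmodule h))

noncomputable instance : Module ℂ (HilbertSchmidt h) :=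
  inferInstanceAs (Module ℂ (hilbertSchmidtSubmodule h))

/-- The bounded operator underlying a Hilbert-Schmidt operator. -/
noncomputable def toCLM : HilbertSchmidt h →ₗ[ℂ] (h →L[ℂ] h) :=
  (hilbertSchmidtSubmodule h).subtype

theorem toCLM_injective : Function.Injective (toCLM (h := h)) :=
  Subtype.val_injective

/-- The family `(X e_i)_i` as an element of the Hilbert sum `⊕ i, h`. -/
noncomputable def toLp :
    HilbertSchmidt h →ₗ[ℂ] lp (fun _ : (exists_hilbertBasis ℂ h).choose => h) 2 where
  toFun X := ⟨fun i => toCLM X (stdHilbertBasis h i), X.2⟩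
  map_add' X Y := by
    ext i
    simp
    rfl
  map_smul' c X := by
    ext i
    simp

theorem toLp_injective : Function.Injective (toLp (h := h)) := by
  intro X Y hXY
  apply toCLM_injective
  have hb := (stdHilbertBasis h).dense_span
  refine ContinuousLinearMap.ext_on (s := range (stdHilbertBasis h)) ?_ ?_
  · rw [Submodule.dense_iff_topologicalClosure_eq_top, hb]
  · rintro _ ⟨i, rfl⟩
    exact congrFun (congrArg Subtype.val hXY) i

/-- The Hilbert-Schmidt norm `‖X‖₂ = (∑ i, ‖X e_i‖ ^ 2) ^ (1 / 2) = (tr (X* X)) ^ (1 / 2)`. -/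
noncomputable instance : NormedAddCommGroup (HilbertSchmidt h) :=
  NormedAddCommGroup.induced _ _ toLp toLp_injective

noncomputable instance : NormedSpace ℂ (HilbertSchmidt h) :=
  NormedSpace.induced ℂ _ _ toLp

theorem norm_eq_norm_toLp (X : HilbertSchmidt h) : ‖X‖ = ‖toLp X‖ := rfl

/-- Parseval's identity. -/
theorem enorm_sq_eq_tsum {ι : Type*} (b : HilbertBasis ι ℂ h) (x : h) :
    ‖x‖ₑ ^ 2 = ∑' i, ‖⟪b i, x⟫_ℂ‖ₑ ^ 2 := by
  have h1 : HasSum (fun i => ‖⟪b i, x⟫_ℂ‖ ^ 2) (‖x‖ ^ 2) := by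
    have := lp.hasSum_norm (p := 2) (by norm_num) (b.repr x)
    simpa [HilbertBasis.repr_apply_apply] using this
  have h2 : ∀ y : h, ‖y‖ₑ ^ 2 = ENNReal.ofReal (‖y‖ ^ 2) := fun y => by
    rw [ENNReal.ofReal_pow (norm_nonneg _), ofReal_norm]
  have h3 : ∀ y : ℂ, ‖y‖ₑ ^ 2 = ENNReal.ofReal (‖y‖ ^ 2) := fun y => by
    rw [ENNReal.ofReal_pow (norm_nonneg _), ofReal_norm]
  rw [h2, ← h1.tsum_eq, ENNReal.ofReal_tsum_of_nonneg (fun _ => by positivity) h1.summable]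
  exact tsum_congr fun i => (h3 _).symm

theorem tsum_enorm_sq_adjoint {ι κ : Type*} (b : HilbertBasis ι ℂ h) (c : HilbertBasis κ ℂ h)
    (X : h →L[ℂ] h) :
    ∑' i, ‖X (b i)‖ₑ ^ 2 = ∑' j, ‖X.adjoint (c j)‖ₑ ^ 2 := by
  simp_rw [enorm_sq_eq_tsum c (X _), enorm_sq_eq_tsum b (X.adjoint _)]
  rw [ENNReal.tsum_comm]
  refine tsum_congr fun j => tsum_congr fun i => ?_
  rw [ContinuousLinearMap.adjoint_inner_right, ← inner_conj_symm]
  congr 1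
  exact RCLike.enorm_conj _

/-- `∑ i, ‖X e_i‖ ^ 2` does not depend on the orthonormal basis. -/
theorem tsum_enorm_sq_eq {ι κ : Type*} (b : HilbertBasis ι ℂ h) (c : HilbertBasis κ ℂ h)
    (X : h →L[ℂ] h) : ∑' i, ‖X (b i)‖ₑ ^ 2 = ∑' j, ‖X (c j)‖ₑ ^ 2 := by
  rw [tsum_enorm_sq_adjoint b c, tsum_enorm_sq_adjoint c c X]

/-- The square of the norm of `ℒ²(h)` is `tr (X* X)`, computed in any orthonormal basis. -/
theorem enorm_sq_eq {ι : Type*} (b : HilbertBasis ι ℂ h) (X : HilbertSchmidt h) :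
    ‖X‖ₑ ^ 2 = ∑' i, ‖toCLM X (b i)‖ₑ ^ 2 := by
  have h1 : HasSum (fun i => ‖toCLM X (stdHilbertBasis h i)‖ ^ 2) (‖X‖ ^ 2) := by
    have := lp.hasSum_norm (p := 2) (by norm_num) (toLp X)
    simpa [norm_eq_norm_toLp, toLp] using this
  have h2 : ∀ y : h, ‖y‖ₑ ^ 2 = ENNReal.ofReal (‖y‖ ^ 2) := fun y => by
    rw [ENNReal.ofReal_pow (norm_nonneg _), ofReal_norm]
  rw [tsum_enorm_sq_eq b (stdHilbertBasis h), ← ofReal_norm, ← ENNReal.ofReal_pow (norm_nonneg _),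
    ← h1.tsum_eq, ENNReal.ofReal_tsum_of_nonneg (fun _ => by positivity) h1.summable]
  exact tsum_congr fun i => (h2 _).symm

/-- A bounded operator belongs to `ℒ²(h)` exactly if `tr (X* X)`, computed in any orthonormal
basis, is finite. -/
theorem exists_toCLM_eq_iff {ι : Type*} (b : HilbertBasis ι ℂ h) (X : h →L[ℂ] h) :
    (∃ Y : HilbertSchmidt h, toCLM Y = X) ↔ ∑' i, ‖X (b i)‖ₑ ^ 2 ≠ ⊤ := by
  constructor
  · rintro ⟨Y, rfl⟩
    rw [← enorm_sq_eq b Y]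
    finiteness
  · intro hX
    rw [tsum_enorm_sq_eq b (stdHilbertBasis h)] at hX
    refine ⟨⟨X, memℓp_gen ?_⟩, rfl⟩
    simpa using ENNReal.summable_toReal hX

end HilbertSchmidt

end HilbertSchmidt

section Flow

variable {h : Type*} [NormedAddCommGroup h] [InnerProductSpace ℂ h] [CompleteSpace h]

/-- The operator `Δ + Υ₀` with domain `D(Υ₀)`, for a bounded operator `Δ`. -/
noncomputable def flowOp (Υ₀ : h →ₗ.[ℂ] h) (Δ : h →L[ℂ] h) : h →ₗ.[ℂ] h :=
  (Δ : h →ₗ[ℂ] h) +ᵥ Υ₀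

theorem flowOp_domain (Υ₀ : h →ₗ.[ℂ] h) (Δ : h →L[ℂ] h) : (flowOp Υ₀ Δ).domain = Υ₀.domain := rfl

/-- `(Δ + Υ₀)^⊤` has the domain of `Υ₀^⊤`. -/
theorem flowOp_transposeOp_domain (C : Conjugation h) (Υ₀ : h →ₗ.[ℂ] h) (Δ : h →L[ℂ] h) :
    ((flowOp Υ₀ Δ).transposeOp C).domain = (Υ₀.transposeOp C).domain := by
  have key : (flowOp Υ₀ Δ).adjoint.domain = Υ₀.adjoint.domain := by
    ext y
    rw [LinearPMap.mem_adjoint_domain_iff, LinearPMap.mem_adjoint_domain_iff]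
    have hc : Continuous (fun x : Υ₀.domain => ⟪y, Δ (x : h)⟫_ℂ) := by fun_prop
    have h1 : ∀ x : Υ₀.domain, ((innerₛₗ ℂ y).comp (flowOp Υ₀ Δ).toFun) x =
        ⟪y, Δ (x : h)⟫_ℂ + ((innerₛₗ ℂ y).comp Υ₀.toFun) x := fun x => by
      change ⟪y, Δ (x : h) + Υ₀ x⟫_ℂ = ⟪y, Δ (x : h)⟫_ℂ + ⟪y, Υ₀ x⟫_ℂ
      exact inner_add_right _ _ _
    constructor
    · intro H
      refine (H.sub hc).congr fun x => ?_
      exact sub_eq_of_eq_add' (h1 x)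
    · intro H
      refine (hc.add H).congr fun x => ?_
      exact (h1 x).symm
  change Submodule.comap _ _ = Submodule.comap _ _
  rw [key]

/-- `B` is the operator `-2 ((Δ + Υ₀) D + D (Δ + Υ₀)^⊤)` on the domain
`D((Δ + Υ₀)^⊤) = D(Υ₀^⊤)`: for every `φ` in there, the vector `D φ` lies in
`D(Δ + Υ₀) = D(Υ₀)` and `B φ = -2 ((Δ + Υ₀) (D φ) + D ((Δ + Υ₀)^⊤ φ))`. -/
def IsFlowField (C : Conjugation h) (Υ₀ : h →ₗ.[ℂ] h) (Δ D B : h →L[ℂ] h) : Prop :=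
  ∀ φ : ((flowOp Υ₀ Δ).transposeOp C).domain, ∃ hφ : D φ ∈ (flowOp Υ₀ Δ).domain,
    B φ = (-2 : ℂ) • (flowOp Υ₀ Δ ⟨D φ, hφ⟩ + D ((flowOp Υ₀ Δ).transposeOp C φ))

/-- `(Δ, D)` is a continuous solution in `ℒ²(h)` of the elliptic operator-valued flow on
`[0, ∞)`, the derivatives being taken in the Hilbert-Schmidt norm (at `t = 0` the derivative of `Δ`
is one-sided). -/
structure IsHilbertSchmidtFlow (C : Conjugation h) (Υ₀ : h →ₗ.[ℂ] h) (D₀ : HilbertSchmidt h)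
    (Δ D : ℝ → HilbertSchmidt h) : Prop where
  continuousOn_Δ : ContinuousOn Δ (Ici 0)
  continuousOn_D : ContinuousOn D (Ici 0)
  Δ_zero : Δ 0 = 0
  D_zero : D 0 = D₀
  deriv_Δ : ∀ t : ℝ, 0 ≤ t → ∃ A : HilbertSchmidt h,
    A.toCLM = (16 : ℂ) • ((D t).toCLM ∘L (D t).toCLM.adjoint) ∧
    HasDerivWithinAt Δ A (Ici 0) t
  deriv_D : ∀ t : ℝ, 0 < t → ∃ B : HilbertSchmidt h,
    IsFlowField C Υ₀ (Δ t).toCLM (D t).toCLM B.toCLM ∧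
    HasDerivAt D B t

/-- `(Δ, D)` is a strongly continuous solution with values in the bounded operators of the elliptic
operator-valued flow on `[0, ∞)`, the derivatives being taken pointwise: on every vector of `h` for
`Δ`, and on every vector of the domain `D((Δ + Υ₀)^⊤) = D(Υ₀^⊤)` for `D`. -/
structure IsStrongFlow (C : Conjugation h) (Υ₀ : h →ₗ.[ℂ] h) (D₀ : h →L[ℂ] h)
    (Δ D : ℝ → h →L[ℂ] h) : Prop where
  continuousOn_Δ : ∀ φ : h, ContinuousOn (fun t => Δ t φ) (Ici 0)
  continuousOn_D : ∀ φ : h, ContinuousOn (fun t => D t φ) (Ici 0)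
  Δ_zero : Δ 0 = 0
  D_zero : D 0 = D₀
  deriv_Δ : ∀ t : ℝ, 0 ≤ t → ∀ φ : h,
    HasDerivWithinAt (fun s => Δ s φ) ((16 : ℂ) • D t ((D t).adjoint φ)) (Ici 0) t
  deriv_D : ∀ t : ℝ, 0 < t → ∀ φ : ((flowOp Υ₀ (Δ t)).transposeOp C).domain,
    ∃ hφ : D t φ ∈ (flowOp Υ₀ (Δ t)).domain,
      HasDerivAt (fun s => D s φ)
        ((-2 : ℂ) • (flowOp Υ₀ (Δ t) ⟨D t φ, hφ⟩ +
          D t ((flowOp Υ₀ (Δ t)).transposeOp C φ))) t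

/-- For every `t > 0` the two terms `(Δ + Υ₀) D` and `D (Δ + Υ₀)^⊤` are themselves Hilbert-Schmidt:
`D` maps all of `h` into `D(Υ₀)`, the everywhere defined operator `(Δ + Υ₀) D` is
Hilbert-Schmidt, and the densely defined `D (Δ + Υ₀)^⊤` extends to a Hilbert-Schmidt operator. -/
def HasHilbertSchmidtTerms (C : Conjugation h) (Υ₀ : h →ₗ.[ℂ] h)
    (Δ D : HilbertSchmidt h) : Prop :=
  (∃ A : HilbertSchmidt h, ∀ φ : h, ∃ hφ : D.toCLM φ ∈ (flowOp Υ₀ Δ.toCLM).domain,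
    flowOp Υ₀ Δ.toCLM ⟨D.toCLM φ, hφ⟩ = A.toCLM φ) ∧
  (∃ A : HilbertSchmidt h, ∀ φ : ((flowOp Υ₀ Δ.toCLM).transposeOp C).domain,
    D.toCLM ((flowOp Υ₀ Δ.toCLM).transposeOp C φ) = A.toCLM φ)

end Flow

/-! Put `c = μ + 1`, so that `A = Υ₀ + c ≥ 1`, and let `R = A⁻¹` (`exists_isShiftedInverse`). The
proof works with the bounded operator `R`. Multiplying the second equation by `R` on the left and
`R^⊤` on the right absorbs all domain questions, because `D(Υ₀^⊤)` is the range of `R^⊤`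
(`IsShiftedInverse.isFlowField_iff`). The semigroup `exp (-r A)` comes from the continuous
functional calculus of `R`.

Local existence. The linear part of the `D`-equation is solved by `T_t X = e^{4ct} e^{-2tA} X
(e^{-2tA})^⊤`, a strongly continuous family on `ℒ²(h)` for which `t T_t'` stays bounded as `t → 0`.
The remaining terms are quadratic and bounded. Picard iteration for the mild equation is run on `u`
and `t u'` together. It contracts on a time depending only on the size of the data, and its limit is
differentiable in the Hilbert-Schmidt norm for all small `t > 0`, whatever the initial datum
(`IsAnalyticKernel.exists_local_solution`, `IsShiftedInverse.exists_local_flow`).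

Uniqueness is proved in the larger, strong class (`IsStrongFlowOn.unique`). The matrix elements
`⟪e^{-2(t-s)A} ψ, D_s (e^{-2(t-s)A})^⊤ φ⟫` have an `s`-derivative free of unbounded operators, so
the difference of two solutions obeys a Gronwall estimate. Banach-Steinhaus supplies the local
bounds.

Regularity. If `A D + D A^⊤ = G` is Hilbert-Schmidt, then so is `A D`, since formally `Re ⟪A D, D
A^⊤⟫ = ‖A^{1/2} D (A^{1/2})^⊤‖₂² ≥ 0` and therefore `‖A D‖₂ ≤ ‖G‖₂`
(`IsShiftedInverse.exists_eq_mul`). This gives the last assertion of the theorem and justifies the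
energy estimate.

Global existence. `Δ` increases from `0`, so `Δ ≥ 0`. Together with `A ≥ 1` this yields `Re ⟪D, ∂_t
D⟫ ≤ 4 (c - 1) ‖D‖₂²` (`IsShiftedInverse.reInner_le`). The norms stay bounded on bounded time
intervals, and local solutions of a fixed length can be chained. -/

open Filter Topology

/-! ### Scalar functions behind the semigroup. -/

section ExpInv

/-- The function `x ↦ x⁻¹ ^ k * exp (-r / x)` on `(0, ∞)`, extended by zero. -/
noncomputable def expInv (k : ℕ) (r x : ℝ) : ℝ :=
  if 0 < x then x⁻¹ ^ k * Real.exp (-(r * x⁻¹)) else 0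

theorem expInv_nonneg (k : ℕ) (r x : ℝ) : 0 ≤ expInv k r x := by
  unfold expInv
  split_ifs with h
  · positivity
  · exact le_rfl

/-- This is `y ^ k / k! ≤ exp y` at `y = r / x`. The cases `k = 0, 1` give the operator bounds `1`
and `1 / r`. -/
theorem expInv_le (k : ℕ) {r : ℝ} (hr : 0 < r) (x : ℝ) : expInv k r x ≤ k.factorial / r ^ k := by
  unfold expInv
  split_ifs with h
  · have h1 := Real.pow_div_factorial_le_exp (r * x⁻¹) (by positivity) k
    rw [Real.exp_neg, ← div_eq_mul_inv, div_le_div_iff₀ (by positivity) (by positivity)]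
    rw [div_le_iff₀ (by positivity), mul_pow] at h1
    linarith
  · positivity

theorem mul_expInv_succ (k : ℕ) (r : ℝ) {x : ℝ} : x * expInv (k + 1) r x = expInv k r x := by
  unfold expInv
  split_ifs with h
  · rw [pow_succ]
    field_simp
  · simp

/-- At the only delicate point `0`, the function is `x` times its successor, which is bounded. -/
theorem continuousOn_expInv (k : ℕ) {r : ℝ} (hr : 0 < r) (s : Set ℝ) (hs : ∀ x ∈ s, 0 ≤ x) :
    ContinuousOn (expInv k r) s := by
  intro x hx
  rcases (hs x hx).lt_or_eq with h | h
  · refine ContinuousAt.continuousWithinAt ?_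
    have : (fun y : ℝ => y⁻¹ ^ k * Real.exp (-(r * y⁻¹))) =ᶠ[𝓝 x] expInv k r := by
      filter_upwards [lt_mem_nhds h] with y hy
      simp [expInv, hy]
    refine ContinuousAt.congr ?_ this
    have : ContinuousAt (fun y : ℝ => y⁻¹) x := continuousAt_inv₀ h.ne'
    fun_prop
  · subst h
    have h0 : expInv k r 0 = 0 := by simp [expInv]
    rw [ContinuousWithinAt, h0]
    have : Tendsto (fun y : ℝ => y * ((k + 1).factorial / r ^ (k + 1))) (𝓝[s] 0) (𝓝 0) := by
      have h1 : Continuous fun y : ℝ => y * ((k + 1).factorial / r ^ (k + 1)) := by fun_prop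
      simpa using (h1.tendsto 0).mono_left nhdsWithin_le_nhds
    refine tendsto_of_tendsto_of_tendsto_of_le_of_le' tendsto_const_nhds this
      (Eventually.of_forall fun y => expInv_nonneg _ _ _) ?_
    filter_upwards [self_mem_nhdsWithin] with y hy
    rw [← mul_expInv_succ]
    exact mul_le_mul_of_nonneg_left (expInv_le _ hr y) (hs y hy)

theorem abs_exp_sub_one_sub_le (y : ℝ) : |Real.exp y - 1 - y| ≤ y ^ 2 * Real.exp |y| := by
  have h1 := Real.add_one_le_exp y
  have h2 := Real.add_one_le_exp (-y)
  have h3 : Real.exp y * Real.exp (-y) = 1 := by rw [← Real.exp_add]; simp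
  rw [abs_of_nonneg (by linarith)]
  have h4 : Real.exp y - 1 ≤ y * Real.exp y := by nlinarith [Real.exp_pos y]
  rcases le_or_gt 0 y with h | h
  · rw [abs_of_nonneg h]
    nlinarith
  · have h5 : (1 : ℝ) ≤ Real.exp |y| := Real.one_le_exp (abs_nonneg y)
    nlinarith [sq_nonneg y]

/-- A second order Taylor bound in `r`, uniform in `x`, so that it passes to operators in norm. The
condition `|k| ≤ r / 2` leaves half of the exponential decay to absorb the powers of `x⁻¹`. -/
theorem abs_expInv_add_sub_le (j : ℕ) {r k : ℝ} (hr : 0 < r) (hk : |k| ≤ r / 2) (x : ℝ) :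
    |expInv j (r + k) x - expInv j r x + k * expInv (j + 1) r x| ≤
      (j + 2).factorial / (r / 2) ^ (j + 2) * k ^ 2 := by
  have h1 : |expInv j (r + k) x - expInv j r x + k * expInv (j + 1) r x| ≤
      k ^ 2 * expInv (j + 2) (r / 2) x := by
    unfold expInv
    split_ifs with h
    · have e1 : x⁻¹ ^ j * Real.exp (-((r + k) * x⁻¹)) - x⁻¹ ^ j * Real.exp (-(r * x⁻¹)) +
          k * (x⁻¹ ^ (j + 1) * Real.exp (-(r * x⁻¹))) =
          x⁻¹ ^ j * Real.exp (-(r * x⁻¹)) * (Real.exp (-(k * x⁻¹)) - 1 - -(k * x⁻¹)) := by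
        rw [add_mul, neg_add, Real.exp_add]
        ring
      rw [e1, abs_mul, abs_of_pos (by positivity)]
      calc x⁻¹ ^ j * Real.exp (-(r * x⁻¹)) * |Real.exp (-(k * x⁻¹)) - 1 - -(k * x⁻¹)|
          ≤ x⁻¹ ^ j * Real.exp (-(r * x⁻¹)) * ((-(k * x⁻¹)) ^ 2 * Real.exp |-(k * x⁻¹)|) := by
            gcongr
            exact abs_exp_sub_one_sub_le _
        _ = k ^ 2 * (x⁻¹ ^ (j + 2) * Real.exp (-(r * x⁻¹) + |k| * x⁻¹)) := by
            rw [Real.exp_add, abs_neg, abs_mul, abs_of_pos (inv_pos.2 h)]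
            ring
        _ ≤ k ^ 2 * (x⁻¹ ^ (j + 2) * Real.exp (-(r / 2 * x⁻¹))) := by
            have : |k| * x⁻¹ ≤ r / 2 * x⁻¹ := mul_le_mul_of_nonneg_right hk (by positivity)
            gcongr
            linarith
    · simp
  refine h1.trans ?_
  rw [mul_comm]
  gcongr
  exact expInv_le (j + 2) (half_pos hr) x

end ExpInv

/-! ### The semigroup of the inverse of a positive operator. -/

section Semigroup

variable {h : Type*} [NormedAddCommGroup h] [InnerProductSpace ℂ h] [CompleteSpace h]

/-- The semigroup `exp (-r R⁻¹)`, equal to `1` for `r ≤ 0`. -/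
noncomputable def invSemigroup (R : h →L[ℂ] h) (r : ℝ) : h →L[ℂ] h :=
  if 0 < r then cfc (expInv 0 r) R else 1

/-- The operator `R⁻¹ exp (-r R⁻¹)` for `r > 0`, extended by zero. -/
noncomputable def invSemigroupGen (R : h →L[ℂ] h) (r : ℝ) : h →L[ℂ] h :=
  if 0 < r then cfc (expInv 1 r) R else 0

variable {R : h →L[ℂ] h}

theorem invSemigroup_of_nonpos {r : ℝ} (hr : r ≤ 0) : invSemigroup R r = 1 :=
  if_neg hr.not_gt

theorem invSemigroupGen_of_nonpos {r : ℝ} (hr : r ≤ 0) : invSemigroupGen R r = 0 :=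
  if_neg hr.not_gt

theorem isSelfAdjoint_invSemigroup (r : ℝ) : IsSelfAdjoint (invSemigroup R r) := by
  unfold invSemigroup
  split_ifs
  · exact cfc_predicate _ _
  · exact .one _

theorem isSelfAdjoint_invSemigroupGen (r : ℝ) : IsSelfAdjoint (invSemigroupGen R r) := by
  unfold invSemigroupGen
  split_ifs
  · exact cfc_predicate _ _
  · exact .zero _

theorem norm_invSemigroup_le (r : ℝ) : ‖invSemigroup R r‖ ≤ 1 := by
  unfold invSemigroup
  split_ifs with hr
  · refine norm_cfc_le zero_le_one fun x _ => ?_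
    rw [Real.norm_of_nonneg (expInv_nonneg _ _ _)]
    simpa using expInv_le 0 hr x
  · exact ContinuousLinearMap.norm_id_le

theorem norm_smul_invSemigroupGen_le (r : ℝ) : ‖r • invSemigroupGen R r‖ ≤ 1 := by
  rw [norm_smul]
  unfold invSemigroupGen
  split_ifs with hr
  · have : ‖cfc (expInv 1 r) R‖ ≤ 1 / r := by
      refine norm_cfc_le (by positivity) fun x _ => ?_
      rw [Real.norm_of_nonneg (expInv_nonneg _ _ _)]
      simpa using expInv_le 1 hr x
    rw [Real.norm_of_nonneg hr.le]
    calc r * _ ≤ r * (1 / r) := by gcongr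
      _ = 1 := by field_simp
  · simp

theorem continuousOn_expInv_spectrum (hR : 0 ≤ R) (k : ℕ) {r : ℝ} (hr : 0 < r) :
    ContinuousOn (expInv k r) (spectrum ℝ R) :=
  continuousOn_expInv k hr _ fun _ hx => spectrum_nonneg_of_nonneg hR hx

theorem mul_invSemigroupGen (hR : 0 ≤ R) {r : ℝ} (hr : 0 < r) :
    R * invSemigroupGen R r = invSemigroup R r := by
  have hc := continuousOn_expInv_spectrum hR 1 hr
  have hsa : IsSelfAdjoint R := .of_nonneg hR
  rw [invSemigroup, invSemigroupGen, if_pos hr, if_pos hr]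
  have h1 := cfc_mul (fun x => x) (expInv 1 r) R
  rw [cfc_id' ℝ R] at h1
  rw [← h1]
  exact cfc_congr fun x _ => mul_expInv_succ 0 r

theorem invSemigroupGen_mul (hR : 0 ≤ R) {r : ℝ} (hr : 0 < r) :
    invSemigroupGen R r * R = invSemigroup R r := by
  have h1 := congrArg star (mul_invSemigroupGen hR hr)
  rwa [star_mul, (isSelfAdjoint_invSemigroup r).star_eq, (isSelfAdjoint_invSemigroupGen r).star_eq,
    (IsSelfAdjoint.of_nonneg hR).star_eq] at h1

theorem invSemigroup_comm (hR : 0 ≤ R) (r : ℝ) : invSemigroup R r * R = R * invSemigroup R r := by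
  rcases le_or_gt r 0 with hr | hr
  · simp [invSemigroup_of_nonpos hr]
  · rw [← mul_invSemigroupGen hR hr, mul_assoc, invSemigroupGen_mul hR hr, ← mul_invSemigroupGen hR hr]

theorem hasDerivAt_cfc_expInv (hR : 0 ≤ R) (j : ℕ) {r : ℝ} (hr : 0 < r) :
    HasDerivAt (fun r => cfc (expInv j r) R) (-cfc (expInv (j + 1) r) R) r := by
  rw [hasDerivAt_iff_isLittleO_nhds_zero]
  refine Asymptotics.IsBigO.trans_isLittleO (g := fun k : ℝ => k ^ 2) ?_ ?_
  · refine Asymptotics.IsBigO.of_bound ((j + 2).factorial / (r / 2) ^ (j + 2)) ?_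
    have : {k : ℝ | |k| < r / 2} ∈ 𝓝 (0 : ℝ) := by
      have h2 : Continuous fun k : ℝ => |k| := continuous_abs
      exact h2.continuousAt.preimage_mem_nhds (Iio_mem_nhds (by simpa using hr))
    filter_upwards [this] with k hk
    have hk' : |k| < r / 2 := hk
    have hrk : 0 < r + k := by linarith [(abs_lt.1 hk').1]
    have h0 := continuousOn_expInv_spectrum hR j hr
    have h1 := continuousOn_expInv_spectrum hR (j + 1) hr
    have h0' := continuousOn_expInv_spectrum hR j hrk
    have hsa : IsSelfAdjoint R := .of_nonneg hR
    rw [smul_neg, sub_neg_eq_add, ← cfc_sub _ _ R, ← cfc_const_mul k _ R, ← cfc_add R _ _]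
    refine norm_cfc_le (by positivity) fun x _ => ?_
    rw [Real.norm_of_nonneg (sq_nonneg k), Real.norm_eq_abs]
    exact abs_expInv_add_sub_le j hr hk'.le x
  · simpa using Asymptotics.isLittleO_pow_pow (𝕜 := ℝ) (m := 1) (n := 2) (by norm_num)

theorem hasDerivAt_invSemigroup (hR : 0 ≤ R) {r : ℝ} (hr : 0 < r) :
    HasDerivAt (invSemigroup R) (-invSemigroupGen R r) r := by
  have := hasDerivAt_cfc_expInv hR 0 hr
  rw [invSemigroupGen, if_pos hr]
  refine this.congr_of_eventuallyEq ?_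
  filter_upwards [lt_mem_nhds hr] with s hs
  rw [invSemigroup, if_pos hs]

theorem continuousAt_invSemigroupGen (hR : 0 ≤ R) {r : ℝ} (hr : 0 < r) :
    ContinuousAt (invSemigroupGen R) r := by
  refine (hasDerivAt_cfc_expInv hR 1 hr).continuousAt.congr ?_
  filter_upwards [lt_mem_nhds hr] with s hs
  rw [invSemigroupGen, if_pos hs]

/-- On the spectrum, `x (1 - exp (-r / x)) ≤ r`. This norm convergence after multiplication by `R`
gives strong continuity at `0`, the range of `R` being dense. -/
theorem norm_invSemigroup_mul_sub_le (hR : 0 ≤ R) {r : ℝ} (hr : 0 < r) :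
    ‖invSemigroup R r * R - R‖ ≤ r := by
  have h0 := continuousOn_expInv_spectrum hR 0 hr
  have hsa : IsSelfAdjoint R := .of_nonneg hR
  have : invSemigroup R r * R - R = cfc (fun x => expInv 0 r x * x - x) R := by
    rw [cfc_sub (fun x => expInv 0 r x * x) (fun x => x) R, cfc_mul (expInv 0 r) (fun x => x) R,
      cfc_id' ℝ R, invSemigroup, if_pos hr]
  rw [this]
  refine norm_cfc_le hr.le fun x hx => ?_
  unfold expInv
  split_ifs with h
  · have h1 := Real.add_one_le_exp (-(r * x⁻¹))
    have h2 : Real.exp (-(r * x⁻¹)) ≤ 1 := Real.exp_le_one_iff.2 (by simp; positivity)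
    rw [Real.norm_eq_abs, abs_of_nonpos (by nlinarith)]
    have : x * (r * x⁻¹) = r := by field_simp
    nlinarith
  · have : x = 0 := le_antisymm (not_lt.1 h) (spectrum_nonneg_of_nonneg hR hx)
    simp [this, hr.le]

/-- Strong convergence of a bounded family of operators follows from convergence on the range of
an operator with dense range. -/
theorem tendsto_apply_of_tendsto_mul {α : Type*} {l : Filter α} {B : α → h →L[ℂ] h}
    {B₀ : h →L[ℂ] h} {M : ℝ} (hd : DenseRange R) (hB : ∀ᶠ a in l, ‖B a‖ ≤ M)
    (hl : Tendsto (fun a => B a * R) l (𝓝 (B₀ * R))) (φ : h) :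
    Tendsto (fun a => B a φ) l (𝓝 (B₀ φ)) := by
  rw [Metric.tendsto_nhds]
  intro ε hε
  set N := |M| + ‖B₀‖ + 1 with hN
  have hNpos : 0 < N := by positivity
  obtain ⟨ψ, hψ⟩ := hd.exists_dist_lt φ (show 0 < ε / (2 * N) by positivity)
  have h1 : Tendsto (fun a => (B a * R) ψ) l (𝓝 ((B₀ * R) ψ)) :=
    ((ContinuousLinearMap.apply ℂ h ψ).continuous.tendsto _).comp hl
  filter_upwards [hB, Metric.tendsto_nhds.1 h1 (ε / 2) (half_pos hε)] with a ha h2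
  have h3 : B a φ - B₀ φ = (B a - B₀) (φ - R ψ) + ((B a * R) ψ - (B₀ * R) ψ) := by
    simp only [map_sub, sub_apply, mul_apply_eq_comp]
    abel
  rw [dist_eq_norm] at h2 hψ ⊢
  rw [h3]
  have h4 : ‖(B a - B₀) (φ - R ψ)‖ ≤ N * (ε / (2 * N)) := by
    refine (ContinuousLinearMap.le_opNorm _ _).trans ?_
    have : ‖B a - B₀‖ ≤ N := by
      refine (norm_sub_le _ _).trans ?_
      linarith [le_abs_self M]
    gcongr
  have h5 : N * (ε / (2 * N)) = ε / 2 := by field_simp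
  linarith [norm_add_le ((B a - B₀) (φ - R ψ)) ((B a * R) ψ - (B₀ * R) ψ)]

theorem tendsto_invSemigroup_zero (hR : 0 ≤ R) (hd : DenseRange R) (φ : h) :
    Tendsto (fun r => invSemigroup R r φ) (𝓝 0) (𝓝 φ) := by
  refine tendsto_apply_of_tendsto_mul (B₀ := 1) hd
    (Eventually.of_forall fun r => norm_invSemigroup_le r) ?_ φ
  rw [tendsto_iff_norm_sub_tendsto_zero]
  refine squeeze_zero (fun _ => norm_nonneg _) (g := fun r : ℝ => |r|) (fun r => ?_)
    (by simpa using (continuous_abs (G := ℝ)).tendsto 0)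
  rcases le_or_gt r 0 with hr | hr
  · simp [invSemigroup_of_nonpos hr]
  · simpa [abs_of_pos hr] using norm_invSemigroup_mul_sub_le hR hr

/-- Multiplied by `R`, the operator becomes `r` times a contraction; the uniform bound `1` and
density do the rest. Hence `t` times the derivative of the semigroup extends strongly continuously
by `0` to `t = 0`. -/
theorem tendsto_smul_invSemigroupGen_zero (hR : 0 ≤ R) (hd : DenseRange R) (φ : h) :
    Tendsto (fun r : ℝ => (r • invSemigroupGen R r) φ) (𝓝 0) (𝓝 0) := by
  refine tendsto_apply_of_tendsto_mul (B₀ := 0) hd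
    (Eventually.of_forall fun r => norm_smul_invSemigroupGen_le r) ?_ φ
  rw [zero_mul, tendsto_zero_iff_norm_tendsto_zero]
  refine squeeze_zero (fun _ => norm_nonneg _) (g := fun r : ℝ => |r|) (fun r => ?_)
    (by simpa using (continuous_abs (G := ℝ)).tendsto 0)
  rcases le_or_gt r 0 with hr | hr
  · simp [invSemigroupGen_of_nonpos hr]
  · rw [smul_mul_assoc, invSemigroupGen_mul hR hr, norm_smul]
    exact mul_le_of_le_one_right (abs_nonneg r) (norm_invSemigroup_le r)

theorem continuous_invSemigroup_apply (hR : 0 ≤ R) (hd : DenseRange R) (φ : h) :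
    Continuous fun r => invSemigroup R r φ := by
  rw [continuous_iff_continuousAt]
  intro r
  rcases lt_trichotomy r 0 with hr | rfl | hr
  · refine continuousAt_const.congr (f := fun _ => φ) ?_
    filter_upwards [gt_mem_nhds hr] with s hs
    simp [invSemigroup_of_nonpos hs.le]
  · have := tendsto_invSemigroup_zero hR hd φ
    rw [ContinuousAt]
    simpa [invSemigroup_of_nonpos le_rfl] using this
  · exact (hasDerivAt_invSemigroup hR hr).continuousAt.clm_apply continuousAt_const

theorem continuous_smul_invSemigroupGen_apply (hR : 0 ≤ R) (hd : DenseRange R) (φ : h) :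
    Continuous fun r : ℝ => (r • invSemigroupGen R r) φ := by
  rw [continuous_iff_continuousAt]
  intro r
  rcases lt_trichotomy r 0 with hr | rfl | hr
  · refine continuousAt_const.congr (f := fun _ => 0) ?_
    filter_upwards [gt_mem_nhds hr] with s hs
    simp [invSemigroupGen_of_nonpos hs.le]
  · have := tendsto_smul_invSemigroupGen_zero hR hd φ
    rw [ContinuousAt]
    simpa using this
  · exact (continuousAt_id.smul (continuousAt_invSemigroupGen hR hr)).clm_apply continuousAt_const

/-- A regularised form of `A = A^{1/2} A^{1/2}`; it exhibits the cross term of the Sylvester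
equation as a square. -/
theorem exists_sq_eq_invSemigroupGen_mul (hR : 0 ≤ R) {r : ℝ} (hr : 0 < r) :
    ∃ B : h →L[ℂ] h, IsSelfAdjoint B ∧ B * B = invSemigroupGen R r * invSemigroup R r := by
  have hc0 := continuousOn_expInv_spectrum hR 0 hr
  have hc1 := continuousOn_expInv_spectrum hR 1 hr
  have h1 : 0 ≤ invSemigroupGen R r * invSemigroup R r := by
    rw [invSemigroup, invSemigroupGen, if_pos hr, if_pos hr, ← cfc_mul (expInv 1 r) (expInv 0 r) R]
    exact cfc_nonneg fun x _ => mul_nonneg (expInv_nonneg _ _ _) (expInv_nonneg _ _ _)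
  exact ⟨CFC.sqrt _, .of_nonneg (CFC.sqrt_nonneg _), CFC.sqrt_mul_sqrt_self _ h1⟩

end Semigroup

/-! ### Strongly continuous families of operators. -/

section StrongFamilies

variable {𝕜 E F : Type*} [NontriviallyNormedField 𝕜] [NormedAddCommGroup E] [NormedSpace 𝕜 E]
  [NormedAddCommGroup F] [NormedSpace 𝕜 F]

theorem tendsto_clm_apply_of_bounded {α : Type*} {l : Filter α} {B : α → E →L[𝕜] F} {v : α → E}
    {M : ℝ} {x : E} {y : F} (hM : ∀ᶠ a in l, ‖B a‖ ≤ M) (hB : Tendsto (fun a => B a x) l (𝓝 y))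
    (hv : Tendsto v l (𝓝 x)) : Tendsto (fun a => B a (v a)) l (𝓝 y) := by
  have h1 : Tendsto (fun a => B a (v a - x)) l (𝓝 0) := by
    refine squeeze_zero_norm' (a := fun a => M * ‖v a - x‖) ?_ ?_
    · filter_upwards [hM] with a ha
      exact (B a).le_of_opNorm_le ha _
    · simpa using (tendsto_iff_norm_sub_tendsto_zero.1 hv).const_mul M
  simpa using h1.add hB

theorem ContinuousOn.clm_apply_of_bounded {X : Type*} [TopologicalSpace X] {B : X → E →L[𝕜] F}
    {v : X → E} {M : ℝ} {s : Set X} (hM : ∀ a ∈ s, ‖B a‖ ≤ M)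
    (hB : ∀ x, ContinuousOn (fun a => B a x) s) (hv : ContinuousOn v s) :
    ContinuousOn (fun a => B a (v a)) s := fun a ha =>
  tendsto_clm_apply_of_bounded (eventually_nhdsWithin_of_forall hM) (hB (v a) a ha) (hv a ha)

theorem exists_norm_le_of_continuousOn_apply [CompleteSpace E] {X : Type*} [TopologicalSpace X]
    {B : X → E →L[𝕜] F} {s : Set X} (hs : IsCompact s)
    (hB : ∀ x, ContinuousOn (fun a => B a x) s) : ∃ M, ∀ a ∈ s, ‖B a‖ ≤ M := by
  obtain ⟨M, hM⟩ := banach_steinhaus (g := fun a : s => B a) fun x => by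
    obtain ⟨N, hN⟩ := hs.exists_bound_of_continuousOn (hB x)
    exact ⟨N, fun a => hN a a.2⟩
  exact ⟨M, fun a ha => hM ⟨a, ha⟩⟩

end StrongFamilies

/-! ### A product rule for strong derivatives. -/

section StrongDeriv

variable {E F : Type*} [NormedAddCommGroup E] [NormedSpace ℝ E]
  [NormedAddCommGroup F] [NormedSpace ℝ F]

/-- The product rule for a strongly differentiable family of operators. -/
theorem HasDerivAt.clm_apply_of_bounded {B : ℝ → E →L[ℝ] F} {v : ℝ → E} {v' : E} {b : F} {M t : ℝ}
    (hM : ∀ᶠ s in 𝓝 t, ‖B s‖ ≤ M) (hB : HasDerivAt (fun s => B s (v t)) b t)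
    (hv : HasDerivAt v v' t) (hc : ContinuousAt (fun s => B s v') t) :
    HasDerivAt (fun s => B s (v s)) (b + B t v') t := by
  -- `B s (v s)` is `B s (v t)` plus `(s - t) • B s v'` plus `B s` applied to an `o(s - t)`
  -- remainder. Strong continuity at the single vector `v'` handles the second term, the uniform
  -- bound the third.
  rw [hasDerivAt_iff_isLittleO] at hB hv ⊢
  have h1 : (fun s => B s (v s - v t - (s - t) • v')) =o[𝓝 t] fun s => s - t := by
    refine Asymptotics.IsBigO.trans_isLittleO ?_ hv
    refine Asymptotics.IsBigO.of_bound M ?_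
    filter_upwards [hM] with s hs using (B s).le_of_opNorm_le hs _
  have h2 : (fun s => (s - t) • (B s v' - B t v')) =o[𝓝 t] fun s => s - t := by
    have h3 : (fun s => B s v' - B t v') =o[𝓝 t] fun _ => (1 : ℝ) := by
      rw [Asymptotics.isLittleO_one_iff]
      simpa using hc.tendsto.sub_const (B t v')
    simpa using (Asymptotics.isBigO_refl (fun s => s - t) (𝓝 t)).smul_isLittleO h3
  refine ((hB.add h1).add h2).congr_left fun s => ?_
  simp only [map_sub, map_smul, smul_sub, smul_add]
  abel

end StrongDeriv

/-! ### Duhamel integrals for kernels `T` with `t T'` bounded. -/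

section MildIntegral

variable {E : Type*} [NormedAddCommGroup E] [NormedSpace ℝ E]

/-- The average `t⁻¹ ∫ s in 0..t, H (t - s) (g s)`. -/
noncomputable def mildIntegral (H : ℝ → E →L[ℝ] E) (g : ℝ → E) (t : ℝ) : E :=
  ∫ θ in (0 : ℝ)..1, H (t * (1 - θ)) (g (t * θ))

/-- A strongly continuous family of operators on `ℝ` that is bounded on half-lines. -/
structure IsStrongKernel (H : ℝ → E →L[ℝ] E) : Prop where
  continuous_apply : ∀ x, Continuous fun t => H t x
  exists_norm_le : ∀ b : ℝ, ∃ M, ∀ t ≤ b, ‖H t‖ ≤ M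

variable {H T K : ℝ → E →L[ℝ] E} {g g₁ g₂ : ℝ → E}

theorem IsStrongKernel.continuous_clm_apply (hH : IsStrongKernel H) {X : Type*}
    [TopologicalSpace X] {f : X → ℝ} {v : X → E} (hf : Continuous f) (hv : Continuous v) :
    Continuous fun p => H (f p) (v p) := by
  rw [continuous_iff_continuousAt]
  intro p
  obtain ⟨M, hM⟩ := hH.exists_norm_le (f p + 1)
  refine tendsto_clm_apply_of_bounded (M := M) ?_
    (((hH.continuous_apply (v p)).comp hf).continuousAt) hv.continuousAt
  filter_upwards [hf.continuousAt.eventually_lt_const (lt_add_one (f p))] with a ha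
  exact hM _ ha.le

theorem IsStrongKernel.continuous_integrand (hH : IsStrongKernel H) (hg : Continuous g) :
    Continuous (Function.uncurry fun t θ : ℝ => H (t * (1 - θ)) (g (t * θ))) :=
  hH.continuous_clm_apply (f := fun p : ℝ × ℝ => p.1 * (1 - p.2)) (v := fun p => g (p.1 * p.2))
    (by fun_prop) (by fun_prop)

theorem IsStrongKernel.intervalIntegrable (hH : IsStrongKernel H) (hg : Continuous g) (t : ℝ) :
    IntervalIntegrable (fun θ : ℝ => H (t * (1 - θ)) (g (t * θ))) MeasureTheory.volume 0 1 :=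
  ((hH.continuous_integrand hg).comp (Continuous.prodMk_right t)).intervalIntegrable _ _

theorem IsStrongKernel.continuous_mildIntegral (hH : IsStrongKernel H) (hg : Continuous g) :
    Continuous (mildIntegral H g) :=
  intervalIntegral.continuous_parametric_intervalIntegral_of_continuous'
    (hH.continuous_integrand hg) 0 1

theorem IsStrongKernel.mildIntegral_sub (hH : IsStrongKernel H) (h₁ : Continuous g₁)
    (h₂ : Continuous g₂) (t : ℝ) :
    mildIntegral H g₁ t - mildIntegral H g₂ t = mildIntegral H (fun s => g₁ s - g₂ s) t := by
  simp only [mildIntegral, map_sub]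
  rw [intervalIntegral.integral_sub (hH.intervalIntegrable h₁ t) (hH.intervalIntegrable h₂ t)]

theorem norm_mildIntegral_le {C D τ t : ℝ} (hC : ∀ s ≤ 1, ‖H s‖ ≤ C) (hτ : τ ≤ 1)
    (hg : ∀ s ∈ Icc 0 τ, ‖g s‖ ≤ D) (ht : t ∈ Icc 0 τ) : ‖mildIntegral H g t‖ ≤ C * D := by
  have h1 := intervalIntegral.norm_integral_le_of_norm_le_const (a := 0) (b := 1) (C := C * D)
    (f := fun θ : ℝ => H (t * (1 - θ)) (g (t * θ))) fun θ hθ => by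
      rw [uIoc_of_le zero_le_one] at hθ
      have h2 : t * (1 - θ) ≤ 1 := by nlinarith [hθ.1, hθ.2, ht.1, ht.2]
      have h3 : t * θ ∈ Icc 0 τ := ⟨by nlinarith [hθ.1, ht.1], by nlinarith [hθ.1, hθ.2, ht.1, ht.2]⟩
      refine ((H _).le_opNorm _).trans ?_
      gcongr
      · exact (norm_nonneg _).trans (hC 1 le_rfl)
      · exact hC _ h2
      · exact hg _ h3
  simpa [mildIntegral] using h1

/-- `K t = t T' t` for the strong derivative `T'` of `T`. -/
structure IsAnalyticKernel (T K : ℝ → E →L[ℝ] E) : Prop where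
  left : IsStrongKernel T
  right : IsStrongKernel K
  hasDerivAt : ∀ t > 0, ∀ x, HasDerivAt (fun s => T s x) (t⁻¹ • K t x) t

/-- Differentiation of `t ↦ mildIntegral T F t` if `t F' = G`. -/
theorem IsAnalyticKernel.hasDerivAt_mildIntegral (hT : IsAnalyticKernel T K) {F G : ℝ → E}
    (hF : Continuous F) (hG : Continuous G) (hFG : ∀ t > 0, HasDerivAt F (t⁻¹ • G t) t) {t : ℝ}
    (ht : 0 < t) :
    HasDerivAt (mildIntegral T F) (t⁻¹ • (mildIntegral K F t + mildIntegral T G t)) t := by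
  have hK1 := hT.right.continuous_integrand hF
  have hT1 := hT.left.continuous_integrand hG
  -- With the substitution `s = t θ` the limits of integration are fixed, and `s ∂_s [T (s (1 - θ))
  -- (F (s θ))]` equals `K F + T G` at the same arguments. The derivatives of `T` and `F` may blow
  -- up at `0`, but `K` and `G` do not, so `F'` is dominated for `s` away from `0`.
  set F' : ℝ → ℝ → E := fun s θ =>
    s⁻¹ • (K (s * (1 - θ)) (F (s * θ)) + T (s * (1 - θ)) (G (s * θ))) with hF'
  have hcont : ContinuousOn (Function.uncurry F') (Icc (t / 2) (2 * t) ×ˢ Icc 0 1) := by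
    have h1 : ContinuousOn (fun p : ℝ × ℝ => p.1⁻¹) (Icc (t / 2) (2 * t) ×ˢ Icc 0 1) := by
      refine ContinuousOn.inv₀ continuousOn_fst fun p hp => ?_
      have : t / 2 ≤ p.1 := hp.1.1
      exact (by linarith : 0 < p.1).ne'
    exact h1.smul (hK1.add hT1).continuousOn
  obtain ⟨M, hM⟩ := (isCompact_Icc.prod isCompact_Icc).exists_bound_of_continuousOn hcont
  have hs : Ioo (t / 2) (2 * t) ∈ 𝓝 t := Ioo_mem_nhds (by linarith) (by linarith)
  have key := (intervalIntegral.hasDerivAt_integral_of_dominated_loc_of_deriv_le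
    (F := fun s θ => T (s * (1 - θ)) (F (s * θ))) (F' := F') (x₀ := t) (a := 0) (b := 1)
    (bound := fun _ => M) (μ := MeasureTheory.volume) hs ?_ ?_ ?_ ?_ ?_ ?_).2
  · convert! key using 1
    rw [hF', intervalIntegral.integral_smul, intervalIntegral.integral_add]
    · rfl
    · exact hT.right.intervalIntegrable hF t
    · exact hT.left.intervalIntegrable hG t
  · exact Eventually.of_forall fun s =>
      ((hT.left.continuous_integrand hF).comp (Continuous.prodMk_right s)).aestronglyMeasurable
  · exact hT.left.intervalIntegrable hF t
  · exact ((((hK1.comp (Continuous.prodMk_right t)).add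
      (hT1.comp (Continuous.prodMk_right t))).const_smul t⁻¹)).aestronglyMeasurable
  · refine Eventually.of_forall fun θ hθ s hs => ?_
    rw [uIoc_of_le zero_le_one] at hθ
    exact hM (s, θ) ⟨Ioo_subset_Icc_self hs, Ioc_subset_Icc_self hθ⟩
  · exact intervalIntegrable_const
  -- At `θ = 1` the derivative of `T` at time `0` would be needed.
  · have h1 : ∀ᵐ θ : ℝ, θ ≠ 1 := by
      simp [MeasureTheory.ae_iff]
    filter_upwards [h1] with θ hθ1 hθ s hs
    rw [uIoc_of_le zero_le_one] at hθ
    have hθ' : 0 < 1 - θ := by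
      have := lt_of_le_of_ne hθ.2 hθ1
      linarith
    have hs0 : 0 < s := by linarith [hs.1]
    have hp1 : 0 < s * (1 - θ) := by positivity
    have hp2 : 0 < s * θ := mul_pos hs0 hθ.1
    obtain ⟨N, hN⟩ := hT.left.exists_norm_le (s * (1 - θ) + 1)
    have d1 : HasDerivAt (fun r : ℝ => r * (1 - θ)) (1 - θ) s := by
      simpa using (hasDerivAt_id s).mul_const (1 - θ)
    have d2 : HasDerivAt (fun r : ℝ => r * θ) θ s := by
      simpa using (hasDerivAt_id s).mul_const θ
    have d3 := (hT.hasDerivAt _ hp1 (F (s * θ))).scomp s d1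
    have d4 := (hFG _ hp2).scomp s d2
    have := HasDerivAt.clm_apply_of_bounded (B := fun r => T (r * (1 - θ))) (M := N) ?_ d3 d4 ?_
    · convert! this using 1
      simp only [hF', smul_add, smul_smul, map_smul]
      congr 2
      · field_simp
      · field_simp [hθ.1.ne']
    · have hc : ContinuousAt (fun r : ℝ => r * (1 - θ)) s := by fun_prop
      filter_upwards [hc.eventually_lt_const (lt_add_one _)] with r hr using hN _ hr.le
    · exact ((hT.left.continuous_apply _).comp (continuous_id.mul continuous_const)).continuousAt

/-- One component of the Picard step. -/
noncomputable def picardStep (T : ℝ → E →L[ℝ] E) (x : E) (F : ℝ → E) (t : ℝ) : E :=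
  T t x + t • mildIntegral T F t

/-- The function `t ↦ t u' t` for `u = picardStep T x F`. -/
noncomputable def picardStepDeriv (T K : ℝ → E →L[ℝ] E) (x : E) (F G : ℝ → E) (t : ℝ) : E :=
  K t x + t • (mildIntegral T F t + (mildIntegral K F t + mildIntegral T G t))

theorem IsAnalyticKernel.hasDerivAt_picardStep (hT : IsAnalyticKernel T K) {F G : ℝ → E} (x : E)
    (hF : Continuous F) (hG : Continuous G) (hFG : ∀ t > 0, HasDerivAt F (t⁻¹ • G t) t) {t : ℝ}
    (ht : 0 < t) :
    HasDerivAt (picardStep T x F) (t⁻¹ • picardStepDeriv T K x F G t) t := by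
  have h1 := (hT.hasDerivAt t ht x).add
    ((hasDerivAt_id t).smul (hT.hasDerivAt_mildIntegral hF hG hFG ht))
  convert! h1 using 1
  simp only [picardStepDeriv, smul_add, smul_smul, id]
  field_simp
  module

/-- The equation satisfied by the Picard step. -/
theorem IsAnalyticKernel.apply_picardStepDeriv [CompleteSpace E] (hT : IsAnalyticKernel T K)
    (hT0 : T 0 = 1) {j ℓ : E →L[ℝ] E} (hj : ∀ t x, j (T t x) = T t (j x))
    (hℓ : ∀ t x, ℓ (T t x) = T t (ℓ x)) (hK : ∀ t ≥ 0, ∀ x, j (K t x) = t • ℓ (T t x))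
    (hKj : ∀ t x, j (K t x) = K t (j x))
    {F G : ℝ → E} (x : E)
    (hF : Continuous F) (hG : Continuous G) (hFG : ∀ t > 0, HasDerivAt F (t⁻¹ • G t) t) {t : ℝ}
    (ht : 0 < t) :
    j (picardStepDeriv T K x F G t) = t • (ℓ (picardStep T x F t) + j (F t)) := by
  have hTF := hT.left.intervalIntegrable hF t
  have hKF := hT.right.intervalIntegrable hF t
  have hTG := hT.left.intervalIntegrable hG t
  have hjF : Continuous fun s => j (F s) := j.continuous.comp hF
  have hjG : Continuous fun s => j (G s) := j.continuous.comp hG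
  -- Integrate the derivative of `θ • T (t (1 - θ)) (j (F (t θ)))`. The weight `θ` removes the
  -- boundary term at `0` and turns `t θ F'` into `G`.
  have ftc : ∫ θ in (0 : ℝ)..1, (T (t * (1 - θ)) (j (F (t * θ))) -
      (t * θ) • T (t * (1 - θ)) (ℓ (F (t * θ))) + T (t * (1 - θ)) (j (G (t * θ)))) = j (F t) := by
    have := intervalIntegral.integral_eq_sub_of_hasDerivAt_of_le zero_le_one
      (f := fun θ : ℝ => θ • T (t * (1 - θ)) (j (F (t * θ)))) (f' := fun θ =>
        (T (t * (1 - θ)) (j (F (t * θ))) - (t * θ) • T (t * (1 - θ)) (ℓ (F (t * θ))) +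
        T (t * (1 - θ)) (j (G (t * θ))))) ?_ ?_ ?_
    · rw [this]
      simp [hT0]
    · exact (continuous_id.smul ((hT.left.continuous_integrand hjF).comp
        (Continuous.prodMk_right t))).continuousOn
    · intro θ hθ
      have hp1 : 0 < t * (1 - θ) := mul_pos ht (by linarith [hθ.2])
      have hp2 : 0 < t * θ := mul_pos ht hθ.1
      obtain ⟨N, hN⟩ := hT.left.exists_norm_le (t * (1 - θ) + 1)
      have d1 : HasDerivAt (fun r : ℝ => t * (1 - r)) (-t) θ := by
        simpa using ((hasDerivAt_id θ).const_sub 1).const_mul t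
      have d2 : HasDerivAt (fun r : ℝ => t * r) t θ := by
        simpa using (hasDerivAt_id θ).const_mul t
      have d3 := (hT.hasDerivAt _ hp1 (j (F (t * θ)))).scomp θ d1
      have d4 := (j.hasFDerivAt.comp_hasDerivAt _ (hFG _ hp2)).scomp θ d2
      have d5 := HasDerivAt.clm_apply_of_bounded (B := fun r => T (t * (1 - r))) (M := N) ?_ d3 d4 ?_
      · have d6 := (hasDerivAt_id θ).smul d5
        convert! d6 using 1
        have e1 : K (t * (1 - θ)) (j (F (t * θ))) =
            (t * (1 - θ)) • T (t * (1 - θ)) (ℓ (F (t * θ))) := by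
          rw [← hKj, hK _ hp1.le, hℓ]
        have n1 : 1 - θ ≠ 0 := (by linarith [hθ.2] : 0 < 1 - θ).ne'
        have n2 : θ ≠ 0 := hθ.1.ne'
        simp only [e1, map_smul, id, Function.comp]
        match_scalars <;> field_simp
      · have hc : ContinuousAt (fun r : ℝ => t * (1 - r)) θ := by fun_prop
        filter_upwards [hc.eventually_lt_const (lt_add_one _)] with r hr using hN _ hr.le
      · exact ((hT.left.continuous_apply _).comp (by fun_prop)).continuousAt
    · have c1 := (hT.left.continuous_integrand hjF).comp (Continuous.prodMk_right t)
      have c2 := (hT.left.continuous_integrand (ℓ.continuous.comp hF)).comp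
        (Continuous.prodMk_right t)
      have c3 := (hT.left.continuous_integrand hjG).comp (Continuous.prodMk_right t)
      exact ((c1.sub ((continuous_const.mul continuous_id).smul c2)).add c3).intervalIntegrable _ _
  have e1 : j (mildIntegral T F t + (mildIntegral K F t + mildIntegral T G t)) =
      ∫ θ in (0 : ℝ)..1, (T (t * (1 - θ)) (j (F (t * θ))) +
        ((t * (1 - θ)) • T (t * (1 - θ)) (ℓ (F (t * θ))) + T (t * (1 - θ)) (j (G (t * θ))))) := by
    rw [mildIntegral, mildIntegral, mildIntegral, ← intervalIntegral.integral_add hKF hTG,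
      ← intervalIntegral.integral_add hTF (hKF.add hTG),
      ← ContinuousLinearMap.intervalIntegral_comp_comm _ (hTF.add (hKF.add hTG))]
    refine intervalIntegral.integral_congr fun θ hθ => ?_
    rw [uIcc_of_le zero_le_one] at hθ
    have hp1 : 0 ≤ t * (1 - θ) := mul_nonneg ht.le (by linarith [hθ.2])
    simp only [map_add, hj, hK _ hp1, hℓ]
  have e2 : ℓ (mildIntegral T F t) = ∫ θ in (0 : ℝ)..1, T (t * (1 - θ)) (ℓ (F (t * θ))) := by
    rw [mildIntegral, ← ContinuousLinearMap.intervalIntegral_comp_comm _ hTF]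
    simp only [hℓ]
  have c1 := ((hT.left.continuous_integrand hjF).comp (Continuous.prodMk_right t))
  have c2 := (hT.left.continuous_integrand (ℓ.continuous.comp hF)).comp (Continuous.prodMk_right t)
  have c3 := (hT.left.continuous_integrand hjG).comp (Continuous.prodMk_right t)
  -- The `ℓ`-terms carry the weights `t θ` from `ftc` and `t (1 - θ)` from `K`, which add up to `t`.
  have e3 : j (mildIntegral T F t + (mildIntegral K F t + mildIntegral T G t)) =
      j (F t) + t • ℓ (mildIntegral T F t) := by
    rw [e1, e2, ← ftc, ← intervalIntegral.integral_smul, ← intervalIntegral.integral_add]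
    · refine intervalIntegral.integral_congr fun θ _ => ?_
      module
    · exact ((c1.sub ((continuous_const.mul continuous_id).smul c2)).add c3).intervalIntegrable _ _
    · exact (c2.const_smul t).intervalIntegrable _ _
  rw [picardStepDeriv, picardStep, map_add, map_smul, e3, hK t ht.le, map_add, map_smul]
  module

end MildIntegral

/-! ### Picard iteration for the pair `(u, t u')`. -/

section Picard

variable {E : Type*} [NormedAddCommGroup E]

theorem exists_tendstoUniformlyOn_of_norm_sub_le [CompleteSpace E] {u : ℕ → ℝ → E} {s : Set ℝ}
    {ρ : ℝ} (hu : ∀ n, ∀ t ∈ s, ‖u n t - u (n + 1) t‖ ≤ ρ / 2 ^ n) :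
    ∃ v : ℝ → E, TendstoUniformlyOn u v atTop s := by
  have h1 : ∀ t ∈ s, ∀ n, dist (u n t) (u (n + 1) t) ≤ 2 * ρ / 2 / 2 ^ n := fun t ht n => by
    rw [dist_eq_norm]
    simpa using hu n t ht
  have h2 : ∀ t, ∃ y, t ∈ s → Tendsto (fun n => u n t) atTop (𝓝 y) := fun t => by
    by_cases ht : t ∈ s
    · obtain ⟨y, hy⟩ := cauchySeq_tendsto_of_complete (cauchySeq_of_le_geometric_two (h1 t ht))
      exact ⟨y, fun _ => hy⟩
    · exact ⟨0, fun h => absurd h ht⟩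
  choose v hv using h2
  refine ⟨v, ?_⟩
  rw [Metric.tendstoUniformlyOn_iff]
  intro ε hε
  have h3 : Tendsto (fun n : ℕ => 2 * ρ / 2 ^ n) atTop (𝓝 0) := by
    have := (tendsto_pow_atTop_nhds_zero_of_lt_one (r := (1 / 2 : ℝ)) (by norm_num)
      (by norm_num)).const_mul (2 * ρ)
    simpa [div_eq_mul_inv] using this
  filter_upwards [h3.eventually_lt_const hε] with n hn t ht
  rw [dist_comm]
  exact (dist_le_of_le_geometric_two_of_tendsto (h1 t ht) (hv t ht) n).trans_lt hn

variable [NormedSpace ℝ E]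

/-- The Picard iterates `(u, t u')` of the mild form of `u' = T' 0 u + Q (u, u)`, `u 0 = x`. -/
noncomputable def picard (T K : ℝ → E →L[ℝ] E) (Q : E →L[ℝ] E →L[ℝ] E) (x : E) :
    ℕ → (ℝ → E) × (ℝ → E)
  | 0 => (fun _ => 0, fun _ => 0)
  | n + 1 =>
    let u := (picard T K Q x n).1
    let w := (picard T K Q x n).2
    (picardStep T x fun s => Q (u s) (u s),
      picardStepDeriv T K x (fun s => Q (u s) (u s)) fun s => Q (u s) (w s) + Q (w s) (u s))

variable {T K : ℝ → E →L[ℝ] E} {Q : E →L[ℝ] E →L[ℝ] E} {x : E}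

theorem picard_spec (hT : IsAnalyticKernel T K) (n : ℕ) :
    Continuous (picard T K Q x n).1 ∧ Continuous (picard T K Q x n).2 ∧
      ∀ t > 0, HasDerivAt (picard T K Q x n).1 (t⁻¹ • (picard T K Q x n).2 t) t := by
  induction n with
  | zero =>
    refine ⟨continuous_const, continuous_const, fun t _ => ?_⟩
    simpa [picard] using hasDerivAt_const t (0 : E)
  | succ n ih =>
    obtain ⟨hu, hw, hd⟩ := ih
    set u := (picard T K Q x n).1 with hu'
    set w := (picard T K Q x n).2 with hw'
    have hF : Continuous fun s => Q (u s) (u s) := by fun_prop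
    have hG : Continuous fun s => Q (u s) (w s) + Q (w s) (u s) := by fun_prop
    have hFG : ∀ t > 0, HasDerivAt (fun s => Q (u s) (u s))
        (t⁻¹ • (Q (u t) (w t) + Q (w t) (u t))) t := fun t ht => by
      have h1 := (Q.hasFDerivAt.comp_hasDerivAt t (hd t ht)).clm_apply (hd t ht)
      convert! h1 using 1
      simp [add_comm]
    have hTF := hT.left.continuous_mildIntegral hF
    have hKF := hT.right.continuous_mildIntegral hF
    have hTG := hT.left.continuous_mildIntegral hG
    refine ⟨?_, ?_, fun t ht => hT.hasDerivAt_picardStep x hF hG hFG ht⟩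
    · exact (hT.left.continuous_apply x).add (continuous_id.smul hTF)
    · exact (hT.right.continuous_apply x).add (continuous_id.smul (hTF.add (hKF.add hTG)))

theorem picard_apply_eq [CompleteSpace E] (hT : IsAnalyticKernel T K)
    (hT0 : T 0 = 1) {j ℓ : E →L[ℝ] E} (hj : ∀ t x, j (T t x) = T t (j x))
    (hℓ : ∀ t x, ℓ (T t x) = T t (ℓ x)) (hK : ∀ t ≥ 0, ∀ x, j (K t x) = t • ℓ (T t x))
    (hKj : ∀ t x, j (K t x) = K t (j x)) (n : ℕ) {t : ℝ} (ht : 0 < t) :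
    j ((picard T K Q x (n + 1)).2 t) = t • (ℓ ((picard T K Q x (n + 1)).1 t) +
      j (Q ((picard T K Q x n).1 t) ((picard T K Q x n).1 t))) := by
  obtain ⟨hu, hw, hd⟩ := picard_spec (Q := Q) (x := x) hT n
  refine hT.apply_picardStepDeriv hT0 hj hℓ hK hKj x (by fun_prop) (by fun_prop)
    (fun t ht => ?_) ht
  have h1 := (Q.hasFDerivAt.comp_hasDerivAt t (hd t ht)).clm_apply (hd t ht)
  convert! h1 using 1
  simp [add_comm]

theorem norm_clm₂_le {q ρ : ℝ} (hQ : ‖Q‖ ≤ q) (hρ : 0 ≤ ρ) {a b : E} {d : ℝ} (ha : ‖a‖ ≤ ρ)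
    (hb : ‖b‖ ≤ d) : ‖Q a b‖ ≤ q * ρ * d :=
  (Q.le_opNorm₂ a b).trans (by
    have := Q.opNorm_nonneg.trans hQ
    gcongr)

theorem norm_clm₂_sub_le {q ρ d : ℝ} (hQ : ‖Q‖ ≤ q) (hρ : 0 ≤ ρ) (hd : 0 ≤ d) {a b a' b' : E}
    (ha : ‖a'‖ ≤ ρ) (hb : ‖b‖ ≤ ρ) (haa : ‖a - a'‖ ≤ d) (hbb : ‖b - b'‖ ≤ d) :
    ‖Q a b - Q a' b'‖ ≤ 2 * q * ρ * d := by
  have : Q a b - Q a' b' = Q (a - a') b + Q a' (b - b') := by simp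
  rw [this]
  have h1 := norm_clm₂_le hQ hd haa hb
  have h2 := norm_clm₂_le hQ hρ ha hbb
  linarith [norm_add_le (Q (a - a') b) (Q a' (b - b'))]

/-- `C M` bounds the free evolution, and the extra `1` in `ρ` absorbs the integrals. They amount to
at most four terms of size `t C q ρ²`: one from `T F`, one from `K F`, two from `T G`. -/
theorem picard_bound {C M q ρ τ : ℝ} (hC : 0 ≤ C)
    (hCT : ∀ s ≤ 1, ‖T s‖ ≤ C) (hCK : ∀ s ≤ 1, ‖K s‖ ≤ C) (hq : ‖Q‖ ≤ q) (hx : ‖x‖ ≤ M)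
    (hρ : ρ = C * M + 1) (hτ : τ ≤ 1) (hτρ : τ * (16 * C * q * ρ ^ 2) ≤ 1) (n : ℕ) :
    ∀ t ∈ Icc 0 τ, (‖(picard T K Q x n).1 t‖ ≤ ρ ∧ ‖(picard T K Q x n).2 t‖ ≤ ρ) := by
  have hq0 : 0 ≤ q := Q.opNorm_nonneg.trans hq
  have hM0 : 0 ≤ M := (norm_nonneg _).trans hx
  have hρ0 : 0 ≤ ρ := by rw [hρ]; positivity
  induction n with
  | zero => intro t _; simp [picard, hρ0]
  | succ n ih =>
    intro t ht
    have hF : ∀ s ∈ Icc 0 τ, ‖Q ((picard T K Q x n).1 s) ((picard T K Q x n).1 s)‖ ≤ q * ρ * ρ :=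
      fun s hs => norm_clm₂_le hq hρ0 (ih s hs).1 (ih s hs).1
    have hG : ∀ s ∈ Icc 0 τ, ‖Q ((picard T K Q x n).1 s) ((picard T K Q x n).2 s) +
        Q ((picard T K Q x n).2 s) ((picard T K Q x n).1 s)‖ ≤ 2 * (q * ρ * ρ) := fun s hs => by
      refine (norm_add_le _ _).trans ?_
      linarith [norm_clm₂_le hq hρ0 (ih s hs).1 (ih s hs).2,
        norm_clm₂_le hq hρ0 (ih s hs).2 (ih s hs).1]
    have b1 := norm_mildIntegral_le hCT hτ hF ht
    have b2 := norm_mildIntegral_le hCK hτ hF ht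
    have b3 := norm_mildIntegral_le hCT hτ hG ht
    have ht1 : t ≤ 1 := ht.2.trans hτ
    have hTx : ‖T t x‖ ≤ C * M := ((T t).le_of_opNorm_le_of_le (hCT t ht1) hx)
    have hKx : ‖K t x‖ ≤ C * M := ((K t).le_of_opNorm_le_of_le (hCK t ht1) hx)
    have hP : 0 ≤ C * (q * ρ * ρ) := by positivity
    have hs : t * (16 * (C * (q * ρ * ρ))) ≤ 1 := by
      calc t * (16 * (C * (q * ρ * ρ))) ≤ τ * (16 * (C * (q * ρ * ρ))) := by
            gcongr
            exact ht.2
        _ = τ * (16 * C * q * ρ ^ 2) := by ring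
        _ ≤ 1 := hτρ
    constructor
    · refine (norm_add_le _ _).trans ?_
      rw [norm_smul, Real.norm_of_nonneg ht.1]
      have : t * ‖mildIntegral T (fun s => Q ((picard T K Q x n).1 s) ((picard T K Q x n).1 s)) t‖
          ≤ t * (C * (q * ρ * ρ)) := mul_le_mul_of_nonneg_left b1 ht.1
      have := mul_nonneg ht.1 hP
      linarith
    · refine (norm_add_le _ _).trans ?_
      rw [norm_smul, Real.norm_of_nonneg ht.1]
      have : t * ‖mildIntegral T (fun s => Q ((picard T K Q x n).1 s) ((picard T K Q x n).1 s)) t +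
          (mildIntegral K (fun s => Q ((picard T K Q x n).1 s) ((picard T K Q x n).1 s)) t +
          mildIntegral T (fun s => Q ((picard T K Q x n).1 s) ((picard T K Q x n).2 s) +
            Q ((picard T K Q x n).2 s) ((picard T K Q x n).1 s)) t)‖
          ≤ t * (C * (q * ρ * ρ) + (C * (q * ρ * ρ) + C * (2 * (q * ρ * ρ)))) :=
        mul_le_mul_of_nonneg_left (norm_add_le_of_le b1 (norm_add_le_of_le b2 b3)) ht.1
      have := mul_nonneg ht.1 hP
      linarith

/-- The iterate of index `0` vanishes, so the first difference is at most `ρ`. Each later step costs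
at most `8 t C q ρ` (`2 + 2 + 4` from the three integrals), and the constant `16` makes this at most
`1 / 2`. -/
theorem picard_dist (hT : IsAnalyticKernel T K) {C M q ρ τ : ℝ} (hC : 0 ≤ C)
    (hCT : ∀ s ≤ 1, ‖T s‖ ≤ C) (hCK : ∀ s ≤ 1, ‖K s‖ ≤ C) (hq : ‖Q‖ ≤ q) (hx : ‖x‖ ≤ M)
    (hρ : ρ = C * M + 1) (hτ : τ ≤ 1) (hτρ : τ * (16 * C * q * ρ ^ 2) ≤ 1) (n : ℕ) :
    ∀ t ∈ Icc 0 τ, (‖(picard T K Q x n).1 t - (picard T K Q x (n + 1)).1 t‖ ≤ ρ / 2 ^ n ∧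
      ‖(picard T K Q x n).2 t - (picard T K Q x (n + 1)).2 t‖ ≤ ρ / 2 ^ n) := by
  have hb := picard_bound hC hCT hCK hq hx hρ hτ hτρ
  have hq0 : 0 ≤ q := Q.opNorm_nonneg.trans hq
  have hM0 : 0 ≤ M := (norm_nonneg _).trans hx
  have hρ1 : 1 ≤ ρ := by rw [hρ]; linarith [mul_nonneg hC hM0]
  have hρ0 : 0 ≤ ρ := zero_le_one.trans hρ1
  induction n with
  | zero =>
    intro t ht
    have h1 := hb 1 t ht
    simpa [picard] using h1
  | succ n ih =>
    intro t ht
    obtain ⟨cu, cw, -⟩ := picard_spec (Q := Q) (x := x) hT n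
    obtain ⟨cu', cw', -⟩ := picard_spec (Q := Q) (x := x) hT (n + 1)
    set u := (picard T K Q x n).1 with hu
    set w := (picard T K Q x n).2 with hw
    set u' := (picard T K Q x (n + 1)).1 with hu'
    set w' := (picard T K Q x (n + 1)).2 with hw'
    set d := ρ / 2 ^ n with hd
    have hd0 : 0 ≤ d := by positivity
    have hF : ∀ s ∈ Icc 0 τ, ‖Q (u s) (u s) - Q (u' s) (u' s)‖ ≤ 2 * q * ρ * d := fun s hs =>
      norm_clm₂_sub_le hq hρ0 hd0 (hb _ s hs).1 (hb _ s hs).1 (ih s hs).1 (ih s hs).1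
    have hG : ∀ s ∈ Icc 0 τ, ‖(Q (u s) (w s) + Q (w s) (u s)) -
        (Q (u' s) (w' s) + Q (w' s) (u' s))‖ ≤ 4 * q * ρ * d := fun s hs => by
      have e1 := norm_clm₂_sub_le hq hρ0 hd0 (hb (n + 1) s hs).1 (hb n s hs).2 (ih s hs).1
        (ih s hs).2
      have e2 := norm_clm₂_sub_le hq hρ0 hd0 (hb (n + 1) s hs).2 (hb n s hs).1 (ih s hs).2
        (ih s hs).1
      rw [add_sub_add_comm]
      refine (norm_add_le _ _).trans ?_
      linarith
    have b1 := norm_mildIntegral_le hCT hτ hF ht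
    have b2 := norm_mildIntegral_le hCK hτ hF ht
    have b3 := norm_mildIntegral_le hCT hτ hG ht
    rw [← hT.left.mildIntegral_sub (by fun_prop) (by fun_prop)] at b1 b3
    rw [← hT.right.mildIntegral_sub (by fun_prop) (by fun_prop)] at b2
    have hP : 0 ≤ C * (q * ρ * d) := by positivity
    have hs : t * (16 * (C * (q * ρ * d))) ≤ d := by
      calc t * (16 * (C * (q * ρ * d))) ≤ τ * (16 * (C * (q * (ρ * ρ) * d))) := by
            have h1 : ρ ≤ ρ * ρ := by nlinarith
            have h2 := ht.1.trans ht.2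
            gcongr
            exact ht.2
        _ = τ * (16 * C * q * ρ ^ 2) * d := by ring
        _ ≤ 1 * d := by gcongr
        _ = d := one_mul d
    have hd2 : ρ / 2 ^ (n + 1) = d / 2 := by rw [hd, pow_succ]; ring
    have hP' := mul_nonneg ht.1 hP
    rw [hd2]
    constructor
    · have e1 : u' t - (picard T K Q x (n + 1 + 1)).1 t =
          t • (mildIntegral T (fun s => Q (u s) (u s)) t -
            mildIntegral T (fun s => Q (u' s) (u' s)) t) := by
        change picardStep T x _ t - picardStep T x _ t = _
        rw [picardStep, picardStep]
        module
      rw [e1, norm_smul, Real.norm_of_nonneg ht.1]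
      refine (mul_le_mul_of_nonneg_left b1 ht.1).trans ?_
      nlinarith
    · have e1 : w' t - (picard T K Q x (n + 1 + 1)).2 t =
          t • ((mildIntegral T (fun s => Q (u s) (u s)) t -
            mildIntegral T (fun s => Q (u' s) (u' s)) t) +
            ((mildIntegral K (fun s => Q (u s) (u s)) t -
            mildIntegral K (fun s => Q (u' s) (u' s)) t) +
            (mildIntegral T (fun s => Q (u s) (w s) + Q (w s) (u s)) t -
            mildIntegral T (fun s => Q (u' s) (w' s) + Q (w' s) (u' s)) t))) := by
        change picardStepDeriv T K x _ _ t - picardStepDeriv T K x _ _ t = _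
        rw [picardStepDeriv, picardStepDeriv]
        module
      rw [e1, norm_smul, Real.norm_of_nonneg ht.1]
      refine (mul_le_mul_of_nonneg_left (norm_add_le_of_le b1 (norm_add_le_of_le b2 b3))
        ht.1).trans ?_
      nlinarith

/-- Local existence of regular solutions of the semilinear equation `u' = T' 0 u + Q (u, u)`, in
the form regularised by `j`. -/
theorem IsAnalyticKernel.exists_local_solution [CompleteSpace E] (hT : IsAnalyticKernel T K)
    (hT0 : T 0 = 1) {j ℓ : E →L[ℝ] E} (hj : ∀ t x, j (T t x) = T t (j x))
    (hℓ : ∀ t x, ℓ (T t x) = T t (ℓ x)) (hK : ∀ t ≥ 0, ∀ x, j (K t x) = t • ℓ (T t x))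
    (hKj : ∀ t x, j (K t x) = K t (j x)) (Q : E →L[ℝ] E →L[ℝ] E) (M : ℝ) :
    ∃ τ > 0, ∀ x, ‖x‖ ≤ M → ∃ u u' : ℝ → E, ContinuousOn u (Icc 0 τ) ∧ u 0 = x ∧
      ∀ t ∈ Ioo 0 τ, HasDerivAt u (u' t) t ∧ j (u' t) = ℓ (u t) + j (Q (u t) (u t)) := by
  obtain ⟨C₁, hC₁⟩ := hT.left.exists_norm_le 1
  obtain ⟨C₂, hC₂⟩ := hT.right.exists_norm_le 1
  set C := max C₁ C₂ with hCdef
  have hCT : ∀ s ≤ 1, ‖T s‖ ≤ C := fun s hs => (hC₁ s hs).trans (le_max_left _ _)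
  have hCK : ∀ s ≤ 1, ‖K s‖ ≤ C := fun s hs => (hC₂ s hs).trans (le_max_right _ _)
  have hC : 0 ≤ C := (norm_nonneg _).trans (hCT 0 zero_le_one)
  set q := ‖Q‖
  set ρ := C * M + 1 with hρ
  set B := 16 * C * q * ρ ^ 2 with hB
  have hB0 : 0 ≤ B := by positivity
  -- This choice gives both `τ ≤ 1` and `τ B ≤ 1`. It depends on `M` but not on `x`, as the
  -- continuation argument requires.
  refine ⟨1 / (1 + B), by positivity, fun x hx => ?_⟩
  set τ := 1 / (1 + B) with hτ
  have hτ0 : 0 < τ := by positivity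
  have hτ1 : τ ≤ 1 := by
    rw [hτ, div_le_one (by positivity)]
    linarith
  have hτB : τ * (16 * C * q * ρ ^ 2) ≤ 1 := by
    rw [← hB, hτ, div_mul_eq_mul_div, div_le_one (by positivity)]
    linarith
  have hdist := picard_dist hT hC hCT hCK le_rfl hx hρ hτ1 hτB
  obtain ⟨u, hu⟩ := exists_tendstoUniformlyOn_of_norm_sub_le
    (u := fun n => (picard T K Q x n).1) (s := Icc 0 τ) fun n t ht => (hdist n t ht).1
  obtain ⟨w, hw⟩ := exists_tendstoUniformlyOn_of_norm_sub_le
    (u := fun n => (picard T K Q x n).2) (s := Icc 0 τ) fun n t ht => (hdist n t ht).2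
  have hspec := picard_spec (Q := Q) (x := x) hT
  have huc : ContinuousOn u (Icc 0 τ) :=
    hu.continuousOn (Frequently.of_forall fun n => (hspec n).1.continuousOn)
  have hupt : ∀ t ∈ Icc 0 τ, Tendsto (fun n => (picard T K Q x n).1 t) atTop (𝓝 (u t)) :=
    fun t ht => hu.tendsto_at ht
  have hwpt : ∀ t ∈ Icc 0 τ, Tendsto (fun n => (picard T K Q x n).2 t) atTop (𝓝 (w t)) :=
    fun t ht => hw.tendsto_at ht
  refine ⟨u, fun t => t⁻¹ • w t, huc, ?_, fun t ht => ⟨?_, ?_⟩⟩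
  · refine tendsto_nhds_unique ((hupt 0 ⟨le_rfl, hτ0.le⟩).comp (tendsto_add_atTop_nat 1)) ?_
    refine tendsto_const_nhds.congr fun n => ?_
    simp [picard, picardStep, hT0]
  -- Since `t⁻¹` is bounded on compact subsets of `(0, τ)`, uniform convergence of `t u'` gives
  -- locally uniform convergence of the derivatives.
  · have hloc : TendstoLocallyUniformlyOn (fun (n : ℕ) (t : ℝ) => t⁻¹ • (picard T K Q x n).2 t)
        (fun t => t⁻¹ • w t) atTop (Ioo 0 τ) := by
      rw [tendstoLocallyUniformlyOn_iff_forall_isCompact isOpen_Ioo]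
      intro k hk hkc
      have hinv : ContinuousOn (fun t : ℝ => t⁻¹) k :=
        continuousOn_id.inv₀ fun t ht => (hk ht).1.ne'
      obtain ⟨N, hN⟩ := hkc.exists_bound_of_continuousOn hinv
      rw [Metric.tendstoUniformlyOn_iff]
      intro ε hε
      have := (Metric.tendstoUniformlyOn_iff.1 hw) (ε / (|N| + 1)) (by positivity)
      filter_upwards [this] with n hn s hs
      have h1 := hn s (Ioo_subset_Icc_self (hk hs))
      rw [dist_eq_norm] at h1 ⊢
      rw [← smul_sub, norm_smul]
      have h2 : ‖s⁻¹‖ < |N| + 1 := by linarith [hN s hs, le_abs_self N]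
      calc ‖s⁻¹‖ * ‖w s - (picard T K Q x n).2 s‖ ≤
            (|N| + 1) * ‖w s - (picard T K Q x n).2 s‖ := by gcongr
        _ < (|N| + 1) * (ε / (|N| + 1)) := by gcongr
        _ = ε := by field_simp
    exact hasDerivAt_of_tendstoLocallyUniformlyOn isOpen_Ioo hloc
      (Eventually.of_forall fun n s hs => (hspec n).2.2 s hs.1)
      (fun s hs => hupt s (Ioo_subset_Icc_self hs)) ht
  · have ht' := Ioo_subset_Icc_self ht
    have l1 := (j.continuous.tendsto _).comp ((hwpt t ht').comp (tendsto_add_atTop_nat 1))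
    have l2 := (ℓ.continuous.tendsto _).comp ((hupt t ht').comp (tendsto_add_atTop_nat 1))
    have hQc : Continuous fun y : E => j (Q y y) := by fun_prop
    have l3 := (hQc.tendsto _).comp (hupt t ht')
    -- The unbounded generator appears only through the bounded maps `j` and `ℓ`, so the equation
    -- for the iterates passes to the limit.
    have l4 : j (w t) = t • (ℓ (u t) + j (Q (u t) (u t))) :=
      tendsto_nhds_unique l1 (((l2.add l3).const_smul t).congr fun n =>
        (picard_apply_eq hT hT0 hj hℓ hK hKj n ht.1).symm)
    rw [map_smul, l4, smul_smul, inv_mul_cancel₀ ht.1.ne', one_smul]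

end Picard

/-! ### Conjugations and transposes of bounded operators. -/

section Transpose

variable {h : Type*} [NormedAddCommGroup h] [InnerProductSpace ℂ h]

namespace Conjugation

theorem involutive (C : Conjugation h) (φ : h) : C.toLinearMap (C.toLinearMap φ) = φ :=
  C.involutive' φ

theorem inner_map (C : Conjugation h) (φ ψ : h) :
    ⟪C.toLinearMap φ, C.toLinearMap ψ⟫_ℂ = ⟪ψ, φ⟫_ℂ :=
  C.inner_map' φ ψ

theorem inner_map_left (C : Conjugation h) (φ ψ : h) :
    ⟪C.toLinearMap φ, ψ⟫_ℂ = ⟪C.toLinearMap ψ, φ⟫_ℂ := by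
  conv_lhs => rw [← C.involutive ψ]
  exact C.inner_map _ _

theorem inner_map_right (C : Conjugation h) (φ ψ : h) :
    ⟪φ, C.toLinearMap ψ⟫_ℂ = ⟪ψ, C.toLinearMap φ⟫_ℂ := by
  conv_lhs => rw [← C.involutive φ]
  exact C.inner_map _ _

theorem norm_map (C : Conjugation h) (φ : h) : ‖C.toLinearMap φ‖ = ‖φ‖ := by
  have h1 := C.inner_map φ φ
  rw [inner_self_eq_norm_sq_to_K, inner_self_eq_norm_sq_to_K] at h1
  have h2 : ‖C.toLinearMap φ‖ ^ 2 = ‖φ‖ ^ 2 := by exact_mod_cast h1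
  exact (sq_eq_sq₀ (norm_nonneg _) (norm_nonneg _)).1 h2

theorem continuous (C : Conjugation h) : Continuous C.toLinearMap :=
  AddMonoidHomClass.continuous_of_bound C.toLinearMap 1 fun φ => by rw [C.norm_map, one_mul]

variable [CompleteSpace h]

/-- The transpose of a bounded operator, as a bounded operator. -/
noncomputable def transposeCLM (C : Conjugation h) (X : h →L[ℂ] h) : h →L[ℂ] h :=
  LinearMap.mkContinuous
    { toFun := fun φ => C.toLinearMap (X.adjoint (C.toLinearMap φ))
      map_add' := fun φ ψ => by simp
      map_smul' := fun c φ => by simp }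
    ‖X‖ fun φ => by
      change ‖C.toLinearMap (X.adjoint (C.toLinearMap φ))‖ ≤ _
      rw [C.norm_map, ← C.norm_map φ, ← LinearIsometryEquiv.norm_map ContinuousLinearMap.adjoint X]
      exact X.adjoint.le_opNorm _

theorem norm_transposeCLM_le (C : Conjugation h) (X : h →L[ℂ] h) : ‖C.transposeCLM X‖ ≤ ‖X‖ :=
  LinearMap.mkContinuous_norm_le _ (norm_nonneg _) _

theorem transposeCLM_apply (C : Conjugation h) (X : h →L[ℂ] h) (φ : h) :
    C.transposeCLM X φ = C.toLinearMap (X.adjoint (C.toLinearMap φ)) := rfl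

/-- The transpose `X^⊤ = 𝒞 X* 𝒞` of bounded operators. -/
noncomputable def transpose (C : Conjugation h) : (h →L[ℂ] h) →L[ℂ] (h →L[ℂ] h) :=
  LinearMap.mkContinuous
    { toFun := C.transposeCLM
      map_add' := fun X Y => by
        ext φ
        simp [transposeCLM_apply]
      map_smul' := fun c X => by
        ext φ
        rw [transposeCLM_apply, map_smulₛₗ, smul_apply, map_smulₛₗ,
          RingHomCompTriple.comp_apply]
        rfl }
    1 fun X => by
      rw [one_mul]
      exact C.norm_transposeCLM_le X

variable (C : Conjugation h)

theorem transpose_apply (X : h →L[ℂ] h) (φ : h) :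
    C.transpose X φ = C.toLinearMap (X.adjoint (C.toLinearMap φ)) := rfl

theorem norm_transpose_le (X : h →L[ℂ] h) : ‖C.transpose X‖ ≤ ‖X‖ :=
  C.norm_transposeCLM_le X

theorem inner_transpose_left (X : h →L[ℂ] h) (φ ψ : h) :
    ⟪C.transpose X φ, ψ⟫_ℂ = ⟪φ, C.transpose X.adjoint ψ⟫_ℂ := by
  rw [transpose_apply, transpose_apply, inner_map_left, ContinuousLinearMap.adjoint_inner_right,
    ContinuousLinearMap.adjoint_adjoint, inner_map_right]

theorem transpose_mul (X Y : h →L[ℂ] h) :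
    C.transpose (X * Y) = C.transpose Y * C.transpose X := by
  ext φ
  simp only [mul_apply_eq_comp, transpose_apply, involutive]
  rw [ContinuousLinearMap.mul_def, ContinuousLinearMap.adjoint_comp]
  rfl

theorem transpose_one : C.transpose 1 = 1 := by
  ext φ
  rw [transpose_apply, ContinuousLinearMap.one_def, ContinuousLinearMap.adjoint_id]
  exact C.involutive φ

theorem adjoint_transpose (X : h →L[ℂ] h) : (C.transpose X).adjoint = C.transpose X.adjoint := by
  symm
  rw [ContinuousLinearMap.eq_adjoint_iff]
  intro φ ψ
  rw [inner_transpose_left, ContinuousLinearMap.adjoint_adjoint]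

theorem transpose_apply_of_isSelfAdjoint {X : h →L[ℂ] h} (hX : IsSelfAdjoint X) (φ : h) :
    C.transpose X φ = C.toLinearMap (X (C.toLinearMap φ)) := by
  rw [transpose_apply, hX.adjoint_eq]

theorem adjoint_transpose_of_isSelfAdjoint {X : h →L[ℂ] h} (hX : IsSelfAdjoint X) :
    (C.transpose X).adjoint = C.transpose X := by
  rw [adjoint_transpose, hX.adjoint_eq]

end Conjugation

end Transpose

/-! ### The Hilbert space and bimodule structure of `ℒ²(h)`. -/

namespace HilbertSchmidt

variable {h : Type*} [NormedAddCommGroup h] [InnerProductSpace ℂ h] [CompleteSpace h]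

theorem hasSum_norm_sq (X : HilbertSchmidt h) :
    HasSum (fun i => ‖toCLM X (stdHilbertBasis h i)‖ ^ 2) (‖X‖ ^ 2) := by
  have := lp.hasSum_norm (p := 2) (by norm_num) (toLp X)
  simpa [norm_eq_norm_toLp, toLp] using this

theorem enorm_adjoint_sq (X : HilbertSchmidt h) :
    ∑' i, ‖(toCLM X).adjoint (stdHilbertBasis h i)‖ₑ ^ 2 = ‖X‖ₑ ^ 2 := by
  rw [enorm_sq_eq (stdHilbertBasis h) X,
    ← tsum_enorm_sq_adjoint (stdHilbertBasis h) (stdHilbertBasis h)]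

/-- An operator with finite `∑ ‖X eᵢ‖²` as a Hilbert-Schmidt operator. -/
noncomputable def ofCLM (X : h →L[ℂ] h) (hX : ∑' i, ‖X (stdHilbertBasis h i)‖ₑ ^ 2 ≠ ⊤) :
    HilbertSchmidt h :=
  ((exists_toCLM_eq_iff (stdHilbertBasis h) X).2 hX).choose

@[simp]
theorem toCLM_ofCLM (X : h →L[ℂ] h) (hX : ∑' i, ‖X (stdHilbertBasis h i)‖ₑ ^ 2 ≠ ⊤) :
    toCLM (ofCLM X hX) = X :=
  ((exists_toCLM_eq_iff (stdHilbertBasis h) X).2 hX).choose_spec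

theorem norm_le_of_tsum_le {X : HilbertSchmidt h} {c : ℝ} (hc : 0 ≤ c)
    (hX : ∑' i, ‖toCLM X (stdHilbertBasis h i)‖ₑ ^ 2 ≤ ENNReal.ofReal c ^ 2) : ‖X‖ ≤ c := by
  rw [← enorm_sq_eq, ← ofReal_norm, ← ENNReal.ofReal_pow (norm_nonneg _), ← ENNReal.ofReal_pow hc,
    ENNReal.ofReal_le_ofReal_iff (by positivity)] at hX
  exact (sq_le_sq₀ (norm_nonneg _) hc).1 hX

/-- By Parseval `‖X φ‖² = ∑ |⟪X* eᵢ, φ⟫|²`; apply Cauchy-Schwarz to each term. -/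
theorem opNorm_toCLM_le (X : HilbertSchmidt h) : ‖toCLM X‖ ≤ ‖X‖ := by
  refine ContinuousLinearMap.opNorm_le_bound _ (norm_nonneg _) fun φ => ?_
  have h1 : ‖toCLM X φ‖ₑ ^ 2 ≤ ‖X‖ₑ ^ 2 * ‖φ‖ₑ ^ 2 := by
    rw [enorm_sq_eq_tsum (stdHilbertBasis h), ← enorm_adjoint_sq, ← ENNReal.tsum_mul_right]
    refine ENNReal.tsum_le_tsum fun i => ?_
    rw [← ContinuousLinearMap.adjoint_inner_left, ← mul_pow]
    gcongr
    rw [← ofReal_norm, ← ofReal_norm, ← ofReal_norm, ← ENNReal.ofReal_mul (norm_nonneg _)]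
    exact ENNReal.ofReal_le_ofReal (norm_inner_le_norm _ _)
  rw [← ofReal_norm, ← ofReal_norm, ← ofReal_norm, ← ENNReal.ofReal_pow (norm_nonneg _),
    ← ENNReal.ofReal_pow (norm_nonneg _), ← ENNReal.ofReal_pow (norm_nonneg _),
    ← ENNReal.ofReal_mul (by positivity), ENNReal.ofReal_le_ofReal_iff (by positivity),
    ← mul_pow] at h1
  exact (sq_le_sq₀ (norm_nonneg _) (by positivity)).1 h1

/-- The inclusion of the Hilbert-Schmidt operators into the bounded operators. -/
noncomputable def toCLML : HilbertSchmidt h →L[ℂ] (h →L[ℂ] h) :=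
  toCLM.mkContinuous 1 fun X => by simpa using opNorm_toCLM_le X

theorem norm_toLp (X : HilbertSchmidt h) : ‖toLp X‖ = ‖X‖ := rfl

/-- A Cauchy sequence converges both in the Hilbert sum and in operator norm. Evaluating the
operator limit on the basis identifies it with the limit in the Hilbert sum, so it is
Hilbert-Schmidt. -/
instance : CompleteSpace (HilbertSchmidt h) := by
  refine Metric.complete_of_cauchySeq_tendsto fun u hu => ?_
  have h1 : CauchySeq fun n => toLp (u n) := by
    rw [Metric.cauchySeq_iff] at hu ⊢
    simpa only [dist_eq_norm, ← map_sub, norm_toLp] using hu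
  obtain ⟨v, hv⟩ := cauchySeq_tendsto_of_complete h1
  obtain ⟨A, hA⟩ := cauchySeq_tendsto_of_complete ((toCLML (h := h)).uniformContinuous.comp_cauchySeq hu)
  have h2 : ∀ i, A (stdHilbertBasis h i) = v i := fun i => by
    have l1 : Tendsto (fun n => toCLM (u n) (stdHilbertBasis h i)) atTop
        (𝓝 (A (stdHilbertBasis h i))) :=
      ((ContinuousLinearMap.apply ℂ h (stdHilbertBasis h i)).continuous.tendsto _).comp hA
    refine tendsto_nhds_unique l1 ?_
    rw [tendsto_iff_norm_sub_tendsto_zero] at hv ⊢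
    exact squeeze_zero (fun _ => norm_nonneg _)
      (fun n => lp.norm_apply_le_norm (by norm_num) (toLp (u n) - v) i) hv
  have h3 : Memℓp (fun i => A (stdHilbertBasis h i)) 2 := by
    rw [funext h2]
    exact v.2
  obtain ⟨X, hX⟩ : ∃ X : HilbertSchmidt h, toLp X = v :=
    ⟨⟨A, h3⟩, by
      ext i
      exact h2 i⟩
  refine ⟨X, ?_⟩
  rw [tendsto_iff_norm_sub_tendsto_zero] at hv ⊢
  simpa only [← norm_toLp, map_sub, hX] using hv

/-- The adjoint of a Hilbert-Schmidt operator. -/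
noncomputable def adj (X : HilbertSchmidt h) : HilbertSchmidt h :=
  ofCLM (toCLM X).adjoint (by rw [enorm_adjoint_sq]; finiteness)

@[simp]
theorem toCLM_adj (X : HilbertSchmidt h) : toCLM (adj X) = (toCLM X).adjoint :=
  toCLM_ofCLM _ _

theorem adj_adj (X : HilbertSchmidt h) : adj (adj X) = X :=
  toCLM_injective (by simp)

theorem norm_adj (X : HilbertSchmidt h) : ‖adj X‖ = ‖X‖ := by
  have h1 : ∀ X : HilbertSchmidt h, ‖adj X‖ ≤ ‖X‖ := fun X => by
    refine norm_le_of_tsum_le (norm_nonneg _) ?_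
    rw [toCLM_adj, enorm_adjoint_sq, ofReal_norm]
  refine le_antisymm (h1 X) ?_
  conv_lhs => rw [← adj_adj X]
  exact h1 _

theorem tsum_enorm_comp_le (A : h →L[ℂ] h) (X : HilbertSchmidt h) :
    ∑' i, ‖(A * toCLM X) (stdHilbertBasis h i)‖ₑ ^ 2 ≤ ENNReal.ofReal (‖A‖ * ‖X‖) ^ 2 := by
  rw [ENNReal.ofReal_mul (norm_nonneg _), mul_pow, ofReal_norm, ofReal_norm,
    enorm_sq_eq (stdHilbertBasis h) X, ← ENNReal.tsum_mul_left]
  refine ENNReal.tsum_le_tsum fun i => ?_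
  rw [← mul_pow]
  gcongr
  exact A.le_opENorm _

theorem tsum_enorm_comp_ne_top (A : h →L[ℂ] h) (X : HilbertSchmidt h) :
    ∑' i, ‖(A * toCLM X) (stdHilbertBasis h i)‖ₑ ^ 2 ≠ ⊤ :=
  ((tsum_enorm_comp_le A X).trans_lt (by finiteness)).ne

/-- `A X` for a bounded `A` and a Hilbert-Schmidt `X`. -/
noncomputable def lmul : (h →L[ℂ] h) →L[ℂ] HilbertSchmidt h →L[ℂ] HilbertSchmidt h :=
  LinearMap.mkContinuous₂
    (LinearMap.mk₂ ℂ (fun A X => ofCLM (A * toCLM X) (tsum_enorm_comp_ne_top A X))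
      (fun A B X => toCLM_injective (by simp [add_mul]))
      (fun c A X => toCLM_injective (by simp))
      (fun A X Y => toCLM_injective (by simp [mul_add]))
      (fun c A X => toCLM_injective (by simp)))
    1 fun A X => by
      rw [one_mul]
      refine norm_le_of_tsum_le (by positivity) ?_
      simpa using tsum_enorm_comp_le A X

@[simp]
theorem toCLM_lmul (A : h →L[ℂ] h) (X : HilbertSchmidt h) : toCLM (lmul A X) = A * toCLM X :=
  toCLM_ofCLM _ (tsum_enorm_comp_ne_top A X)

theorem norm_lmul_le (A : h →L[ℂ] h) (X : HilbertSchmidt h) : ‖lmul A X‖ ≤ ‖A‖ * ‖X‖ := by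
  refine norm_le_of_tsum_le (by positivity) ?_
  simpa using tsum_enorm_comp_le A X

/-- `X B` for a bounded `B` and a Hilbert-Schmidt `X`. -/
noncomputable def rmul : (h →L[ℂ] h) →L[ℂ] HilbertSchmidt h →L[ℂ] HilbertSchmidt h :=
  LinearMap.mkContinuous₂
    (LinearMap.mk₂ ℂ (fun B X => adj (lmul B.adjoint (adj X)))
      (fun A B X => toCLM_injective (by
        simp [ContinuousLinearMap.mul_def, ContinuousLinearMap.adjoint_comp]))
      (fun c A X => toCLM_injective (by
        simp [ContinuousLinearMap.mul_def, ContinuousLinearMap.adjoint_comp]))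
      (fun A X Y => toCLM_injective (by
        simp [ContinuousLinearMap.mul_def, ContinuousLinearMap.adjoint_comp]))
      (fun c A X => toCLM_injective (by
        simp [ContinuousLinearMap.mul_def, ContinuousLinearMap.adjoint_comp])))
    1 fun A X => by
      rw [one_mul, LinearMap.mk₂_apply, norm_adj, ← norm_adj X,
        ← LinearIsometryEquiv.norm_map ContinuousLinearMap.adjoint A]
      exact norm_lmul_le _ _

theorem rmul_eq (B : h →L[ℂ] h) (X : HilbertSchmidt h) :
    rmul B X = adj (lmul B.adjoint (adj X)) := rfl

@[simp]
theorem toCLM_rmul (B : h →L[ℂ] h) (X : HilbertSchmidt h) : toCLM (rmul B X) = toCLM X * B := by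
  simp [rmul_eq, ContinuousLinearMap.mul_def, ContinuousLinearMap.adjoint_comp]

theorem norm_rmul_le (B : h →L[ℂ] h) (X : HilbertSchmidt h) : ‖rmul B X‖ ≤ ‖X‖ * ‖B‖ := by
  rw [rmul_eq, norm_adj, ← norm_adj X,
    ← LinearIsometryEquiv.norm_map ContinuousLinearMap.adjoint B, mul_comm]
  exact norm_lmul_le _ _

theorem adj_add (X Y : HilbertSchmidt h) : adj (X + Y) = adj X + adj Y :=
  toCLM_injective (by simp)

theorem adj_sub (X Y : HilbertSchmidt h) : adj (X - Y) = adj X - adj Y :=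
  toCLM_injective (by simp)

theorem adj_real_smul (c : ℝ) (X : HilbertSchmidt h) : adj (c • X) = c • adj X :=
  toCLM_injective (by
    rw [← Complex.coe_smul, ← Complex.coe_smul, toCLM_adj, toCLM.map_smul,
      toCLM.map_smul, LinearIsometryEquiv.map_smulₛₗ, Complex.conj_ofReal, toCLM_adj])

/-- Dominated convergence in `∑ ‖(B - B₀) X eᵢ‖²`: multiplication by a Hilbert-Schmidt operator
upgrades bounded strong convergence to norm convergence. On the right the same holds with the
adjoints converging strongly. -/
theorem tendsto_lmul {α : Type*} {l : Filter α} [l.IsCountablyGenerated]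
    {B : α → h →L[ℂ] h} {B₀ : h →L[ℂ] h}
    {M : ℝ} (hM : ∀ᶠ a in l, ‖B a‖ ≤ M) (hB : ∀ φ, Tendsto (fun a => B a φ) l (𝓝 (B₀ φ)))
    (X : HilbertSchmidt h) : Tendsto (fun a => lmul (B a) X) l (𝓝 (lmul B₀ X)) := by
  rw [tendsto_iff_norm_sub_tendsto_zero]
  have h1 : Tendsto (fun a => ‖lmul (B a) X - lmul B₀ X‖ ^ 2) l (𝓝 0) := by
    have h2 : ∀ a, ‖lmul (B a) X - lmul B₀ X‖ ^ 2 =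
        ∑' i, ‖(B a - B₀) (toCLM X (stdHilbertBasis h i))‖ ^ 2 := fun a => by
      rw [← (hasSum_norm_sq _).tsum_eq]
      simp
    simp_rw [h2]
    have h3 := tendsto_tsum_of_dominated_convergence (𝓕 := l)
      (f := fun a i => ‖(B a - B₀) (toCLM X (stdHilbertBasis h i))‖ ^ 2) (g := fun _ => (0 : ℝ))
      (bound := fun i => (M + ‖B₀‖) ^ 2 * ‖toCLM X (stdHilbertBasis h i)‖ ^ 2)
      ((hasSum_norm_sq X).summable.mul_left _) ?_ ?_
    · simpa using h3
    · intro i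
      have := (tendsto_iff_norm_sub_tendsto_zero.1 (hB (toCLM X (stdHilbertBasis h i)))).pow 2
      simpa using this
    · filter_upwards [hM] with a ha i
      rw [norm_pow, norm_norm, ← mul_pow]
      gcongr
      refine (ContinuousLinearMap.le_opNorm _ _).trans ?_
      gcongr
      exact (norm_sub_le _ _).trans (by gcongr)
  have := h1.sqrt
  simpa using this

theorem tendsto_rmul {α : Type*} {l : Filter α} [l.IsCountablyGenerated]
    {B : α → h →L[ℂ] h} {B₀ : h →L[ℂ] h}
    {M : ℝ} (hM : ∀ᶠ a in l, ‖B a‖ ≤ M)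
    (hB : ∀ φ, Tendsto (fun a => (B a).adjoint φ) l (𝓝 (B₀.adjoint φ)))
    (X : HilbertSchmidt h) : Tendsto (fun a => rmul (B a) X) l (𝓝 (rmul B₀ X)) := by
  have h1 := tendsto_lmul (M := M) (B := fun a => (B a).adjoint) (by simpa using hM) hB (adj X)
  rw [tendsto_iff_norm_sub_tendsto_zero] at h1 ⊢
  simpa only [rmul_eq, ← adj_sub, norm_adj] using h1

/-- The real part of the Hilbert-Schmidt inner product. -/
noncomputable def reInner (X Y : HilbertSchmidt h) : ℝ := (⟪toLp X, toLp Y⟫_ℂ).re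

theorem reInner_self (X : HilbertSchmidt h) : reInner X X = ‖X‖ ^ 2 := by
  rw [← norm_toLp]
  exact inner_self_eq_norm_sq (𝕜 := ℂ) _

theorem norm_add_sq (X Y : HilbertSchmidt h) :
    ‖X + Y‖ ^ 2 = ‖X‖ ^ 2 + 2 * reInner X Y + ‖Y‖ ^ 2 := by
  simp only [← norm_toLp, map_add]
  exact _root_.norm_add_sq (𝕜 := ℂ) _ _

theorem hasSum_reInner (X Y : HilbertSchmidt h) :
    HasSum (fun i => (⟪toCLM X (stdHilbertBasis h i), toCLM Y (stdHilbertBasis h i)⟫_ℂ).re)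
      (reInner X Y) :=
  Complex.hasSum_re (lp.hasSum_inner (𝕜 := ℂ) (toLp X) (toLp Y))

/-- Polarisation of `norm_adj`. -/
theorem reInner_adj (X Y : HilbertSchmidt h) : reInner (adj X) (adj Y) = reInner X Y := by
  have h1 := norm_add_sq X Y
  have h2 := norm_add_sq (adj X) (adj Y)
  rw [← adj_add, norm_adj, norm_adj, norm_adj] at h2
  linarith

theorem reInner_lmul_left (A : h →L[ℂ] h) (X Y : HilbertSchmidt h) :
    reInner (lmul A X) Y = reInner X (lmul A.adjoint Y) := by
  rw [← (hasSum_reInner _ _).tsum_eq, ← (hasSum_reInner _ _).tsum_eq]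
  simp [ContinuousLinearMap.adjoint_inner_right]

theorem reInner_rmul_left (B : h →L[ℂ] h) (X Y : HilbertSchmidt h) :
    reInner (rmul B X) Y = reInner X (rmul B.adjoint Y) := by
  rw [rmul_eq, rmul_eq, ← reInner_adj, adj_adj, reInner_lmul_left, ← reInner_adj, adj_adj]

end HilbertSchmidt

/-! ### The bounded inverse of `Υ + μ + 1`. -/

section ShiftedInverse

variable {h : Type*} [NormedAddCommGroup h] [InnerProductSpace ℂ h] [CompleteSpace h]

theorem IsSelfAdjoint.exists_apply_eq_of_inner {Υ : h →ₗ.[ℂ] h} (hΥ : IsSelfAdjoint Υ) {y w : h}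
    (hw : ∀ x : Υ.domain, ⟪w, (x : h)⟫_ℂ = ⟪y, Υ x⟫_ℂ) : ∃ hy : y ∈ Υ.domain, Υ ⟨y, hy⟩ = w := by
  have h1 := LinearPMap.mem_adjoint_domain_of_exists (T := Υ) y ⟨w, hw⟩
  have h2 := LinearPMap.adjoint_apply_eq hΥ.dense_domain ⟨y, h1⟩ hw
  rw [LinearPMap.isSelfAdjoint_def] at hΥ
  -- Generalising the operator allows the equality of adjoint and operator to be substituted,
  -- although the domain membership depends on it.
  have key : ∀ S : h →ₗ.[ℂ] h, S = Υ → ∀ hy : y ∈ S.domain, S ⟨y, hy⟩ = w →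
      ∃ hy : y ∈ Υ.domain, Υ ⟨y, hy⟩ = w := by
    rintro _ rfl hy e
    exact ⟨hy, e⟩
  exact key _ hΥ h1 h2

theorem IsSelfAdjoint.inner_apply_left {Υ : h →ₗ.[ℂ] h} (hΥ : IsSelfAdjoint Υ) (x y : Υ.domain) :
    ⟪Υ x, (y : h)⟫_ℂ = ⟪(x : h), Υ y⟫_ℂ := by
  have h1 := LinearPMap.adjoint_isFormalAdjoint hΥ.dense_domain
  rw [LinearPMap.isSelfAdjoint_def.1 hΥ] at h1
  exact h1 x y

/-- `R` is the positive, bounded inverse of `Υ + c`. -/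
structure IsShiftedInverse (Υ : h →ₗ.[ℂ] h) (c : ℝ) (R : h →L[ℂ] h) : Prop where
  nonneg : 0 ≤ R
  denseRange : DenseRange R
  sq_norm_le : ∀ ψ : h, ‖R ψ‖ ^ 2 ≤ (⟪R ψ, ψ⟫_ℂ).re
  apply_eq_iff : ∀ x y : h, (∃ hx : x ∈ Υ.domain, Υ ⟨x, hx⟩ = y) ↔ R (y + (c : ℂ) • x) = x

/-- `A = Υ + c` with `c = μ + 1` is symmetric and satisfies `⟪φ, A φ⟫ ≥ ‖φ‖²`, so it is injective
with bounded inverse on its range. Self-adjointness makes the range closed, and a vector orthogonal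
to it would lie in the kernel of `A`; hence `A` is onto. In terms of the inverse, coercivity reads
`R² ≤ R`, which is the field `sq_norm_le`. -/
theorem exists_isShiftedInverse {Υ : h →ₗ.[ℂ] h} (hΥ : IsSelfAdjoint Υ) {μ : ℝ}
    (hμ : ∀ φ : Υ.domain, -μ * ‖(φ : h)‖ ^ 2 ≤ (⟪(φ : h), Υ φ⟫_ℂ).re) :
    ∃ R : h →L[ℂ] h, IsShiftedInverse Υ (μ + 1) R := by
  set c : ℝ := μ + 1 with hc
  set A : Υ.domain →ₗ[ℂ] h := Υ.toFun + (c : ℂ) • Υ.domain.subtype with hA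
  have hAapp : ∀ φ, A φ = Υ φ + (c : ℂ) • (φ : h) := fun φ => rfl
  have hsymm : ∀ φ ψ : Υ.domain, ⟪A φ, (ψ : h)⟫_ℂ = ⟪(φ : h), A ψ⟫_ℂ := fun φ ψ => by
    rw [hAapp, hAapp, inner_add_left, inner_add_right, hΥ.inner_apply_left, inner_smul_left,
      inner_smul_right, Complex.conj_ofReal]
  have hmem : ∀ x y : h, (∀ φ : Υ.domain, ⟪x, A φ⟫_ℂ = ⟪y, (φ : h)⟫_ℂ) →
      ∃ hx : x ∈ Υ.domain, A ⟨x, hx⟩ = y := fun x y hxy => by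
    obtain ⟨hx, e⟩ := hΥ.exists_apply_eq_of_inner (y := x) (w := y - (c : ℂ) • x) fun φ => by
      have := hxy φ
      rw [hAapp, inner_add_right, inner_smul_right] at this
      rw [inner_sub_left, inner_smul_left, Complex.conj_ofReal, ← this]
      ring
    exact ⟨hx, by rw [hAapp, e]; simp⟩
  have hcoer : ∀ φ : Υ.domain, ‖(φ : h)‖ ^ 2 ≤ (⟪(φ : h), A φ⟫_ℂ).re := fun φ => by
    rw [hAapp, inner_add_right, inner_smul_right, inner_self_eq_norm_sq_to_K, Complex.add_re]
    have h1 := hμ φ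
    have h2 : ((c : ℂ) * ((‖(φ : h)‖ : ℝ) : ℂ) ^ 2).re = c * ‖(φ : h)‖ ^ 2 := by
      rw [← Complex.ofReal_pow, ← Complex.ofReal_mul, Complex.ofReal_re]
    have h3 : ((c : ℂ) * ((RCLike.ofReal ‖(φ : h)‖ : ℂ)) ^ 2).re = c * ‖(φ : h)‖ ^ 2 := h2
    rw [h3]
    linarith
  have hbound : ∀ φ : Υ.domain, ‖(φ : h)‖ ≤ ‖A φ‖ := fun φ => by
    have h1 := (hcoer φ).trans ((Complex.re_le_norm _).trans (norm_inner_le_norm _ _))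
    rcases (norm_nonneg (φ : h)).eq_or_lt with h0 | h0
    · rw [← h0]; exact norm_nonneg _
    · nlinarith
  have hinj : Function.Injective A := by
    rw [injective_iff_map_eq_zero]
    intro φ hφ
    have := hbound φ
    rw [hφ, norm_zero] at this
    exact Subtype.ext (norm_le_zero_iff.1 this)
  have hclos : ∀ y ∈ closure (LinearMap.range A : Set h), ∃ φ, A φ = y := fun y hy => by
    obtain ⟨u, hu, huy⟩ := mem_closure_iff_seq_limit.1 hy
    choose v hv using hu
    have h1 : CauchySeq fun n => (v n : h) := by
      have h2 := huy.cauchySeq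
      rw [Metric.cauchySeq_iff] at h2 ⊢
      intro ε hε
      obtain ⟨N, hN⟩ := h2 ε hε
      refine ⟨N, fun m hm n hn => lt_of_le_of_lt ?_ (hN m hm n hn)⟩
      rw [dist_eq_norm, dist_eq_norm, ← hv, ← hv, ← map_sub]
      exact hbound (v m - v n)
    obtain ⟨x, hx⟩ := cauchySeq_tendsto_of_complete h1
    obtain ⟨hx', e⟩ := hmem x y fun φ => by
      have l1 : Tendsto (fun n => ⟪(v n : h), A φ⟫_ℂ) atTop (𝓝 ⟪x, A φ⟫_ℂ) :=
        hx.inner tendsto_const_nhds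
      have l2 : Tendsto (fun n => ⟪u n, (φ : h)⟫_ℂ) atTop (𝓝 ⟪y, (φ : h)⟫_ℂ) :=
        huy.inner tendsto_const_nhds
      refine tendsto_nhds_unique l1 (l2.congr fun n => ?_)
      rw [← hv, hsymm]
    exact ⟨_, e⟩
  have horth : (LinearMap.range A)ᗮ = ⊥ := by
    rw [eq_bot_iff]
    intro y hy
    rw [Submodule.mem_orthogonal'] at hy
    obtain ⟨hy', e⟩ := hmem y 0 fun φ => by
      rw [inner_zero_left]
      exact hy _ ⟨φ, rfl⟩
    have := hbound ⟨y, hy'⟩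
    rw [e, norm_zero] at this
    simpa using this
  have hsurj : Function.Surjective A := fun y => by
    refine hclos y ?_
    rw [← Submodule.topologicalClosure_eq_top_iff] at horth
    have h1 : y ∈ (LinearMap.range A).topologicalClosure := by
      rw [horth]
      trivial
    exact h1
  set e := LinearEquiv.ofBijective A ⟨hinj, hsurj⟩ with he
  have heA : ∀ y, A (e.symm y) = y := fun y => e.apply_symm_apply y
  have hAe : ∀ φ, e.symm (A φ) = φ := fun φ => e.symm_apply_apply φ
  set R : h →L[ℂ] h := (Υ.domain.subtype ∘ₗ e.symm.toLinearMap).mkContinuous 1 fun y => by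
    rw [one_mul]
    conv_rhs => rw [← heA y]
    exact hbound _ with hR
  have hRapp : ∀ y, R y = (e.symm y : h) := fun y => rfl
  refine ⟨R, ?_, ?_, fun ψ => ?_, fun x y => ⟨?_, fun H => ?_⟩⟩
  · rw [ContinuousLinearMap.nonneg_iff_isPositive, ContinuousLinearMap.isPositive_def]
    refine ⟨fun x y => ?_, fun x => ?_⟩
    · change ⟪R x, y⟫_ℂ = ⟪x, R y⟫_ℂ
      rw [hRapp, hRapp]
      conv_lhs => rw [← heA y]
      conv_rhs => rw [← heA x]
      rw [hsymm]
    · rw [ContinuousLinearMap.reApplyInnerSelf_apply]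
      conv in ⟪R x, x⟫_ℂ => rw [← heA x]
      rw [hRapp, hAe]
      exact (sq_nonneg _).trans (hcoer _)
  · refine hΥ.dense_domain.mono fun x hx => ⟨A ⟨x, hx⟩, ?_⟩
    rw [hRapp, hAe]
  · have := hcoer (e.symm ψ)
    rwa [heA] at this
  · rintro ⟨hx, rfl⟩
    have : Υ ⟨x, hx⟩ + (c : ℂ) • x = A ⟨x, hx⟩ := rfl
    rw [this, hRapp, hAe]
  · have hx : x ∈ Υ.domain := by
      rw [← H, hRapp]
      exact (e.symm _).2
    have h1 : e.symm (y + (c : ℂ) • x) = ⟨x, hx⟩ := Subtype.ext H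
    have h2 := heA (y + (c : ℂ) • x)
    rw [h1, hAapp] at h2
    exact ⟨hx, add_right_cancel h2⟩

end ShiftedInverse

/-! ### The flow equation rewritten with bounded operators. -/

section FlowField

variable {h : Type*} [NormedAddCommGroup h] [InnerProductSpace ℂ h] [CompleteSpace h]
  {C : Conjugation h} {Υ : h →ₗ.[ℂ] h} {c : ℝ} {R : h →L[ℂ] h}

theorem IsShiftedInverse.isSelfAdjoint (hR : IsShiftedInverse Υ c R) : IsSelfAdjoint R :=
  .of_nonneg hR.nonneg

theorem IsShiftedInverse.transpose_apply (hR : IsShiftedInverse Υ c R) (φ : h) :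
    C.transpose R φ = C.toLinearMap (R (C.toLinearMap φ)) :=
  C.transpose_apply_of_isSelfAdjoint hR.isSelfAdjoint φ

/-- The value of `(Δ + Υ)^⊤`. -/
theorem flowOp_transposeOp_apply (hΥ : IsSelfAdjoint Υ) (Δ : h →L[ℂ] h) {φ ψ : h}
    (hφ : C.toLinearMap φ ∈ Υ.domain) (hψ : Υ ⟨C.toLinearMap φ, hφ⟩ = C.toLinearMap ψ) :
    ∃ hφ' : φ ∈ ((flowOp Υ Δ).transposeOp C).domain,
      (flowOp Υ Δ).transposeOp C ⟨φ, hφ'⟩ = C.transpose Δ φ + ψ := by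
  have key : ∀ x : (flowOp Υ Δ).domain,
      ⟪Δ.adjoint (C.toLinearMap φ) + C.toLinearMap ψ, (x : h)⟫_ℂ =
        ⟪C.toLinearMap φ, flowOp Υ Δ x⟫_ℂ := fun x => by
    have h1 : flowOp Υ Δ x = Δ (x : h) + Υ x := rfl
    rw [h1, inner_add_left, inner_add_right, ContinuousLinearMap.adjoint_inner_left, ← hψ,
      hΥ.inner_apply_left ⟨_, hφ⟩ x]
  have h2 : C.toLinearMap φ ∈ (flowOp Υ Δ).adjoint.domain :=
    LinearPMap.mem_adjoint_domain_of_exists _ ⟨_, key⟩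
  refine ⟨h2, ?_⟩
  change C.toLinearMap ((flowOp Υ Δ).adjoint ⟨C.toLinearMap φ, h2⟩) = _
  rw [LinearPMap.adjoint_apply_eq (T := flowOp Υ Δ) hΥ.dense_domain ⟨C.toLinearMap φ, h2⟩ key,
    map_add, C.involutive, C.transpose_apply]

theorem mem_domain_of_mem_transposeOp (hΥ : IsSelfAdjoint Υ) (Δ : h →L[ℂ] h) {φ : h}
    (hφ : φ ∈ ((flowOp Υ Δ).transposeOp C).domain) : C.toLinearMap φ ∈ Υ.domain := by
  rw [flowOp_transposeOp_domain] at hφ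
  have h1 : C.toLinearMap φ ∈ Υ.adjoint.domain := hφ
  rwa [LinearPMap.isSelfAdjoint_def.1 hΥ] at h1

/-- On the range of `R^⊤` the domain of `(Δ + Υ)^⊤` is exhausted, and the values are explicit. -/
theorem IsShiftedInverse.transposeOp_apply (hR : IsShiftedInverse Υ c R) (hΥ : IsSelfAdjoint Υ)
    (Δ : h →L[ℂ] h) (φ : h) :
    ∃ hφ : C.transpose R φ ∈ ((flowOp Υ Δ).transposeOp C).domain,
      (flowOp Υ Δ).transposeOp C ⟨C.transpose R φ, hφ⟩ =
        C.transpose Δ (C.transpose R φ) + (φ - (c : ℂ) • C.transpose R φ) := by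
  obtain ⟨h1, h2⟩ := (hR.apply_eq_iff (C.toLinearMap (C.transpose R φ))
    (C.toLinearMap (φ - (c : ℂ) • C.transpose R φ))).2 (by
      rw [map_sub, map_smulₛₗ, Complex.conj_ofReal, sub_add_cancel, hR.transpose_apply,
        C.involutive])
  exact flowOp_transposeOp_apply hΥ Δ h1 h2

theorem IsShiftedInverse.exists_transpose_apply_eq (hR : IsShiftedInverse Υ c R)
    (hΥ : IsSelfAdjoint Υ) (Δ : h →L[ℂ] h) {φ : h}
    (hφ : φ ∈ ((flowOp Υ Δ).transposeOp C).domain) : ∃ ψ, C.transpose R ψ = φ := by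
  have h1 := mem_domain_of_mem_transposeOp hΥ Δ hφ
  have h2 := (hR.apply_eq_iff (C.toLinearMap φ) _).1 ⟨h1, rfl⟩
  refine ⟨C.toLinearMap (Υ ⟨_, h1⟩ + (c : ℂ) • C.toLinearMap φ), ?_⟩
  rw [hR.transpose_apply, C.involutive, h2, C.involutive]

/-- The flow equation, at a vector of the domain, in terms of the bounded operator `R`. -/
theorem IsShiftedInverse.flow_apply_iff (hR : IsShiftedInverse Υ c R)
    (Δ : h →L[ℂ] h) (x y b : h) :
    (∃ hx : x ∈ (flowOp Υ Δ).domain, b = (-2 : ℂ) • (flowOp Υ Δ ⟨x, hx⟩ + y)) ↔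
      R b = (-2 : ℂ) • (x + R y) + (2 * c : ℂ) • R x - (2 : ℂ) • R (Δ x) := by
  have h1 : (∃ hx : x ∈ (flowOp Υ Δ).domain, b = (-2 : ℂ) • (flowOp Υ Δ ⟨x, hx⟩ + y)) ↔
      ∃ hx : x ∈ Υ.domain, Υ ⟨x, hx⟩ = (-(1 / 2) : ℂ) • b - y - Δ x := by
    refine exists_congr fun hx => ?_
    have h2 : flowOp Υ Δ ⟨x, hx⟩ = Δ x + Υ ⟨x, hx⟩ := rfl
    rw [h2]
    constructor
    · rintro rfl
      module
    · intro e
      rw [e]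
      module
  rw [h1, hR.apply_eq_iff]
  simp only [map_add, map_sub, map_smul]
  constructor
  · intro e
    have e2 : R b = (-2 : ℂ) • ((-(1 / 2) : ℂ) • R b - R y - R (Δ x) + (c : ℂ) • R x) -
        (2 : ℂ) • R y - (2 : ℂ) • R (Δ x) + (2 * c : ℂ) • R x := by module
    rw [e] at e2
    rw [e2]
    module
  · intro e
    rw [e]
    module

/-- The domain of `(Δ + Υ)^⊤` is exactly the range of `R^⊤`, and membership of `D φ` in `D(Υ)` is
encoded by an identity after applying `R`. Thus the unbounded equation, with its domain condition,
is equivalent to an equality of bounded operators. The term `4 c` undoes the shift by `c` on both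
sides. -/
theorem IsShiftedInverse.isFlowField_iff (hR : IsShiftedInverse Υ c R) (hΥ : IsSelfAdjoint Υ)
    (Δ D B : h →L[ℂ] h) :
    IsFlowField C Υ Δ D B ↔ R * B * C.transpose R =
      (-2 : ℂ) • (D * C.transpose R + R * D) + (4 * c : ℂ) • (R * D * C.transpose R) +
        R * ((-2 : ℂ) • (Δ * D + D * C.transpose Δ)) * C.transpose R := by
  have key : ∀ φ, (R (B (C.transpose R φ)) = (-2 : ℂ) • (D (C.transpose R φ) +
        R (D (C.transpose Δ (C.transpose R φ) + (φ - (c : ℂ) • C.transpose R φ)))) +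
        (2 * c : ℂ) • R (D (C.transpose R φ)) - (2 : ℂ) • R (Δ (D (C.transpose R φ)))) ↔
      ((R * B * C.transpose R) φ =
      ((-2 : ℂ) • (D * C.transpose R + R * D) + (4 * c : ℂ) • (R * D * C.transpose R) +
        R * ((-2 : ℂ) • (Δ * D + D * C.transpose Δ)) * C.transpose R) φ) := fun φ => by
    simp only [mul_apply_eq_comp, add_apply, smul_apply, map_add, map_sub, map_smul]
    refine Eq.congr rfl ?_
    module
  rw [ContinuousLinearMap.ext_iff]
  constructor
  · intro H φ
    obtain ⟨h1, h2⟩ := hR.transposeOp_apply (C := C) hΥ Δ φ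
    have h3 := H ⟨_, h1⟩
    rw [h2] at h3
    exact (key φ).1 ((hR.flow_apply_iff Δ _ _ _).1 h3)
  · rintro H ⟨φ, hφ⟩
    obtain ⟨ψ, rfl⟩ := hR.exists_transpose_apply_eq hΥ Δ hφ
    obtain ⟨h1, h2⟩ := hR.transposeOp_apply (C := C) hΥ Δ ψ
    rw [h2]
    exact (hR.flow_apply_iff Δ _ _ _).2 ((key ψ).2 (H ψ))

end FlowField

/-! ### Comparison estimates of Gronwall type. -/

section Comparison

variable {E : Type*} [NormedAddCommGroup E] [NormedSpace ℝ E]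

/-- Differentiability at the left endpoint is not assumed, as `D` need not have it at `t = 0`:
estimate from `ε > a` and let `ε → a` by continuity. -/
theorem norm_sub_le_of_hasDerivAt_Ioo {f f' : ℝ → E} {B B' : ℝ → ℝ} {a b : ℝ} (hab : a ≤ b)
    (hf : ContinuousOn f (Icc a b)) (hf' : ∀ s ∈ Ioo a b, HasDerivAt f (f' s) s)
    (hB : ∀ s, HasDerivAt B (B' s) s) (hb : ∀ s ∈ Ioo a b, ‖f' s‖ ≤ B' s) :
    ‖f b - f a‖ ≤ B b - B a := by
  rcases hab.eq_or_lt with rfl | hab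
  · simp
  have h1 : ∀ ε ∈ Ioo a b, ‖f b - f ε‖ ≤ B b - B ε := fun ε hε => by
    refine image_norm_le_of_norm_deriv_right_le_deriv_boundary (f := fun s => f s - f ε)
      (f' := f') (B := fun s => B s - B ε) (a := ε) (b := b) (B' := B')
      ((hf.mono (Icc_subset_Icc_left hε.1.le)).sub continuousOn_const)
      (fun s hs => ((hf' s ⟨hε.1.trans_le hs.1, hs.2⟩).sub_const _).hasDerivWithinAt)
      (by simp) (fun s => (hB s).sub_const _) (fun s hs => hb s ⟨hε.1.trans_le hs.1, hs.2⟩)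
      ⟨hε.2.le, le_rfl⟩
  have hBc : Continuous B := continuous_iff_continuousAt.2 fun s => (hB s).continuousAt
  have l1 : Tendsto f (𝓝[>] a) (𝓝 (f a)) :=
    (hf a ⟨le_rfl, hab.le⟩).mono_left (nhdsWithin_le_of_mem (Icc_mem_nhdsGT hab))
  refine le_of_tendsto_of_tendsto ((tendsto_const_nhds.sub l1).norm)
    (tendsto_const_nhds.sub (hBc.continuousAt.mono_left nhdsWithin_le_nhds)) ?_
  filter_upwards [Ioo_mem_nhdsGT hab] with ε hε using h1 ε hε

/-- Integrating `κ m e^{ℓ s}` gains a factor `κ / ℓ ≤ 1 / 2`: with a steep enough exponential weight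
the estimate contracts on intervals of any length. -/
theorem norm_le_half_of_hasDerivAt_Ioo {f f' : ℝ → E} {κ ℓ m t : ℝ} (hκ : 2 * κ ≤ ℓ)
    (hm : 0 ≤ m) (ht : 0 ≤ t) (hf : ContinuousOn f (Icc 0 t))
    (hf' : ∀ s ∈ Ioo 0 t, HasDerivAt f (f' s) s) (h0 : f 0 = 0)
    (hb : ∀ s ∈ Ioo 0 t, ‖f' s‖ ≤ κ * (m * Real.exp (ℓ * s))) :
    ‖f t‖ ≤ m / 2 * Real.exp (ℓ * t) := by
  have h1 := norm_sub_le_of_hasDerivAt_Ioo ht hf hf'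
    (B := fun s => m / 2 * Real.exp (ℓ * s)) (B' := fun s => m / 2 * (Real.exp (ℓ * s) * ℓ))
    (fun s => by
      have : HasDerivAt (fun s : ℝ => ℓ * s) ℓ s := by simpa using (hasDerivAt_id s).const_mul ℓ
      exact this.exp.const_mul _)
    (fun s hs => (hb s hs).trans (by nlinarith [mul_nonneg hm (Real.exp_pos (ℓ * s)).le]))
  rw [h0, sub_zero] at h1
  refine h1.trans ?_
  simp
  positivity

/-- Iterated halving replaces Gronwall's lemma. No regularity of `δ` is needed, which matters when
`δ` is the operator norm of a merely strongly continuous family. -/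
theorem eq_zero_of_forall_exp_bound {δ : ℝ → ℝ} {ℓ m₀ T : ℝ}
    (h0 : ∀ t ∈ Icc 0 T, δ t ≤ m₀) (hℓ : 0 ≤ ℓ) (hm₀ : 0 ≤ m₀) (hδ : ∀ t ∈ Icc 0 T, 0 ≤ δ t)
    (H : ∀ m ≥ 0, (∀ t ∈ Icc 0 T, δ t ≤ m * Real.exp (ℓ * t)) →
      ∀ t ∈ Icc 0 T, δ t ≤ m / 2 * Real.exp (ℓ * t)) :
    ∀ t ∈ Icc 0 T, δ t = 0 := by
  have h1 : ∀ n : ℕ, ∀ t ∈ Icc 0 T, δ t ≤ m₀ / 2 ^ n * Real.exp (ℓ * t) := fun n => by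
    induction n with
    | zero =>
      intro t ht
      have := Real.one_le_exp (mul_nonneg hℓ ht.1)
      have := h0 t ht
      simp only [pow_zero, div_one]
      nlinarith
    | succ n ih =>
      have := H (m₀ / 2 ^ n) (by positivity) ih
      rw [pow_succ, ← div_div]
      exact this
  intro t ht
  refine le_antisymm ?_ (hδ t ht)
  have h2 : Tendsto (fun n : ℕ => m₀ / 2 ^ n * Real.exp (ℓ * t)) atTop (𝓝 0) := by
    have := ((tendsto_pow_atTop_nhds_zero_of_lt_one (r := (1 / 2 : ℝ)) (by norm_num)
      (by norm_num)).const_mul m₀).mul_const (Real.exp (ℓ * t))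
    simpa [div_eq_mul_inv] using this
  exact ge_of_tendsto' h2 fun n => h1 n t ht

end Comparison

/-! ### Uniqueness in the strong topology. -/

section StrongUniqueness

variable {h : Type*} [NormedAddCommGroup h] [InnerProductSpace ℂ h] [CompleteSpace h]

/-- A strongly continuous solution of the flow on `[0, T]`, with no initial condition. -/
structure IsStrongFlowOn (C : Conjugation h) (Υ : h →ₗ.[ℂ] h) (T : ℝ)
    (X Y : ℝ → h →L[ℂ] h) : Prop where
  continuousOn_fst : ∀ φ : h, ContinuousOn (fun t => X t φ) (Icc 0 T)
  continuousOn_snd : ∀ φ : h, ContinuousOn (fun t => Y t φ) (Icc 0 T)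
  deriv_fst : ∀ t ∈ Ioo 0 T, ∀ φ : h,
    HasDerivAt (fun s => X s φ) ((16 : ℂ) • Y t ((Y t).adjoint φ)) t
  deriv_snd : ∀ t ∈ Ioo 0 T, ∀ φ : ((flowOp Υ (X t)).transposeOp C).domain,
    ∃ hφ : Y t φ ∈ (flowOp Υ (X t)).domain,
      HasDerivAt (fun s => Y s φ)
        ((-2 : ℂ) • (flowOp Υ (X t) ⟨Y t φ, hφ⟩ +
          Y t ((flowOp Υ (X t)).transposeOp C φ))) t

variable {C : Conjugation h} {Υ : h →ₗ.[ℂ] h} {T : ℝ} {X Y X' Y' : ℝ → h →L[ℂ] h}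

theorem IsStrongFlow.isStrongFlowOn {D₀ : h →L[ℂ] h} (hXY : IsStrongFlow C Υ D₀ X Y) (T : ℝ) :
    IsStrongFlowOn C Υ T X Y where
  continuousOn_fst φ := (hXY.continuousOn_Δ φ).mono Icc_subset_Ici_self
  continuousOn_snd φ := (hXY.continuousOn_D φ).mono Icc_subset_Ici_self
  deriv_fst t ht φ := (hXY.deriv_Δ t ht.1.le φ).hasDerivAt (Ici_mem_nhds ht.1)
  deriv_snd t ht φ := hXY.deriv_D t ht.1 φ

variable {c : ℝ} {R : h →L[ℂ] h}

theorem IsStrongFlowOn.exists_hasDerivAt_snd (hXY : IsStrongFlowOn C Υ T X Y)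
    (hΥ : IsSelfAdjoint Υ) (hR : IsShiftedInverse Υ c R) {t : ℝ} (ht : t ∈ Ioo 0 T) (φ : h) :
    ∃ b, HasDerivAt (fun s => Y s (C.transpose R φ)) b t ∧
      R b = (-2 : ℂ) • (Y t (C.transpose R φ) + R (Y t φ)) +
        (4 * c : ℂ) • R (Y t (C.transpose R φ)) - (2 : ℂ) • R ((X t * Y t + Y t * C.transpose (X t))
        (C.transpose R φ)) := by
  obtain ⟨h1, h2⟩ := hR.transposeOp_apply (C := C) hΥ (X t) φ
  obtain ⟨hφ, hd⟩ := hXY.deriv_snd t ht ⟨_, h1⟩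
  refine ⟨_, hd, ?_⟩
  rw [(hR.flow_apply_iff _ _ _ _).1 ⟨hφ, rfl⟩, h2]
  simp only [mul_apply_eq_comp, add_apply, map_add, map_sub, map_smul]
  module

/-- The derivative of the interaction picture of a solution. -/
theorem IsStrongFlowOn.hasDerivAt_inner (hXY : IsStrongFlowOn C Υ T X Y)
    (hΥ : IsSelfAdjoint Υ) (hR : IsShiftedInverse Υ c R) {s t : ℝ} (hs : 0 < s) (hst : s < t)
    (ht : t ≤ T) (φ ψ : h) :
    HasDerivAt (fun r => ⟪invSemigroup R (2 * (t - r)) ψ,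
        Y r (C.transpose (invSemigroup R (2 * (t - r))) φ)⟫_ℂ)
      ((4 * c : ℂ) * ⟪invSemigroup R (2 * (t - s)) ψ,
        Y s (C.transpose (invSemigroup R (2 * (t - s))) φ)⟫_ℂ -
      2 * ⟪invSemigroup R (2 * (t - s)) ψ, (X s * Y s + Y s * C.transpose (X s))
        (C.transpose (invSemigroup R (2 * (t - s))) φ)⟫_ℂ) s := by
  have hst' : 0 < 2 * (t - s) := by linarith
  set S := invSemigroup R (2 * (t - s)) with hS
  set Z := invSemigroupGen R (2 * (t - s)) with hZ
  have hRZ : R * Z = S := mul_invSemigroupGen hR.nonneg hst'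
  have hZsa : IsSelfAdjoint Z := isSelfAdjoint_invSemigroupGen _
  have hTS : C.transpose S = C.transpose R * C.transpose Z := by
    rw [← C.transpose_mul, invSemigroupGen_mul hR.nonneg hst']
  have d0 : HasDerivAt (fun r : ℝ => 2 * (t - r)) (-2) s := by
    simpa using ((hasDerivAt_id s).const_sub t).const_mul 2
  have d1 : HasDerivAt (fun r => invSemigroup R (2 * (t - r))) ((2 : ℝ) • Z) s := by
    have := (hasDerivAt_invSemigroup hR.nonneg hst').scomp s d0
    convert! this using 1
    simp [hZ]
  have d2 : HasDerivAt (fun r => invSemigroup R (2 * (t - r)) ψ) ((2 : ℝ) • Z ψ) s := by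
    have := ((ContinuousLinearMap.apply ℂ h ψ).restrictScalars ℝ).hasFDerivAt.comp_hasDerivAt s d1
    convert! this using 1
  have d3 : HasDerivAt (fun r => C.transpose (invSemigroup R (2 * (t - r))) φ)
      ((2 : ℝ) • C.transpose Z φ) s := by
    have := (((ContinuousLinearMap.apply ℂ h φ).comp
      C.transpose).restrictScalars ℝ).hasFDerivAt.comp_hasDerivAt s d1
    convert! this using 1
    simp
  -- For `s < t` the vector `S^⊤ φ` equals `R^⊤ (Z^⊤ φ)`, hence lies in the domain on which `Y` is
  -- differentiable.
  obtain ⟨b, hb, hRb⟩ := hXY.exists_hasDerivAt_snd hΥ hR ⟨hs, hst.trans_le ht⟩ (C.transpose Z φ)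
  have e1 : C.transpose R (C.transpose Z φ) = C.transpose S φ := by rw [hTS]; rfl
  rw [e1] at hb hRb
  obtain ⟨M, hM⟩ := exists_norm_le_of_continuousOn_apply isCompact_Icc hXY.continuousOn_snd
  have d4 := HasDerivAt.clm_apply_of_bounded (B := fun r => (Y r).restrictScalars ℝ) (M := M)
    (v := fun r => C.transpose (invSemigroup R (2 * (t - r))) φ) (t := s) ?_ hb d3 ?_
  · have d5 := d2.inner ℂ d4
    convert! d5 using 1
    have hSψ : ∀ x, ⟪S ψ, x⟫_ℂ = ⟪Z ψ, R x⟫_ℂ := fun x => by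
      rw [← hRZ, mul_apply_eq_comp, ← ContinuousLinearMap.adjoint_inner_right,
        hR.isSelfAdjoint.adjoint_eq]
    -- Writing `S = R Z` moves `R` onto `b`, where the compressed equation applies. The two terms
    -- containing `Z` cancel against the derivatives of the two semigroups.
    have f1 : ⟪S ψ, b⟫_ℂ = -2 * ⟪Z ψ, Y s (C.transpose S φ)⟫_ℂ -
        2 * ⟪S ψ, Y s (C.transpose Z φ)⟫_ℂ + 4 * c * ⟪S ψ, Y s (C.transpose S φ)⟫_ℂ -
        2 * ⟪S ψ, (X s * Y s + Y s * C.transpose (X s)) (C.transpose S φ)⟫_ℂ := by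
      simp only [hSψ, hRb, inner_add_right, inner_sub_right, inner_smul_right]
      ring
    have f2 : ((Y s).restrictScalars ℝ) ((2 : ℝ) • C.transpose Z φ) =
        (2 : ℂ) • Y s (C.transpose Z φ) := by
      rw [map_smul, ← Complex.coe_smul]
      simp
    have f3 : (2 : ℝ) • Z ψ = (2 : ℂ) • Z ψ := by
      rw [← Complex.coe_smul]
      simp
    have f4 : ((Y s).restrictScalars ℝ) (C.transpose S φ) = Y s (C.transpose S φ) := rfl
    rw [f2, f3, inner_add_right, f1, inner_smul_left, inner_smul_right, ← hS, f4]
    simp only [Complex.conj_ofNat]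
    ring
  · filter_upwards [Icc_mem_nhds hs (hst.trans_le ht)] with r hr
    exact (ContinuousLinearMap.norm_restrictScalars (Y r)).le.trans (hM r hr)
  · exact (hXY.continuousOn_snd _).continuousAt (Icc_mem_nhds hs (hst.trans_le ht))

theorem IsStrongFlowOn.continuousOn_inner (hXY : IsStrongFlowOn C Υ T X Y)
    (hR : IsShiftedInverse Υ c R) {t : ℝ} (ht : t ≤ T) (φ ψ : h) :
    ContinuousOn (fun r => ⟪invSemigroup R (2 * (t - r)) ψ,
        Y r (C.transpose (invSemigroup R (2 * (t - r))) φ)⟫_ℂ) (Icc 0 t) := by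
  have hc : ∀ χ, Continuous fun r : ℝ => invSemigroup R (2 * (t - r)) χ := fun χ =>
    (continuous_invSemigroup_apply hR.nonneg hR.denseRange χ).comp (by fun_prop)
  have hc' : Continuous fun r : ℝ => C.transpose (invSemigroup R (2 * (t - r))) φ := by
    simp_rw [C.transpose_apply_of_isSelfAdjoint (isSelfAdjoint_invSemigroup _)]
    exact C.continuous.comp (hc _)
  obtain ⟨M, hM⟩ := exists_norm_le_of_continuousOn_apply isCompact_Icc hXY.continuousOn_snd
  have hsub : Icc 0 t ⊆ Icc 0 T := Icc_subset_Icc_right ht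
  exact (hc ψ).continuousOn.inner (ContinuousOn.clm_apply_of_bounded (fun r hr => hM r (hsub hr))
    (fun x => (hXY.continuousOn_snd x).mono hsub) hc'.continuousOn)

theorem norm_mul_sub_mul_le {A A' B B' : h →L[ℂ] h} {N d : ℝ} (hA : ‖A‖ ≤ N) (hB' : ‖B'‖ ≤ N)
    (hAA : ‖A - A'‖ ≤ d) (hBB : ‖B - B'‖ ≤ d) : ‖A * B - A' * B'‖ ≤ 2 * N * d := by
  have e : A * B - A' * B' = A * (B - B') + (A - A') * B' := by noncomm_ring
  have hN : 0 ≤ N := (norm_nonneg _).trans hA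
  have hd : 0 ≤ d := (norm_nonneg _).trans hAA
  rw [e]
  have h1 : ‖A * (B - B')‖ ≤ N * d := (norm_mul_le _ _).trans (by gcongr)
  have h2 : ‖(A - A') * B'‖ ≤ d * N := (norm_mul_le _ _).trans (by gcongr)
  linarith [norm_add_le (A * (B - B')) ((A - A') * B')]

/-- Uniqueness of strongly continuous solutions of the flow. -/
theorem IsStrongFlowOn.unique (hXY : IsStrongFlowOn C Υ T X Y) (hXY' : IsStrongFlowOn C Υ T X' Y')
    (hΥ : IsSelfAdjoint Υ) (hR : IsShiftedInverse Υ c R) (hX : X 0 = X' 0) (hY : Y 0 = Y' 0) :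
    ∀ t ∈ Icc 0 T, X t = X' t ∧ Y t = Y' t := by
  obtain ⟨N₁, hN₁⟩ := exists_norm_le_of_continuousOn_apply isCompact_Icc hXY.continuousOn_fst
  obtain ⟨N₂, hN₂⟩ := exists_norm_le_of_continuousOn_apply isCompact_Icc hXY.continuousOn_snd
  obtain ⟨N₃, hN₃⟩ := exists_norm_le_of_continuousOn_apply isCompact_Icc hXY'.continuousOn_fst
  obtain ⟨N₄, hN₄⟩ := exists_norm_le_of_continuousOn_apply isCompact_Icc hXY'.continuousOn_snd
  set N := |N₁| + |N₂| + |N₃| + |N₄| with hN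
  have hN0 : 0 ≤ N := by positivity
  have bX : ∀ t ∈ Icc 0 T, ‖X t‖ ≤ N := fun t ht => by
    linarith [hN₁ t ht, le_abs_self N₁, abs_nonneg N₂, abs_nonneg N₃, abs_nonneg N₄]
  have bY : ∀ t ∈ Icc 0 T, ‖Y t‖ ≤ N := fun t ht => by
    linarith [hN₂ t ht, le_abs_self N₂, abs_nonneg N₁, abs_nonneg N₃, abs_nonneg N₄]
  have bX' : ∀ t ∈ Icc 0 T, ‖X' t‖ ≤ N := fun t ht => by
    linarith [hN₃ t ht, le_abs_self N₃, abs_nonneg N₁, abs_nonneg N₂, abs_nonneg N₄]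
  have bY' : ∀ t ∈ Icc 0 T, ‖Y' t‖ ≤ N := fun t ht => by
    linarith [hN₄ t ht, le_abs_self N₄, abs_nonneg N₁, abs_nonneg N₂, abs_nonneg N₃]
  -- The weight is twice a common Lipschitz constant on the ball of radius `N`: `16 Y Y*`
  -- contributes `32 N`, while the field for `Y` has `4 |c| + 8 N`.
  have key := eq_zero_of_forall_exp_bound (δ := fun t => max ‖X t - X' t‖ ‖Y t - Y' t‖)
    (m₀ := 2 * N) (T := T) (ℓ := 2 * (4 * |c| + 32 * N)) ?_ (by positivity) (by positivity)
    (fun t _ => le_max_of_le_left (norm_nonneg _)) ?_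
  · intro t ht
    have h1 : max ‖X t - X' t‖ ‖Y t - Y' t‖ ≤ 0 := (key t ht).le
    rw [max_le_iff, norm_le_zero_iff, norm_le_zero_iff, sub_eq_zero, sub_eq_zero] at h1
    exact h1
  · intro t ht
    refine max_le ?_ ?_
    · linarith [norm_sub_le (X t) (X' t), bX t ht, bX' t ht]
    · linarith [norm_sub_le (Y t) (Y' t), bY t ht, bY' t ht]
  intro m hm hδ t ht
  have hδX : ∀ s ∈ Icc 0 T, ‖X s - X' s‖ ≤ m * Real.exp (2 * (4 * |c| + 32 * N) * s) :=
    fun s hs => (le_max_left _ _).trans (hδ s hs)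
  have hδY : ∀ s ∈ Icc 0 T, ‖Y s - Y' s‖ ≤ m * Real.exp (2 * (4 * |c| + 32 * N) * s) :=
    fun s hs => (le_max_right _ _).trans (hδ s hs)
  have hsub : Icc 0 t ⊆ Icc 0 T := Icc_subset_Icc_right ht.2
  have hsub' : Ioo 0 t ⊆ Icc 0 T := Ioo_subset_Icc_self.trans hsub
  refine max_le ?_ ?_
  · refine ContinuousLinearMap.opNorm_le_bound _ (by positivity) fun φ => ?_
    have h1 := norm_le_half_of_hasDerivAt_Ioo (f := fun s => X s φ - X' s φ)
      (f' := fun s => (16 : ℂ) • Y s ((Y s).adjoint φ) - (16 : ℂ) • Y' s ((Y' s).adjoint φ))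
      (κ := 32 * N) (ℓ := 2 * (4 * |c| + 32 * N)) (m := m * ‖φ‖)
      (by nlinarith [abs_nonneg c]) (by positivity) ht.1
      (((hXY.continuousOn_fst φ).sub (hXY'.continuousOn_fst φ)).mono hsub)
      (fun s hs => (hXY.deriv_fst s (Ioo_subset_Ioo_right ht.2 hs) φ).sub
        (hXY'.deriv_fst s (Ioo_subset_Ioo_right ht.2 hs) φ)) (by simp [hX]) fun s hs => by
        have h2 := norm_mul_sub_mul_le (B := (Y s).adjoint) (B' := (Y' s).adjoint) (bY s (hsub' hs))
          (by simpa using bY' s (hsub' hs)) (hδY s (hsub' hs))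
          (by
            rw [← map_sub, LinearIsometryEquiv.norm_map]
            exact hδY s (hsub' hs))
        have h3 := (Y s * (Y s).adjoint - Y' s * (Y' s).adjoint).le_of_opNorm_le h2 φ
        rw [← smul_sub, norm_smul]
        simp only [sub_apply, mul_apply_eq_comp] at h3
        have h4 : ‖(16 : ℂ)‖ = 16 := by simp
        rw [h4]
        linarith
    calc ‖(X t - X' t) φ‖ ≤ m * ‖φ‖ / 2 * Real.exp (2 * (4 * |c| + 32 * N) * t) := by simpa using h1
      _ = _ := by ring
  · refine ContinuousLinearMap.opNorm_le_bound _ (by positivity) fun φ => ?_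
    -- The Duhamel argument runs on matrix elements, from `r = 0`, where the two solutions agree, to
    -- `r = t`, where the semigroup is `1`. Taking `ψ = (Y t - Y' t) φ` then recovers the norm.
    have weak : ∀ ψ, ‖⟪ψ, (Y t - Y' t) φ⟫_ℂ‖ ≤
        m * (‖ψ‖ * ‖φ‖) / 2 * Real.exp (2 * (4 * |c| + 32 * N) * t) := fun ψ => by
      set S := fun r => invSemigroup R (2 * (t - r)) with hS
      have nS : ∀ r, ‖S r‖ ≤ 1 := fun r => norm_invSemigroup_le _
      have nST : ∀ r, ‖C.transpose (S r)‖ ≤ 1 := fun r => (C.norm_transpose_le _).trans (nS r)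
      have h1 := norm_le_half_of_hasDerivAt_Ioo
        (f := fun r => ⟪S r ψ, Y r (C.transpose (S r) φ)⟫_ℂ - ⟪S r ψ, Y' r (C.transpose (S r) φ)⟫_ℂ)
        (f' := fun s => ((4 * c : ℂ) * ⟪S s ψ, Y s (C.transpose (S s) φ)⟫_ℂ -
            2 * ⟪S s ψ, (X s * Y s + Y s * C.transpose (X s)) (C.transpose (S s) φ)⟫_ℂ) -
          ((4 * c : ℂ) * ⟪S s ψ, Y' s (C.transpose (S s) φ)⟫_ℂ -
            2 * ⟪S s ψ, (X' s * Y' s + Y' s * C.transpose (X' s)) (C.transpose (S s) φ)⟫_ℂ))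
        (κ := 4 * |c| + 32 * N) (ℓ := 2 * (4 * |c| + 32 * N)) (m := m * (‖ψ‖ * ‖φ‖))
        le_rfl (by positivity) ht.1
        ((hXY.continuousOn_inner hR ht.2 φ ψ).sub (hXY'.continuousOn_inner hR ht.2 φ ψ))
        (fun s hs => (hXY.hasDerivAt_inner hΥ hR hs.1 hs.2 ht.2 φ ψ).sub
          (hXY'.hasDerivAt_inner hΥ hR hs.1 hs.2 ht.2 φ ψ)) (by simp [hY]) fun s hs => by
          set d := m * Real.exp (2 * (4 * |c| + 32 * N) * s) with hd
          have hs' := hsub' hs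
          have hd0 : 0 ≤ d := by positivity
          have g1 := norm_mul_sub_mul_le (bX s hs') (bY' s hs') (hδX s hs') (hδY s hs')
          have g2 := norm_mul_sub_mul_le (B := C.transpose (X s)) (B' := C.transpose (X' s))
            (bY s hs') ((C.norm_transpose_le _).trans (bX' s hs')) (hδY s hs')
            (by
              rw [← map_sub]
              exact (C.norm_transpose_le _).trans (hδX s hs'))
          set W : h →L[ℂ] h := (4 * c : ℂ) • (Y s - Y' s) - (2 : ℂ) • ((X s * Y s - X' s * Y' s) +
            (Y s * C.transpose (X s) - Y' s * C.transpose (X' s))) with hW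
          have g3 : ‖W‖ ≤ (4 * |c| + 32 * N) * d := by
            refine (norm_sub_le _ _).trans ?_
            rw [norm_smul, norm_smul]
            have k1 : ‖(4 * c : ℂ)‖ = 4 * |c| := by simp
            have k2 : ‖(2 : ℂ)‖ = 2 := by simp
            rw [k1, k2]
            have k3 := (norm_add_le _ _).trans (add_le_add g1 g2)
            have k4 := mul_le_mul_of_nonneg_left (hδY s hs') (by positivity : 0 ≤ 4 * |c|)
            nlinarith [mul_nonneg hN0 hd0]
          have g4 : ((4 * c : ℂ) * ⟪S s ψ, Y s (C.transpose (S s) φ)⟫_ℂ -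
              2 * ⟪S s ψ, (X s * Y s + Y s * C.transpose (X s)) (C.transpose (S s) φ)⟫_ℂ) -
              ((4 * c : ℂ) * ⟪S s ψ, Y' s (C.transpose (S s) φ)⟫_ℂ -
              2 * ⟪S s ψ, (X' s * Y' s + Y' s * C.transpose (X' s)) (C.transpose (S s) φ)⟫_ℂ) =
              ⟪S s ψ, W (C.transpose (S s) φ)⟫_ℂ := by
            simp only [hW, sub_apply, add_apply, smul_apply, inner_sub_right, inner_add_right,
              inner_smul_right]
            ring
          rw [g4]
          refine (norm_inner_le_norm _ _).trans ?_
          have g5 : ‖S s ψ‖ ≤ ‖ψ‖ := by simpa using (S s).le_of_opNorm_le (nS s) ψ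
          have g6 : ‖C.transpose (S s) φ‖ ≤ ‖φ‖ := by
            simpa using (C.transpose (S s)).le_of_opNorm_le (nST s) φ
          calc ‖S s ψ‖ * ‖W (C.transpose (S s) φ)‖
              ≤ ‖ψ‖ * ((4 * |c| + 32 * N) * d * ‖φ‖) := by
                gcongr
                exact W.le_of_opNorm_le_of_le g3 g6
            _ = _ := by rw [hd]; ring
      have e1 : S t = 1 := by simp [hS, invSemigroup_of_nonpos]
      rw [e1, C.transpose_one] at h1
      simpa [inner_sub_right] using h1
    have h2 := weak ((Y t - Y' t) φ)
    rw [inner_self_eq_norm_sq_to_K] at h2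
    have h3 : ‖(RCLike.ofReal ‖(Y t - Y' t) φ‖ : ℂ) ^ 2‖ = ‖(Y t - Y' t) φ‖ ^ 2 := by simp
    rw [h3] at h2
    rcases (norm_nonneg ((Y t - Y' t) φ)).eq_or_lt with h0 | h0
    · rw [← h0]
      positivity
    · refine le_of_mul_le_mul_left ?_ h0
      calc _ = ‖(Y t - Y' t) φ‖ ^ 2 := by ring
        _ ≤ _ := h2
        _ = _ := by ring

end StrongUniqueness

/-! ### Hilbert-Schmidt regularity and the energy estimate. -/

section Sylvester

variable {h : Type*} [NormedAddCommGroup h] [InnerProductSpace ℂ h] [CompleteSpace h]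
  {C : Conjugation h} {Υ : h →ₗ.[ℂ] h} {c : ℝ} {R : h →L[ℂ] h}

open HilbertSchmidt

theorem IsShiftedInverse.injective (hR : IsShiftedInverse Υ c R) : Function.Injective R := by
  rw [injective_iff_map_eq_zero]
  intro y hy
  obtain ⟨h0, e⟩ := (hR.apply_eq_iff 0 y).2 (by simpa using hy)
  have h1 : (⟨0, h0⟩ : Υ.domain) = 0 := rfl
  rw [← e, h1, LinearPMap.map_zero]

/-- A vector `x` with `|⟪x, ψ⟫| ≤ K ‖R ψ‖` lies in the range of `R`. -/
theorem IsShiftedInverse.exists_apply_eq (hR : IsShiftedInverse Υ c R) (hΥ : IsSelfAdjoint Υ)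
    {x : h} {K : ℝ} (hK : 0 ≤ K) (hx : ∀ ψ, ‖⟪x, ψ⟫_ℂ‖ ≤ K * ‖R ψ‖) :
    ∃ z, R z = x ∧ ‖z‖ ≤ K := by
  -- For `ψ = (Υ + c) y` the hypothesis bounds `⟪x, (Υ + c) y⟫` by `K ‖y‖`, which is membership in
  -- the domain of the adjoint.
  have h1 : x ∈ Υ.adjoint.domain := by
    rw [LinearPMap.mem_adjoint_domain_iff]
    refine AddMonoidHomClass.continuous_of_bound _ (K + |c| * ‖x‖) fun y => ?_
    have h2 := (hR.apply_eq_iff (y : h) _).1 ⟨y.2, rfl⟩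
    have h3 := hx (Υ y + (c : ℂ) • (y : h))
    rw [h2] at h3
    change ‖⟪x, Υ y⟫_ℂ‖ ≤ _ * ‖(y : h)‖
    have h4 : ⟪x, Υ y⟫_ℂ = ⟪x, Υ y + (c : ℂ) • (y : h)⟫_ℂ - ⟪x, (c : ℂ) • (y : h)⟫_ℂ := by
      rw [inner_add_right, add_sub_cancel_right]
    have h5 : ‖⟪x, (c : ℂ) • (y : h)⟫_ℂ‖ ≤ ‖x‖ * (|c| * ‖(y : h)‖) := by
      refine (norm_inner_le_norm _ _).trans ?_
      rw [norm_smul, Complex.norm_real, Real.norm_eq_abs]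
    rw [h4]
    refine (norm_sub_le _ _).trans ((add_le_add h3 h5).trans (le_of_eq (by ring)))
  rw [LinearPMap.isSelfAdjoint_def.1 hΥ] at h1
  have h2 := (hR.apply_eq_iff x _).1 ⟨h1, rfl⟩
  set z := Υ ⟨x, h1⟩ + (c : ℂ) • x with hz
  refine ⟨z, h2, ?_⟩
  have h3 : ∀ χ, ‖⟪z, χ⟫_ℂ‖ ≤ K * ‖χ‖ := fun χ => by
    refine hR.denseRange.induction_on (p := fun χ => ‖⟪z, χ⟫_ℂ‖ ≤ K * ‖χ‖) χ ?_ fun ψ => ?_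
    · exact isClosed_le (by fun_prop) (by fun_prop)
    · rw [← ContinuousLinearMap.adjoint_inner_left, hR.isSelfAdjoint.adjoint_eq, h2]
      exact hx ψ
  have h4 := h3 z
  rw [inner_self_eq_norm_sq_to_K] at h4
  have h5 : ‖(RCLike.ofReal ‖z‖ : ℂ) ^ 2‖ = ‖z‖ ^ 2 := by simp
  rw [h5] at h4
  rcases (norm_nonneg z).eq_or_lt with h0 | h0
  · rw [← h0]; exact hK
  · nlinarith

theorem norm_le_norm_add_of_reInner_nonneg {P Q : HilbertSchmidt h} (hPQ : 0 ≤ reInner P Q) :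
    ‖P‖ ≤ ‖P + Q‖ := by
  have h1 := HilbertSchmidt.norm_add_sq P Q
  refine (sq_le_sq₀ (norm_nonneg _) (norm_nonneg _)).1 ?_
  nlinarith [sq_nonneg ‖Q‖]

/-- Formally `A D` and `D A^⊤` have inner product `‖A^{1/2} D (A^{1/2})^⊤‖₂² ≥ 0`, so either is
bounded by the norm of their sum `G`. Smoothing both sides by the semigroup makes this rigorous,
with a bound independent of `r`. -/
theorem norm_invSemigroupGen_mul_mul_le (hR : IsShiftedInverse Υ c R) {D G : HilbertSchmidt h}
    (hDG : toCLM D * C.transpose R + R * toCLM D = R * toCLM G * C.transpose R) {r : ℝ}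
    (hr : 0 < r) :
    ‖lmul (invSemigroupGen R r) (rmul (C.transpose (invSemigroup R r)) D)‖ ≤ ‖G‖ := by
  set S := invSemigroup R r with hS
  set Z := invSemigroupGen R r with hZ
  have hSsa : IsSelfAdjoint S := isSelfAdjoint_invSemigroup r
  have hZsa : IsSelfAdjoint Z := isSelfAdjoint_invSemigroupGen r
  have hZR : Z * R = S := invSemigroupGen_mul hR.nonneg hr
  have hRZ : C.transpose R * C.transpose Z = C.transpose S := by rw [← C.transpose_mul, hZR]
  have e1 : lmul Z (rmul (C.transpose S) D) + lmul S (rmul (C.transpose Z) D) =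
      lmul S (rmul (C.transpose S) G) := by
    apply toCLM_injective
    simp only [map_add, toCLM_lmul, toCLM_rmul]
    calc Z * (toCLM D * C.transpose S) + S * (toCLM D * C.transpose Z)
        = Z * (toCLM D * C.transpose R + R * toCLM D) * C.transpose Z := by
          rw [← hRZ, ← hZR]; noncomm_ring
      _ = S * (toCLM G * C.transpose S) := by rw [hDG, ← hRZ, ← hZR]; noncomm_ring
  obtain ⟨B, hBsa, hB⟩ := exists_sq_eq_invSemigroupGen_mul hR.nonneg hr
  have e2 : reInner (lmul Z (rmul (C.transpose S) D)) (lmul S (rmul (C.transpose Z) D)) =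
      reInner (lmul B (rmul (C.transpose B) D)) (lmul B (rmul (C.transpose B) D)) := by
    rw [reInner_lmul_left, reInner_rmul_left, reInner_lmul_left, reInner_rmul_left,
      hZsa.adjoint_eq, hBsa.adjoint_eq, C.adjoint_transpose_of_isSelfAdjoint hSsa,
      C.adjoint_transpose_of_isSelfAdjoint hBsa]
    congr 1
    apply toCLM_injective
    simp only [toCLM_lmul, toCLM_rmul]
    have e3 : C.transpose Z * C.transpose S = C.transpose B * C.transpose B := by
      rw [← C.transpose_mul, ← C.transpose_mul, hB]
      have := congrArg star hB
      rw [star_mul, star_mul, hBsa.star_eq, hZsa.star_eq, hSsa.star_eq] at this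
      rw [← this, hB]
    calc Z * (S * (toCLM D * C.transpose Z)) * C.transpose S
        = (Z * S) * toCLM D * (C.transpose Z * C.transpose S) := by noncomm_ring
      _ = _ := by rw [← hB, e3]; noncomm_ring
  refine (norm_le_norm_add_of_reInner_nonneg (Q := lmul S (rmul (C.transpose Z) D)) ?_).trans ?_
  · rw [e2, reInner_self]
    positivity
  · rw [e1]
    have n1 : ‖S‖ ≤ 1 := norm_invSemigroup_le r
    have n2 : ‖C.transpose S‖ ≤ 1 := (C.norm_transpose_le S).trans n1
    calc _ ≤ ‖S‖ * (‖G‖ * ‖C.transpose S‖) :=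
          (norm_lmul_le _ _).trans (by gcongr; exact norm_rmul_le _ _)
      _ ≤ 1 * (‖G‖ * 1) := by gcongr
      _ = ‖G‖ := by ring

theorem tendsto_invSemigroup_mul_mul (hR : IsShiftedInverse Υ c R) (W : h →L[ℂ] h) (φ : h) :
    Tendsto (fun r => invSemigroup R r (W (C.transpose (invSemigroup R r) φ))) (𝓝[>] 0)
      (𝓝 (W φ)) := by
  have h1 : ∀ χ, Tendsto (fun r => invSemigroup R r χ) (𝓝[>] 0) (𝓝 χ) := fun χ =>
    (tendsto_invSemigroup_zero hR.nonneg hR.denseRange χ).mono_left nhdsWithin_le_nhds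
  refine tendsto_clm_apply_of_bounded (M := 1) (Eventually.of_forall norm_invSemigroup_le)
    (h1 _) ((W.continuous.tendsto _).comp ?_)
  simp_rw [C.transpose_apply_of_isSelfAdjoint (isSelfAdjoint_invSemigroup _)]
  have := (C.continuous.tendsto _).comp (h1 (C.toLinearMap φ))
  rwa [C.involutive] at this

/-- Regularity for the Sylvester equation `A D + D A^⊤ = G`, `A = R⁻¹`, in the Hilbert-Schmidt
class: `A D` is Hilbert-Schmidt. -/
theorem IsShiftedInverse.exists_eq_mul (hR : IsShiftedInverse Υ c R) (hΥ : IsSelfAdjoint Υ)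
    {D G : HilbertSchmidt h}
    (hDG : toCLM D * C.transpose R + R * toCLM D = R * toCLM G * C.transpose R) :
    ∃ W : HilbertSchmidt h, toCLM D = R * toCLM W := by
  have hP := fun r hr => norm_invSemigroupGen_mul_mul_le hR hDG (r := r) hr
  -- As `r → 0`, the uniform bound shows `|⟪D φ, ψ⟫| ≤ ‖G‖ ‖φ‖ ‖R ψ‖`, so `D φ` lies in the range of
  -- `R`.
  have h1 : ∀ φ, ∃ z, R z = toCLM D φ ∧ ‖z‖ ≤ ‖G‖ * ‖φ‖ := fun φ => by
    refine hR.exists_apply_eq hΥ (by positivity) fun ψ => ?_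
    have l1 := ((tendsto_invSemigroup_mul_mul (C := C) hR (toCLM D) φ).inner
      (𝕜 := ℂ) (tendsto_const_nhds (x := ψ))).norm
    refine le_of_tendsto l1 ?_
    filter_upwards [self_mem_nhdsWithin] with r hr
    rw [← mul_invSemigroupGen hR.nonneg hr, mul_apply_eq_comp,
      ← ContinuousLinearMap.adjoint_inner_right, hR.isSelfAdjoint.adjoint_eq,
      mul_invSemigroupGen hR.nonneg hr]
    refine (norm_inner_le_norm _ _).trans ?_
    gcongr
    exact ContinuousLinearMap.le_of_opNorm_le (toCLM (lmul (invSemigroupGen R r)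
      (rmul (C.transpose (invSemigroup R r)) D))) ((opNorm_toCLM_le _).trans (hP r hr)) φ |>.trans'
        (by simp)
  choose z hz hzn using h1
  let W : h →L[ℂ] h := LinearMap.mkContinuous
    { toFun := z
      map_add' := fun φ ψ => hR.injective (by simp [hz])
      map_smul' := fun a φ => hR.injective (by simp [hz]) } ‖G‖ hzn
  have hW : ∀ φ, R (W φ) = toCLM D φ := hz
  -- A Fatou argument: each finite sum of `‖W eᵢ‖²` is a limit of finite sums bounded by `‖G‖²`.
  have hWHS : Memℓp (fun i => W (stdHilbertBasis h i)) 2 := by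
    refine memℓp_gen' (C := ‖G‖ ^ 2) fun s => ?_
    have l1 : Tendsto (fun r => ∑ i ∈ s, ‖invSemigroup R r (W (C.transpose (invSemigroup R r)
        (stdHilbertBasis h i)))‖ ^ 2) (𝓝[>] 0) (𝓝 (∑ i ∈ s, ‖W (stdHilbertBasis h i)‖ ^ 2)) :=
      tendsto_finsetSum _ fun i _ =>
        ((tendsto_invSemigroup_mul_mul (C := C) hR W (stdHilbertBasis h i)).norm.pow 2)
    have l2 : ∑ i ∈ s, ‖W (stdHilbertBasis h i)‖ ^ 2 ≤ ‖G‖ ^ 2 := by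
      refine le_of_tendsto l1 ?_
      filter_upwards [self_mem_nhdsWithin] with r hr
      have h2 := sum_le_hasSum s (fun _ _ => by positivity) (hasSum_norm_sq (lmul
        (invSemigroupGen R r) (rmul (C.transpose (invSemigroup R r)) D)))
      have h3 : ∀ φ, invSemigroup R r (W φ) = invSemigroupGen R r (toCLM D φ) := fun φ => by
        rw [← invSemigroupGen_mul hR.nonneg hr, mul_apply_eq_comp, hW]
      simp_rw [h3]
      refine le_trans (le_of_eq ?_) (h2.trans ?_)
      · simp
      · gcongr
        exact hP r hr
    simpa using l2
  obtain ⟨W', hW'⟩ : ∃ W' : HilbertSchmidt h, toCLM W' = W := ⟨⟨W, hWHS⟩, rfl⟩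
  refine ⟨W', ?_⟩
  rw [hW']
  ext φ
  exact (hW φ).symm

/-- The two terms of the flow equation are separately Hilbert-Schmidt. -/
theorem IsShiftedInverse.exists_terms (hR : IsShiftedInverse Υ c R) (hΥ : IsSelfAdjoint Υ)
    {Δ D B : HilbertSchmidt h} (hB : IsFlowField C Υ (toCLM Δ) (toCLM D) (toCLM B)) :
    ∃ W W' : HilbertSchmidt h, toCLM D = R * toCLM W ∧ toCLM D = toCLM W' * C.transpose R ∧
      B = (-2 : ℂ) • (W + W' - (2 * c : ℂ) • D +
        (lmul (toCLM Δ) D + rmul (C.transpose (toCLM Δ)) D)) := by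
  rw [hR.isFlowField_iff hΥ] at hB
  -- `G` is the flow equation solved for `A D + D A^⊤`: the field, the shift and the terms in `Δ`
  -- are all Hilbert-Schmidt.
  set G : HilbertSchmidt h := (-(1 / 2) : ℂ) • B + (2 * c : ℂ) • D -
    (lmul (toCLM Δ) D + rmul (C.transpose (toCLM Δ)) D) with hG
  have hDG : toCLM D * C.transpose R + R * toCLM D = R * toCLM G * C.transpose R := by
    have e1 : R * toCLM G * C.transpose R = (-(1 / 2) : ℂ) • (R * toCLM B * C.transpose R) +
        (2 * c : ℂ) • (R * toCLM D * C.transpose R) + (1 / 2 : ℂ) • (R * ((-2 : ℂ) •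
          (toCLM Δ * toCLM D + toCLM D * C.transpose (toCLM Δ))) * C.transpose R) := by
      simp only [hG, map_add, map_sub, map_smul, toCLM_lmul, toCLM_rmul, mul_add, mul_sub, add_mul,
        sub_mul, mul_smul_comm, smul_mul_assoc, smul_add, smul_smul]
      module
    rw [e1, hB]
    module
  obtain ⟨W, hW⟩ := hR.exists_eq_mul hΥ hDG
  have hRT : Function.Injective (C.transpose R) := fun x y hxy => by
    rw [hR.transpose_apply, hR.transpose_apply] at hxy
    have h1 := congrArg C.toLinearMap hxy
    rw [C.involutive, C.involutive] at h1
    have h2 := congrArg C.toLinearMap (hR.injective h1)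
    rwa [C.involutive, C.involutive] at h2
  refine ⟨W, G - W, hW, ?_, ?_⟩
  · rw [map_sub, sub_mul]
    ext φ
    apply hR.injective
    have h1 := DFunLike.congr_fun hDG φ
    have h2 : toCLM D (C.transpose R φ) = R (toCLM W (C.transpose R φ)) :=
      DFunLike.congr_fun hW _
    simp only [add_apply, mul_apply_eq_comp] at h1
    rw [sub_apply, mul_apply_eq_comp, mul_apply_eq_comp, map_sub, ← h2, ← h1]
    abel
  · rw [hG]
    module

theorem IsShiftedInverse.hasHilbertSchmidtTerms (hR : IsShiftedInverse Υ c R)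
    (hΥ : IsSelfAdjoint Υ) {Δ D B : HilbertSchmidt h}
    (hB : IsFlowField C Υ (toCLM Δ) (toCLM D) (toCLM B)) : HasHilbertSchmidtTerms C Υ Δ D := by
  obtain ⟨W, W', hW, -, -⟩ := hR.exists_terms hΥ hB
  have h1 : ∀ φ, ∃ hφ : toCLM D φ ∈ (flowOp Υ (toCLM Δ)).domain,
      flowOp Υ (toCLM Δ) ⟨toCLM D φ, hφ⟩ =
        toCLM (lmul (toCLM Δ) D + (W - (c : ℂ) • D)) φ := fun φ => by
    obtain ⟨hx, e⟩ := (hR.apply_eq_iff (toCLM D φ) (toCLM (W - (c : ℂ) • D) φ)).2 (by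
      rw [map_sub, map_smul, sub_apply, smul_apply, sub_add_cancel, hW, mul_apply_eq_comp])
    refine ⟨hx, ?_⟩
    have : flowOp Υ (toCLM Δ) ⟨toCLM D φ, hx⟩ =
      toCLM Δ (toCLM D φ) + Υ ⟨toCLM D φ, hx⟩ := rfl
    rw [this, e]
    simp
  -- The second term is the total field minus the first, which is already known to be
  -- Hilbert-Schmidt.
  refine ⟨⟨_, h1⟩, (-(1 / 2) : ℂ) • B - (lmul (toCLM Δ) D + (W - (c : ℂ) • D)), fun φ => ?_⟩
  obtain ⟨hφ, e⟩ := hB φ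
  obtain ⟨hφ', e'⟩ := h1 φ
  rw [e'] at e
  rw [map_sub, map_smul, sub_apply, smul_apply, e]
  module

theorem reInner_lmul_self_nonneg {A : h →L[ℂ] h} (hA : ∀ x, 0 ≤ (⟪x, A x⟫_ℂ).re)
    (D : HilbertSchmidt h) : 0 ≤ reInner D (lmul A D) := by
  rw [← (hasSum_reInner _ _).tsum_eq]
  refine tsum_nonneg fun i => ?_
  rw [toCLM_lmul]
  exact hA _

theorem reInner_rmul_self_nonneg {A : h →L[ℂ] h} (hA : ∀ x, 0 ≤ (⟪x, A.adjoint x⟫_ℂ).re)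
    (D : HilbertSchmidt h) : 0 ≤ reInner D (rmul A D) := by
  rw [rmul_eq, ← reInner_adj, adj_adj]
  exact reInner_lmul_self_nonneg hA _

theorem sq_norm_le_reInner {A : h →L[ℂ] h} (hA : ∀ x, ‖A x‖ ^ 2 ≤ (⟪A x, x⟫_ℂ).re)
    {D W : HilbertSchmidt h} (hD : toCLM D = A * toCLM W) : ‖D‖ ^ 2 ≤ reInner D W := by
  refine hasSum_le (fun i => ?_) (hasSum_norm_sq D) (hasSum_reInner D W)
  rw [hD]
  exact hA _

/-- The dissipation estimate for the flow field. -/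
theorem IsShiftedInverse.reInner_le (hR : IsShiftedInverse Υ c R) (hΥ : IsSelfAdjoint Υ)
    {Δ D B : HilbertSchmidt h} (hB : IsFlowField C Υ (toCLM Δ) (toCLM D) (toCLM B))
    (hΔ : ∀ x, 0 ≤ (⟪x, toCLM Δ x⟫_ℂ).re) : reInner D B ≤ 4 * (c - 1) * ‖D‖ ^ 2 := by
  -- Here `W = A D` and `W'` extends `D A^⊤`. As `A ≥ 1`, each pairs with `D` to at least `‖D‖²`;
  -- against the shift this leaves `4 (c - 1)`, and the terms in `Δ ≥ 0` only help.
  obtain ⟨W, W', hW, hW', rfl⟩ := hR.exists_terms hΥ hB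
  have h1 := sq_norm_le_reInner hR.sq_norm_le hW
  have h2 : ‖D‖ ^ 2 ≤ reInner D W' := by
    rw [← norm_adj, ← reInner_adj]
    refine sq_norm_le_reInner (A := C.transpose R) (fun x => ?_) ?_
    · rw [hR.transpose_apply, C.norm_map, C.inner_map_left, ← inner_conj_symm, Complex.conj_re]
      exact hR.sq_norm_le _
    · rw [toCLM_adj, toCLM_adj, hW', ContinuousLinearMap.mul_def,
        ContinuousLinearMap.adjoint_comp, C.adjoint_transpose_of_isSelfAdjoint hR.isSelfAdjoint]
      rfl
  have h3 := reInner_lmul_self_nonneg hΔ D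
  have h4 : 0 ≤ reInner D (rmul (C.transpose (toCLM Δ)) D) := by
    refine reInner_rmul_self_nonneg (fun x => ?_) D
    rw [C.adjoint_transpose, C.transpose_apply, ContinuousLinearMap.adjoint_adjoint,
      C.inner_map_right, ← inner_conj_symm, Complex.conj_re]
    exact hΔ _
  have h5 := reInner_self D
  have e : reInner D ((-2 : ℂ) • (W + W' - (2 * c : ℂ) • D +
      (lmul (toCLM Δ) D + rmul (C.transpose (toCLM Δ)) D))) =
      -2 * (reInner D W + reInner D W' - 2 * c * reInner D D +
        (reInner D (lmul (toCLM Δ) D) + reInner D (rmul (C.transpose (toCLM Δ)) D))) := by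
    simp only [reInner, map_add, map_sub, map_smul, inner_add_right, inner_sub_right,
      inner_smul_right]
    have e1 : (-2 : ℂ) = ((-2 : ℝ) : ℂ) := by simp
    have e2 : (2 * c : ℂ) = ((2 * c : ℝ) : ℂ) := by simp
    rw [e1, e2]
    simp only [Complex.re_ofReal_mul, Complex.add_re, Complex.sub_re]
  rw [e, h5]
  linarith

end Sylvester

/-! ### Local existence in `ℒ²(h)`. -/

section LocalExistence

variable {h : Type*} [NormedAddCommGroup h] [InnerProductSpace ℂ h] [CompleteSpace h]

namespace HilbertSchmidt

/-- The map `X ↦ A X B` on Hilbert-Schmidt operators. -/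
noncomputable def sandwich (A B : h →L[ℂ] h) : HilbertSchmidt h →L[ℝ] HilbertSchmidt h :=
  ((lmul A).comp (rmul B)).restrictScalars ℝ

theorem sandwich_apply (A B : h →L[ℂ] h) (X : HilbertSchmidt h) :
    sandwich A B X = lmul A (rmul B X) := rfl

theorem toCLM_sandwich (A B : h →L[ℂ] h) (X : HilbertSchmidt h) :
    toCLM (sandwich A B X) = A * toCLM X * B := by
  rw [sandwich_apply, toCLM_lmul, toCLM_rmul, mul_assoc]

theorem sandwich_sandwich (A B A' B' : h →L[ℂ] h) (X : HilbertSchmidt h) :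
    sandwich A B (sandwich A' B' X) = sandwich (A * A') (B' * B) X :=
  toCLM_injective (by simp only [toCLM_sandwich, mul_assoc])

theorem sandwich_smul_left (r : ℝ) (A B : h →L[ℂ] h) (X : HilbertSchmidt h) :
    sandwich (r • A) B X = r • sandwich A B X := by
  rw [sandwich_apply, sandwich_apply, ← Complex.coe_smul, ← Complex.coe_smul, map_smul]
  rfl

theorem sandwich_smul_right (r : ℝ) (A B : h →L[ℂ] h) (X : HilbertSchmidt h) :
    sandwich A (r • B) X = r • sandwich A B X := by
  rw [sandwich_apply, sandwich_apply, ← Complex.coe_smul, ← Complex.coe_smul, map_smul,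
    smul_apply, map_smul]

theorem norm_sandwich_le (A B : h →L[ℂ] h) : ‖sandwich A B‖ ≤ ‖A‖ * ‖B‖ := by
  refine ContinuousLinearMap.opNorm_le_bound _ (by positivity) fun X => ?_
  rw [sandwich_apply]
  calc _ ≤ ‖A‖ * (‖X‖ * ‖B‖) := (norm_lmul_le _ _).trans (by gcongr; exact norm_rmul_le _ _)
    _ = _ := by ring

theorem continuous_sandwich {A B : ℝ → h →L[ℂ] h} {M : ℝ} (hA : ∀ φ, Continuous fun t => A t φ)
    (hB : ∀ φ, Continuous fun t => (B t).adjoint φ) (hAM : ∀ t, ‖A t‖ ≤ M) (hBM : ∀ t, ‖B t‖ ≤ M)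
    (X : HilbertSchmidt h) : Continuous fun t => sandwich (A t) (B t) X := by
  rw [continuous_iff_continuousAt]
  intro t
  refine tendsto_clm_apply_of_bounded (B := fun s => lmul (A s)) (M := M) ?_
    (tendsto_lmul (Eventually.of_forall hAM) (fun φ => (hA φ).tendsto t) _)
    (tendsto_rmul (Eventually.of_forall hBM) (fun φ => (hB φ).tendsto t) X)
  refine Eventually.of_forall fun s => ?_
  refine ContinuousLinearMap.opNorm_le_bound _ ((norm_nonneg _).trans (hAM s)) fun Y => ?_
  exact (norm_lmul_le _ _).trans (by gcongr; exact hAM s)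

theorem hasDerivAt_sandwich {A B : ℝ → h →L[ℂ] h} {A' B' : h →L[ℂ] h} {t : ℝ}
    (hA : HasDerivAt A A' t) (hB : HasDerivAt B B' t) (X : HilbertSchmidt h) :
    HasDerivAt (fun s => sandwich (A s) (B s) X) (sandwich A' (B t) X + sandwich (A t) B' X) t := by
  have h1 : HasDerivAt (fun s => rmul (B s) X) (rmul B' X) t :=
    HasFDerivAt.comp_hasDerivAt t
      ((ContinuousLinearMap.flip (rmul (h := h)) X).restrictScalars ℝ).hasFDerivAt hB
  have h2 : HasDerivAt (fun s => (lmul (A s)).restrictScalars ℝ) ((lmul A').restrictScalars ℝ) t :=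
    ((ContinuousLinearMap.restrictScalarsL ℂ (HilbertSchmidt h) (HilbertSchmidt h) ℝ ℝ).comp
      (lmul.restrictScalars ℝ)).hasFDerivAt.comp_hasDerivAt t hA
  exact h2.clm_apply h1

end HilbertSchmidt

open HilbertSchmidt

variable (C : Conjugation h) (c : ℝ) (R : h →L[ℂ] h)

/-- The bounded family `r R⁻¹ exp (-r R⁻¹)` at `r = 2 t`. -/
noncomputable def scaledGen (t : ℝ) : h →L[ℂ] h := (2 * t) • invSemigroupGen R (2 * t)

/-- The linear flow on the second component. -/
noncomputable def linearFlow (t : ℝ) : HilbertSchmidt h →L[ℝ] HilbertSchmidt h :=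
  Real.exp (4 * c * max t 0) •
    sandwich (invSemigroup R (2 * t)) (C.transpose (invSemigroup R (2 * t)))

/-- `t` times the derivative of the linear flow. -/
noncomputable def linearFlowDeriv (t : ℝ) : HilbertSchmidt h →L[ℝ] HilbertSchmidt h :=
  Real.exp (4 * c * max t 0) •
    ((4 * c * max t 0) • sandwich (invSemigroup R (2 * t)) (C.transpose (invSemigroup R (2 * t))) -
      sandwich (scaledGen R t) (C.transpose (invSemigroup R (2 * t))) -
      sandwich (invSemigroup R (2 * t)) (C.transpose (scaledGen R t)))

/-- Compression by `R`. -/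
noncomputable def compression : HilbertSchmidt h →L[ℝ] HilbertSchmidt h :=
  sandwich R (C.transpose R)

/-- The generator of the linear flow, compressed by `R`. -/
noncomputable def compressedGen : HilbertSchmidt h →L[ℝ] HilbertSchmidt h :=
  (-2 : ℝ) • (sandwich 1 (C.transpose R) + sandwich R 1) + (4 * c) • sandwich R (C.transpose R)

variable {C c R}

theorem isSelfAdjoint_scaledGen (t : ℝ) : IsSelfAdjoint (scaledGen R t) := by
  rw [isSelfAdjoint_iff, scaledGen, star_smul, (isSelfAdjoint_invSemigroupGen _).star_eq,
    star_trivial]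

theorem norm_scaledGen_le (t : ℝ) : ‖scaledGen R t‖ ≤ 1 := norm_smul_invSemigroupGen_le _

theorem mul_scaledGen (hR : 0 ≤ R) {t : ℝ} (ht : 0 ≤ t) :
    R * scaledGen R t = (2 * t) • invSemigroup R (2 * t) := by
  rcases ht.eq_or_lt with rfl | ht
  · simp [scaledGen]
  · rw [scaledGen, mul_smul_comm, mul_invSemigroupGen hR (by linarith)]

theorem scaledGen_mul (hR : 0 ≤ R) {t : ℝ} (ht : 0 ≤ t) :
    scaledGen R t * R = (2 * t) • invSemigroup R (2 * t) := by
  rcases ht.eq_or_lt with rfl | ht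
  · simp [scaledGen]
  · rw [scaledGen, smul_mul_assoc, invSemigroupGen_mul hR (by linarith)]

theorem scaledGen_comm (hR : 0 ≤ R) (t : ℝ) : scaledGen R t * R = R * scaledGen R t := by
  rcases le_or_gt 0 t with ht | ht
  · rw [mul_scaledGen hR ht, scaledGen_mul hR ht]
  · simp [scaledGen, invSemigroupGen_of_nonpos (by linarith : 2 * t ≤ 0)]

theorem continuous_adjoint_transpose {A : ℝ → h →L[ℂ] h} (hA : ∀ t, IsSelfAdjoint (A t))
    (hc : ∀ φ, Continuous fun t => A t φ) (φ : h) :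
    Continuous fun t => (C.transpose (A t)).adjoint φ := by
  simp_rw [C.adjoint_transpose_of_isSelfAdjoint (hA _),
    C.transpose_apply_of_isSelfAdjoint (hA _)]
  exact C.continuous.comp (hc _)

theorem continuous_invSemigroup_two_mul (hR : 0 ≤ R) (hd : DenseRange R) (φ : h) :
    Continuous fun t : ℝ => invSemigroup R (2 * t) φ :=
  (continuous_invSemigroup_apply hR hd φ).comp (by fun_prop)

theorem continuous_scaledGen (hR : 0 ≤ R) (hd : DenseRange R) (φ : h) :
    Continuous fun t : ℝ => scaledGen R t φ :=
  (continuous_smul_invSemigroupGen_apply hR hd φ).comp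
    (continuous_const.mul continuous_id : Continuous fun t : ℝ => 2 * t)

theorem exp_max_le {t b : ℝ} (ht : t ≤ b) :
    Real.exp (4 * c * max t 0) ≤ Real.exp (4 * |c| * |b|) := by
  have h1 : max t 0 ≤ |b| := max_le (ht.trans (le_abs_self b)) (abs_nonneg b)
  refine Real.exp_le_exp.2 ?_
  have h2 : c * max t 0 ≤ |c| * |b| := by
    calc c * max t 0 ≤ |c| * max t 0 := by
          gcongr
          exact le_abs_self c
      _ ≤ |c| * |b| := by gcongr
  linarith

/-- At negative times `max t 0` and the conventions for the semigroup freeze both families at their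
values at `0`. This gives strong continuity on all of `ℝ` and bounds on half-lines. Boundedness of
the scaled derivative comes from `‖r A e^{-rA}‖ ≤ 1`. -/
theorem isAnalyticKernel_linearFlow (hR : 0 ≤ R) (hd : DenseRange R) :
    IsAnalyticKernel (linearFlow C c R) (linearFlowDeriv C c R) := by
  have cS := continuous_invSemigroup_two_mul hR hd
  have cY := continuous_scaledGen hR hd
  have cS' := continuous_adjoint_transpose (C := C)
    (fun t : ℝ => isSelfAdjoint_invSemigroup (R := R) (2 * t)) cS
  have cY' := continuous_adjoint_transpose (C := C) (isSelfAdjoint_scaledGen (R := R)) cY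
  have nS : ∀ t : ℝ, ‖invSemigroup R (2 * t)‖ ≤ 1 := fun t => norm_invSemigroup_le _
  have nY : ∀ t : ℝ, ‖scaledGen R t‖ ≤ 1 := norm_scaledGen_le
  have nS' : ∀ t : ℝ, ‖C.transpose (invSemigroup R (2 * t))‖ ≤ 1 :=
    fun t => (C.norm_transpose_le _).trans (nS t)
  have nY' : ∀ t : ℝ, ‖C.transpose (scaledGen R t)‖ ≤ 1 :=
    fun t => (C.norm_transpose_le _).trans (nY t)
  have hexp : Continuous fun t : ℝ => Real.exp (4 * c * max t 0) := by fun_prop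
  have hn : ∀ {A B : h →L[ℂ] h}, ‖A‖ ≤ 1 → ‖B‖ ≤ 1 → ‖sandwich A B‖ ≤ 1 := fun hA hB =>
    (norm_sandwich_le _ _).trans (mul_le_one₀ hA (norm_nonneg _) hB)
  refine ⟨⟨fun X => ?_, fun b => ⟨Real.exp (4 * |c| * |b|), fun t ht => ?_⟩⟩,
    ⟨fun X => ?_, fun b => ⟨Real.exp (4 * |c| * |b|) * (4 * |c| * |b| + 1 + 1),
      fun t ht => ?_⟩⟩, fun t ht X => ?_⟩
  · exact hexp.smul (continuous_sandwich cS cS' nS nS' X)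
  · rw [linearFlow, norm_smul, Real.norm_of_nonneg (Real.exp_pos _).le]
    exact (mul_le_of_le_one_right (Real.exp_pos _).le (hn (nS t) (nS' t))).trans (exp_max_le ht)
  · have hm : Continuous fun t : ℝ => 4 * c * max t 0 := by fun_prop
    exact hexp.smul (((hm.smul (continuous_sandwich cS cS' nS nS' X)).sub
      (continuous_sandwich cY cS' nY nS' X)).sub (continuous_sandwich cS cY' nS nY' X))
  · rw [linearFlowDeriv, norm_smul, Real.norm_of_nonneg (Real.exp_pos _).le]
    have h1 : ‖(4 * c * max t 0) • sandwich (invSemigroup R (2 * t))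
        (C.transpose (invSemigroup R (2 * t)))‖ ≤ 4 * |c| * |b| := by
      rw [norm_smul]
      refine (mul_le_of_le_one_right (norm_nonneg _) (hn (nS t) (nS' t))).trans ?_
      have h2 : |max t 0| ≤ |b| := by
        rw [abs_of_nonneg (le_max_right _ _)]
        exact max_le (ht.trans (le_abs_self b)) (abs_nonneg b)
      rw [Real.norm_eq_abs, abs_mul, abs_mul, abs_of_pos (by norm_num : (0 : ℝ) < 4)]
      gcongr
    refine mul_le_mul (exp_max_le ht) ?_ (norm_nonneg _) (Real.exp_pos _).le
    exact (norm_sub_le _ _).trans (add_le_add ((norm_sub_le _ _).trans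
      (add_le_add h1 (hn (nY t) (nS' t)))) (hn (nS t) (nY' t)))
  · have ht2 : 0 < 2 * t := by linarith
    have d0 : HasDerivAt (fun r : ℝ => 2 * r) 2 t := by
      simpa using (hasDerivAt_id t).const_mul 2
    have d1 : HasDerivAt (fun s => invSemigroup R (2 * s))
        ((2 : ℝ) • -invSemigroupGen R (2 * t)) t :=
      (hasDerivAt_invSemigroup hR ht2).scomp t d0
    have d2 : HasDerivAt (fun s => C.transpose (invSemigroup R (2 * s)))
        (C.transpose ((2 : ℝ) • -invSemigroupGen R (2 * t))) t :=
      (C.transpose.restrictScalars ℝ).hasFDerivAt.comp_hasDerivAt t d1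
    have d3 : HasDerivAt (fun s : ℝ => Real.exp (4 * c * max s 0))
        (Real.exp (4 * c * max t 0) * (4 * c)) t := by
      have h1 : HasDerivAt (fun s : ℝ => Real.exp (4 * c * s)) (Real.exp (4 * c * t) * (4 * c)) t := by
        have : HasDerivAt (fun s : ℝ => 4 * c * s) (4 * c) t := by
          simpa using (hasDerivAt_id t).const_mul (4 * c)
        exact this.exp
      rw [max_eq_left ht.le]
      refine h1.congr_of_eventuallyEq ?_
      filter_upwards [lt_mem_nhds ht] with s hs
      rw [max_eq_left hs.le]
    have d4 := d3.smul (hasDerivAt_sandwich d1 d2 X)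
    have eY : (2 : ℝ) • -invSemigroupGen R (2 * t) = (-t⁻¹) • scaledGen R t := by
      rw [scaledGen, smul_smul, smul_neg, ← neg_smul]
      congr 1
      field_simp
    have eY' : C.transpose ((-t⁻¹) • scaledGen R t) = (-t⁻¹) • C.transpose (scaledGen R t) :=
      (C.transpose.restrictScalars ℝ).map_smul _ _
    rw [eY, eY', sandwich_smul_left, sandwich_smul_right] at d4
    convert! d4 using 1
    simp only [linearFlowDeriv, smul_apply, sub_apply, max_eq_left ht.le]
    match_scalars <;> field_simp

theorem compression_linearFlow (hR : 0 ≤ R) (t : ℝ) (X : HilbertSchmidt h) :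
    compression C R (linearFlow C c R t X) = linearFlow C c R t (compression C R X) := by
  have e1 := invSemigroup_comm hR (2 * t)
  have e2 : C.transpose R * C.transpose (invSemigroup R (2 * t)) =
      C.transpose (invSemigroup R (2 * t)) * C.transpose R := by
    rw [← C.transpose_mul, ← C.transpose_mul, e1]
  simp only [compression, linearFlow, smul_apply, map_smul, sandwich_sandwich, e1, e2]

theorem compressedGen_linearFlow (hR : 0 ≤ R) (t : ℝ) (X : HilbertSchmidt h) :
    compressedGen C c R (linearFlow C c R t X) = linearFlow C c R t (compressedGen C c R X) := by
  have e1 := invSemigroup_comm hR (2 * t)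
  have e2 : C.transpose R * C.transpose (invSemigroup R (2 * t)) =
      C.transpose (invSemigroup R (2 * t)) * C.transpose R := by
    rw [← C.transpose_mul, ← C.transpose_mul, e1]
  simp only [compressedGen, linearFlow, smul_apply, add_apply, map_smul, map_add,
    sandwich_sandwich, e1, e2, one_mul, mul_one]
  module

theorem compression_linearFlowDeriv_comm (hR : 0 ≤ R) (t : ℝ) (X : HilbertSchmidt h) :
    compression C R (linearFlowDeriv C c R t X) = linearFlowDeriv C c R t (compression C R X) := by
  have e1 := invSemigroup_comm hR (2 * t)
  have e2 : C.transpose R * C.transpose (invSemigroup R (2 * t)) =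
      C.transpose (invSemigroup R (2 * t)) * C.transpose R := by
    rw [← C.transpose_mul, ← C.transpose_mul, e1]
  have e3 := scaledGen_comm hR t
  have e4 : C.transpose R * C.transpose (scaledGen R t) =
      C.transpose (scaledGen R t) * C.transpose R := by
    rw [← C.transpose_mul, ← C.transpose_mul, e3]
  simp only [compression, linearFlowDeriv, smul_apply, sub_apply, map_smul, map_sub,
    sandwich_sandwich, e1, e2, e3, e4]

/-- Since `R (2 t A e^{-2tA}) = 2 t e^{-2tA}`, compression cancels the unbounded factor on either
side. This is the relation `j K = t ℓ T` of the abstract existence theorem. -/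
theorem compression_linearFlowDeriv (hR : 0 ≤ R) {t : ℝ} (ht : 0 ≤ t) (X : HilbertSchmidt h) :
    compression C R (linearFlowDeriv C c R t X) =
      t • compressedGen C c R (linearFlow C c R t X) := by
  have e3 := mul_scaledGen hR ht
  have e4 : C.transpose (scaledGen R t) * C.transpose R =
      (2 * t) • C.transpose (invSemigroup R (2 * t)) := by
    rw [← C.transpose_mul, e3]
    exact (C.transpose.restrictScalars ℝ).map_smul _ _
  simp only [compression, compressedGen, linearFlow, linearFlowDeriv, smul_apply, sub_apply,
    add_apply, map_smul, map_sub, sandwich_sandwich, e3, e4, one_mul, mul_one, sandwich_smul_left,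
    sandwich_smul_right, max_eq_left ht]
  module

/-- The quadratic part of the flow. -/
noncomputable def flowQuad (C : Conjugation h) :
    (HilbertSchmidt h × HilbertSchmidt h) →L[ℝ] (HilbertSchmidt h × HilbertSchmidt h) →L[ℝ]
      HilbertSchmidt h × HilbertSchmidt h :=
  LinearMap.mkContinuous₂
    -- Only real scalars are possible, the adjoint being conjugate linear. The flow uses only the
    -- diagonal `u = v`, so the distribution of the arguments over the factors is a matter of
    -- convenience.
    (LinearMap.mk₂ ℝ (fun u v => ((16 : ℝ) • lmul (toCLM u.2) (adj v.2),
        (-2 : ℝ) • (lmul (toCLM u.1) v.2 + rmul (C.transpose (toCLM v.1)) u.2)))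
      (fun u u' v => by
        ext1
        · simp
        · simp only [Prod.fst_add, Prod.snd_add, map_add, add_apply]
          module)
      (fun r u v => by
        simp only [← Complex.coe_smul]
        ext1
        · simp only [Prod.smul_fst, Prod.smul_snd, map_smul, smul_apply]
          module
        · simp only [Prod.smul_fst, Prod.smul_snd, map_smul, smul_apply]
          module)
      (fun u v v' => by
        ext1
        · simp [adj_add]
        · simp only [Prod.fst_add, Prod.snd_add, map_add, add_apply]
          module)
      (fun r u v => by
        ext1
        · simp only [Prod.smul_snd, Prod.smul_fst, adj_real_smul]
          simp only [← Complex.coe_smul, map_smul]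
          module
        · simp only [← Complex.coe_smul, Prod.smul_fst, Prod.smul_snd, map_smul, smul_apply]
          module))
    16 fun u v => by
      rw [LinearMap.mk₂_apply]
      have h1 := norm_fst_le u
      have h2 := norm_snd_le u
      have h3 := norm_fst_le v
      have h4 := norm_snd_le v
      refine norm_prod_le_iff.2 ⟨?_, ?_⟩
      · rw [norm_smul, Real.norm_of_nonneg (by norm_num), mul_assoc]
        gcongr
        refine (norm_lmul_le _ _).trans ?_
        rw [norm_adj]
        gcongr
        exact (opNorm_toCLM_le _).trans h2
      · rw [norm_smul, norm_neg, Real.norm_of_nonneg (by norm_num)]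
        have k1 : ‖lmul (toCLM u.1) v.2‖ ≤ ‖u‖ * ‖v‖ := by
          refine (norm_lmul_le _ _).trans ?_
          gcongr
          exact (opNorm_toCLM_le _).trans h1
        have k2 : ‖rmul (C.transpose (toCLM v.1)) u.2‖ ≤ ‖u‖ * ‖v‖ := by
          refine (norm_rmul_le _ _).trans ?_
          gcongr
          exact (C.norm_transpose_le _).trans ((opNorm_toCLM_le _).trans h3)
        have k3 := norm_add_le (lmul (toCLM u.1) v.2) (rmul (C.transpose (toCLM v.1)) u.2)
        have k4 : 0 ≤ ‖u‖ * ‖v‖ := by positivity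
        linarith

theorem flowQuad_apply (u v : HilbertSchmidt h × HilbertSchmidt h) :
    flowQuad C u v = ((16 : ℝ) • lmul (toCLM u.2) (adj v.2),
        (-2 : ℝ) • (lmul (toCLM u.1) v.2 + rmul (C.transpose (toCLM v.1)) u.2)) := rfl

/-- The equation for `Δ` has no linear part, so its kernel is the identity, with zero derivative. -/
theorem IsAnalyticKernel.prod_const {E F : Type*} [NormedAddCommGroup E] [NormedSpace ℝ E]
    [NormedAddCommGroup F] [NormedSpace ℝ F] {T K : ℝ → E →L[ℝ] E} (hT : IsAnalyticKernel T K) :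
    IsAnalyticKernel (fun t => (ContinuousLinearMap.id ℝ F).prodMap (T t))
      (fun t => (0 : F →L[ℝ] F).prodMap (K t)) := by
  have hbound : ∀ (A : F →L[ℝ] F) (B : E →L[ℝ] E) (M : ℝ), ‖A‖ ≤ 1 → ‖B‖ ≤ M →
      ‖A.prodMap B‖ ≤ max 1 M := fun A B M hA hB => by
    refine ContinuousLinearMap.opNorm_le_bound _ (by positivity) fun x => ?_
    refine norm_prod_le_iff.2 ⟨?_, ?_⟩
    · exact (A.le_of_opNorm_le (hA.trans (le_max_left _ _)) x.1).trans
        (by gcongr; exact norm_fst_le x)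
    · exact (B.le_of_opNorm_le (hB.trans (le_max_right _ _)) x.2).trans
        (by gcongr; exact norm_snd_le x)
  refine ⟨⟨fun x => ?_, fun b => ?_⟩, ⟨fun x => ?_, fun b => ?_⟩, fun t ht x => ?_⟩
  · exact continuous_const.prodMk (hT.left.continuous_apply x.2)
  · obtain ⟨M, hM⟩ := hT.left.exists_norm_le b
    exact ⟨max 1 M, fun t ht => hbound _ _ _ ContinuousLinearMap.norm_id_le (hM t ht)⟩
  · exact continuous_const.prodMk (hT.right.continuous_apply x.2)
  · obtain ⟨M, hM⟩ := hT.right.exists_norm_le b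
    exact ⟨max 1 M, fun t ht => hbound _ _ _ (by simp) (hM t ht)⟩
  · have := (hasDerivAt_const t x.1).prodMk (hT.hasDerivAt t ht x.2)
    convert! this using 1
    ext1 <;> simp

/-- A continuous solution of the flow on `[0, T]` in the Hilbert-Schmidt topology, with no initial
condition. -/
structure IsHilbertSchmidtFlowOn (C : Conjugation h) (Υ : h →ₗ.[ℂ] h) (T : ℝ)
    (Δ D : ℝ → HilbertSchmidt h) : Prop where
  continuousOn_fst : ContinuousOn Δ (Icc 0 T)
  continuousOn_snd : ContinuousOn D (Icc 0 T)
  deriv_fst : ∀ t ∈ Ioo 0 T, HasDerivAt Δ ((16 : ℝ) • lmul (toCLM (D t)) (adj (D t))) t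
  deriv_snd : ∀ t ∈ Ioo 0 T, ∃ B : HilbertSchmidt h,
    IsFlowField C Υ (toCLM (Δ t)) (toCLM (D t)) (toCLM B) ∧ HasDerivAt D B t

/-- Local existence, on an interval whose length depends only on the size of the data. -/
theorem IsShiftedInverse.exists_local_flow {Υ : h →ₗ.[ℂ] h} (hR : IsShiftedInverse Υ c R)
    (hΥ : IsSelfAdjoint Υ) (M : ℝ) :
    ∃ τ > 0, ∀ Δ₀ D₀ : HilbertSchmidt h, ‖Δ₀‖ ≤ M → ‖D₀‖ ≤ M →
      ∃ Δ D : ℝ → HilbertSchmidt h, IsHilbertSchmidtFlowOn C Υ τ Δ D ∧ Δ 0 = Δ₀ ∧ D 0 = D₀ := by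
  have hR0 := hR.nonneg
  have h1 := (isAnalyticKernel_linearFlow (C := C) (c := c) hR0 hR.denseRange).prod_const
    (F := HilbertSchmidt h)
  have h0 : (ContinuousLinearMap.id ℝ (HilbertSchmidt h)).prodMap (linearFlow C c R 0) = 1 := by
    refine ContinuousLinearMap.ext fun x => ?_
    simp only [linearFlow, mul_zero, max_self, Real.exp_zero, one_smul,
      invSemigroup_of_nonpos le_rfl, C.transpose_one]
    refine Prod.ext rfl (toCLM_injective ?_)
    change toCLM (sandwich 1 1 x.2) = toCLM x.2
    rw [toCLM_sandwich, one_mul, mul_one]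
  -- Only the `D`-component is compressed; `j` is the identity on the `Δ`-component, whose equation
  -- is already bounded.
  obtain ⟨τ, hτ, H⟩ := h1.exists_local_solution h0
    (j := (ContinuousLinearMap.id ℝ (HilbertSchmidt h)).prodMap (compression C R))
    (ℓ := (0 : HilbertSchmidt h →L[ℝ] HilbertSchmidt h).prodMap (compressedGen C c R))
    (fun t x => Prod.ext rfl (compression_linearFlow hR0 t x.2))
    (fun t x => Prod.ext rfl (compressedGen_linearFlow hR0 t x.2))
    (fun t ht x => Prod.ext (by simp) (compression_linearFlowDeriv hR0 ht x.2))
    (fun t x => Prod.ext rfl (compression_linearFlowDeriv_comm hR0 t x.2)) (flowQuad C) M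
  refine ⟨τ, hτ, fun Δ₀ D₀ hΔ₀ hD₀ => ?_⟩
  obtain ⟨u, u', hu, hu0, hd⟩ := H (Δ₀, D₀) (norm_prod_le_iff.2 ⟨hΔ₀, hD₀⟩)
  have d1 : ∀ t ∈ Ioo 0 τ, HasDerivAt (fun s => (u s).1) (u' t).1 t := fun t ht =>
    HasFDerivAt.comp_hasDerivAt t (ContinuousLinearMap.fst ℝ (HilbertSchmidt h)
      (HilbertSchmidt h)).hasFDerivAt (hd t ht).1
  have d2 : ∀ t ∈ Ioo 0 τ, HasDerivAt (fun s => (u s).2) (u' t).2 t := fun t ht =>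
    HasFDerivAt.comp_hasDerivAt t (ContinuousLinearMap.snd ℝ (HilbertSchmidt h)
      (HilbertSchmidt h)).hasFDerivAt (hd t ht).1
  refine ⟨fun t => (u t).1, fun t => (u t).2, ⟨continuous_fst.comp_continuousOn hu,
    continuous_snd.comp_continuousOn hu, fun t ht => ?_, fun t ht => ⟨_, ?_, d2 t ht⟩⟩, ?_, ?_⟩
  · have e := congrArg Prod.fst (hd t ht).2
    have e' : (u' t).1 = (16 : ℝ) • lmul (toCLM (u t).2) (adj (u t).2) := by
      simpa [flowQuad_apply] using e
    rw [← e']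
    exact d1 t ht
  · have e := congrArg Prod.snd (hd t ht).2
    have e' : compression C R (u' t).2 = compressedGen C c R (u t).2 + compression C R
        ((-2 : ℝ) • (lmul (toCLM (u t).1) (u t).2 +
          rmul (C.transpose (toCLM (u t).1)) (u t).2)) := e
    have e2 := congrArg toCLM e'
    rw [hR.isFlowField_iff hΥ]
    have c1 : ∀ (r : ℝ) (X : HilbertSchmidt h), r • X = (r : ℂ) • X := fun r X =>
      (Complex.coe_smul r X).symm
    simp only [compression, compressedGen, add_apply, smul_apply, toCLM_sandwich, c1, map_add,
      map_smul, toCLM_lmul, toCLM_rmul, one_mul, mul_one] at e2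
    rw [e2]
    push_cast
    rfl
  · exact congrArg Prod.fst hu0
  · exact congrArg Prod.snd hu0

end LocalExistence

/-! ### A priori bounds and continuation in time. -/

section GlobalExistence

open HilbertSchmidt

theorem exists_continuousOn_extension {E : Type*} [TopologicalSpace E] {u v : ℝ → E} {a T τ : ℝ}
    (haT : a < T) (hu : ContinuousOn u (Icc 0 T)) (hv : ContinuousOn v (Icc 0 τ))
    (huv : ∀ t ∈ Icc a T, u t = v (t - a)) :
    ∃ z : ℝ → E, ContinuousOn z (Icc 0 (a + τ)) ∧ (∀ t ∈ Icc 0 T, z t = u t) ∧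
      ∀ t ∈ Icc a (a + τ), z t = v (t - a) := by
  set z : ℝ → E := fun t => if t ≤ T then u t else v (t - a) with hz
  have h1 : ∀ t ∈ Icc 0 T, z t = u t := fun t ht => if_pos ht.2
  have h2 : ∀ t ∈ Icc a (a + τ), z t = v (t - a) := fun t ht => by
    rcases le_or_gt t T with h | h
    · rw [← huv t ⟨ht.1, h⟩]
      exact if_pos h
    · exact if_neg h.not_ge
  refine ⟨z, ?_, h1, h2⟩
  have h3 : ContinuousOn z (Icc a (a + τ)) :=
    (hv.comp (f := fun t => t - a) (by fun_prop) fun t ht =>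
      ⟨sub_nonneg.2 ht.1, sub_le_iff_le_add'.2 ht.2⟩).congr h2
  refine ((hu.congr h1).union_of_isClosed h3 isClosed_Icc isClosed_Icc).mono fun t ht => ?_
  rcases le_or_gt t T with h | h
  · exact Or.inl ⟨ht.1, h⟩
  · exact Or.inr ⟨(haT.trans h).le, ht.2⟩

variable {h : Type*} [NormedAddCommGroup h] [InnerProductSpace ℂ h] [CompleteSpace h]

namespace HilbertSchmidt

theorem hasDerivWithinAt_toCLM_apply {u : ℝ → HilbertSchmidt h} {u' : HilbertSchmidt h} {s : Set ℝ}
    {t : ℝ} (hu : HasDerivWithinAt u u' s t) (φ : h) :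
    HasDerivWithinAt (fun r => toCLM (u r) φ) (toCLM u' φ) s t :=
  HasFDerivAt.comp_hasDerivWithinAt t (((ContinuousLinearMap.apply ℂ h φ).comp
    toCLML).restrictScalars ℝ).hasFDerivAt hu

theorem hasDerivAt_toCLM_apply {u : ℝ → HilbertSchmidt h} {u' : HilbertSchmidt h} {t : ℝ}
    (hu : HasDerivAt u u' t) (φ : h) : HasDerivAt (fun r => toCLM (u r) φ) (toCLM u' φ) t :=
  hasDerivWithinAt_univ.1 (hasDerivWithinAt_toCLM_apply hu.hasDerivWithinAt φ)

theorem continuousOn_toCLM_apply {u : ℝ → HilbertSchmidt h} {s : Set ℝ} (hu : ContinuousOn u s)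
    (φ : h) : ContinuousOn (fun r => toCLM (u r) φ) s :=
  ((ContinuousLinearMap.apply ℂ h φ).comp toCLML).continuous.comp_continuousOn hu

theorem hasDerivAt_norm_sq {u : ℝ → HilbertSchmidt h} {u' : HilbertSchmidt h} {t : ℝ}
    (hu : HasDerivAt u u' t) : HasDerivAt (fun s => ‖u s‖ ^ 2) (2 * reInner (u t) u') t := by
  let L : HilbertSchmidt h →ₗᵢ[ℂ] lp (fun _ : (exists_hilbertBasis ℂ h).choose => h) 2 :=
    ⟨toLp, norm_toLp⟩
  have d1 : HasDerivAt (fun s => L (u s)) (L u') t :=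
    HasFDerivAt.comp_hasDerivAt t (L.toContinuousLinearMap.restrictScalars ℝ).hasFDerivAt hu
  have d2 := d1.inner ℂ d1
  have d3 : HasDerivAt (fun s => (⟪L (u s), L (u s)⟫_ℂ).re) _ t :=
    HasFDerivAt.comp_hasDerivAt t Complex.reCLM.hasFDerivAt d2
  convert! d3 using 1
  · ext s
    exact (reInner_self _).symm
  · have e : (⟪L u', L (u t)⟫_ℂ).re = (⟪L (u t), L u'⟫_ℂ).re := inner_re_symm (𝕜 := ℂ) _ _
    simp only [Complex.reCLM_apply, Complex.add_re, e]
    rw [two_mul]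
    rfl

theorem toCLM_smul_lmul_adj (X : HilbertSchmidt h) :
    toCLM ((16 : ℝ) • lmul (toCLM X) (adj X)) =
      (16 : ℂ) • (toCLM X ∘L (toCLM X).adjoint) := by
  rw [← Complex.coe_smul, map_smul, toCLM_lmul, toCLM_adj]
  norm_num
  rfl

theorem norm_smul_lmul_adj_le (X : HilbertSchmidt h) :
    ‖(16 : ℝ) • lmul (toCLM X) (adj X)‖ ≤ 16 * ‖X‖ ^ 2 := by
  rw [norm_smul, Real.norm_of_nonneg (by norm_num), sq]
  gcongr
  refine (norm_lmul_le _ _).trans ?_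
  rw [norm_adj]
  gcongr
  exact opNorm_toCLM_le X

theorem continuous_smul_lmul_adj (C : Conjugation h) :
    Continuous fun X : HilbertSchmidt h => (16 : ℝ) • lmul (toCLM X) (adj X) := by
  have hc : Continuous fun X : HilbertSchmidt h => ((0 : HilbertSchmidt h), X) := by fun_prop
  exact continuous_fst.comp (((flowQuad C).continuous.comp hc).clm_apply hc)

end HilbertSchmidt

variable {C : Conjugation h} {Υ : h →ₗ.[ℂ] h} {c : ℝ} {R : h →L[ℂ] h} {a S T τ : ℝ}
  {Δ D Δ' D' : ℝ → HilbertSchmidt h}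

namespace IsHilbertSchmidtFlowOn

theorem isStrongFlowOn (hu : IsHilbertSchmidtFlowOn C Υ T Δ D) :
    IsStrongFlowOn C Υ T (fun t => toCLM (Δ t)) (fun t => toCLM (D t)) where
  continuousOn_fst := continuousOn_toCLM_apply hu.continuousOn_fst
  continuousOn_snd := continuousOn_toCLM_apply hu.continuousOn_snd
  deriv_fst t ht φ := by
    have := hasDerivAt_toCLM_apply (hu.deriv_fst t ht) φ
    rwa [toCLM_smul_lmul_adj] at this
  deriv_snd t ht φ := by
    obtain ⟨B, hB, hd⟩ := hu.deriv_snd t ht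
    obtain ⟨hφ, e⟩ := hB φ
    exact ⟨hφ, e ▸ hasDerivAt_toCLM_apply hd φ⟩

theorem unique (hu : IsHilbertSchmidtFlowOn C Υ T Δ D) (hv : IsHilbertSchmidtFlowOn C Υ T Δ' D')
    (hΥ : IsSelfAdjoint Υ) (hR : IsShiftedInverse Υ c R) (hΔ : Δ 0 = Δ' 0) (hD : D 0 = D' 0) :
    ∀ t ∈ Icc 0 T, Δ t = Δ' t ∧ D t = D' t := fun t ht => by
  obtain ⟨h1, h2⟩ := hu.isStrongFlowOn.unique hv.isStrongFlowOn hΥ hR (congrArg _ hΔ)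
    (congrArg _ hD) t ht
  exact ⟨toCLM_injective h1, toCLM_injective h2⟩

theorem mono (hu : IsHilbertSchmidtFlowOn C Υ T Δ D) (hS : S ≤ T) :
    IsHilbertSchmidtFlowOn C Υ S Δ D where
  continuousOn_fst := hu.continuousOn_fst.mono (Icc_subset_Icc_right hS)
  continuousOn_snd := hu.continuousOn_snd.mono (Icc_subset_Icc_right hS)
  deriv_fst t ht := hu.deriv_fst t (Ioo_subset_Ioo_right hS ht)
  deriv_snd t ht := hu.deriv_snd t (Ioo_subset_Ioo_right hS ht)

theorem congr (hu : IsHilbertSchmidtFlowOn C Υ T Δ D) (hΔ : ∀ t ∈ Icc 0 T, Δ' t = Δ t)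
    (hD : ∀ t ∈ Icc 0 T, D' t = D t) : IsHilbertSchmidtFlowOn C Υ T Δ' D' where
  continuousOn_fst := hu.continuousOn_fst.congr hΔ
  continuousOn_snd := hu.continuousOn_snd.congr hD
  deriv_fst t ht := by
    rw [hD t (Ioo_subset_Icc_self ht)]
    exact (hu.deriv_fst t ht).congr_of_eventuallyEq
      ((eventually_mem_set.2 (Icc_mem_nhds ht.1 ht.2)).mono hΔ)
  deriv_snd t ht := by
    rw [hD t (Ioo_subset_Icc_self ht), hΔ t (Ioo_subset_Icc_self ht)]
    obtain ⟨B, hB, hd⟩ := hu.deriv_snd t ht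
    exact ⟨B, hB, hd.congr_of_eventuallyEq
      ((eventually_mem_set.2 (Icc_mem_nhds ht.1 ht.2)).mono hD)⟩

theorem comp_add_const (hu : IsHilbertSchmidtFlowOn C Υ T Δ D) (ha : 0 ≤ a) :
    IsHilbertSchmidtFlowOn C Υ (T - a) (fun t => Δ (t + a)) (fun t => D (t + a)) where
  continuousOn_fst := hu.continuousOn_fst.comp (by fun_prop)
    fun t ht => ⟨by linarith [ht.1], by linarith [ht.2]⟩
  continuousOn_snd := hu.continuousOn_snd.comp (by fun_prop)
    fun t ht => ⟨by linarith [ht.1], by linarith [ht.2]⟩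
  deriv_fst t ht :=
    (hu.deriv_fst (t + a) ⟨by linarith [ht.1], by linarith [ht.2]⟩).comp_add_const t a
  deriv_snd t ht := by
    obtain ⟨B, hB, hd⟩ := hu.deriv_snd (t + a) ⟨by linarith [ht.1], by linarith [ht.2]⟩
    exact ⟨B, hB, hd.comp_add_const t a⟩

/-- A solution can be prolonged by a solution restarted at an intermediate time. -/
theorem exists_extension (hu : IsHilbertSchmidtFlowOn C Υ T Δ D)
    (hv : IsHilbertSchmidtFlowOn C Υ τ Δ' D') (hΥ : IsSelfAdjoint Υ) (hR : IsShiftedInverse Υ c R)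
    (ha : 0 ≤ a) (haT : a < T) (hT : T ≤ a + τ) (hΔ : Δ' 0 = Δ a) (hD : D' 0 = D a) :
    ∃ Δ'' D'' : ℝ → HilbertSchmidt h, IsHilbertSchmidtFlowOn C Υ (a + τ) Δ'' D'' ∧
      Δ'' 0 = Δ 0 ∧ D'' 0 = D 0 := by
  have h1 : ∀ t ∈ Icc a T, Δ t = Δ' (t - a) ∧ D t = D' (t - a) := fun t ht => by
    have := (hu.comp_add_const ha).unique (hv.mono (by linarith)) hΥ hR (by simp [hΔ])
      (by simp [hD]) (t - a) ⟨by linarith [ht.1], by linarith [ht.2]⟩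
    simpa using this
  obtain ⟨Δ'', c1, l1, r1⟩ := exists_continuousOn_extension haT hu.continuousOn_fst
    hv.continuousOn_fst fun t ht => (h1 t ht).1
  obtain ⟨D'', c2, l2, r2⟩ := exists_continuousOn_extension haT hu.continuousOn_snd
    hv.continuousOn_snd fun t ht => (h1 t ht).2
  have h2 := hu.congr l1 l2
  have h3 : ∀ t ∈ Ioo a (a + τ), t - a ∈ Ioo 0 τ := fun t ht =>
    ⟨by linarith [ht.1], by linarith [ht.2]⟩
  refine ⟨Δ'', D'', ⟨c1, c2, fun t ht => ?_, fun t ht => ?_⟩,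
    l1 0 ⟨le_rfl, by linarith⟩, l2 0 ⟨le_rfl, by linarith⟩⟩
  -- Because `a < T`, the junction `T` is interior to the second interval, which supplies the
  -- two-sided derivative there.
  · rcases lt_or_ge t T with h | h
    · exact h2.deriv_fst t ⟨ht.1, h⟩
    · have ht' : t ∈ Ioo a (a + τ) := ⟨haT.trans_le h, ht.2⟩
      rw [r2 t (Ioo_subset_Icc_self ht')]
      exact ((hv.deriv_fst _ (h3 t ht')).comp_sub_const t a).congr_of_eventuallyEq
        ((eventually_mem_set.2 (Icc_mem_nhds ht'.1 ht'.2)).mono r1)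
  · rcases lt_or_ge t T with h | h
    · exact h2.deriv_snd t ⟨ht.1, h⟩
    · have ht' : t ∈ Ioo a (a + τ) := ⟨haT.trans_le h, ht.2⟩
      rw [r2 t (Ioo_subset_Icc_self ht'), r1 t (Ioo_subset_Icc_self ht')]
      obtain ⟨B, hB, hd⟩ := hv.deriv_snd _ (h3 t ht')
      exact ⟨B, hB, (hd.comp_sub_const t a).congr_of_eventuallyEq
        ((eventually_mem_set.2 (Icc_mem_nhds ht'.1 ht'.2)).mono r2)⟩

/-- The first component of the flow stays nonnegative. -/
theorem re_inner_nonneg (hu : IsHilbertSchmidtFlowOn C Υ T Δ D) (hΔ : Δ 0 = 0) {t : ℝ}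
    (ht : t ∈ Icc 0 T) (φ : h) : 0 ≤ (⟪φ, toCLM (Δ t) φ⟫_ℂ).re := by
  have hd : ∀ s ∈ Ioo 0 T, HasDerivAt (fun r => (⟪φ, toCLM (Δ r) φ⟫_ℂ).re)
      (16 * ‖(toCLM (D s)).adjoint φ‖ ^ 2) s := fun s hs => by
    have d1 := hasDerivAt_toCLM_apply (hu.deriv_fst s hs) φ
    have d2 := HasFDerivAt.comp_hasDerivAt s (Complex.reCLM.comp
      ((innerSL ℂ φ).restrictScalars ℝ)).hasFDerivAt d1
    convert! d2 using 1
    rw [toCLM_smul_lmul_adj]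
    have e : ⟪φ, ((16 : ℂ) • (toCLM (D s) ∘L (toCLM (D s)).adjoint)) φ⟫_ℂ =
        16 * (‖(toCLM (D s)).adjoint φ‖ : ℂ) ^ 2 := by
      rw [smul_apply, inner_smul_right, ContinuousLinearMap.comp_apply,
        ← ContinuousLinearMap.adjoint_inner_left, inner_self_eq_norm_sq_to_K]
      rfl
    change _ = (⟪φ, ((16 : ℂ) • (toCLM (D s) ∘L (toCLM (D s)).adjoint)) φ⟫_ℂ).re
    rw [e]
    norm_cast
  have hm : MonotoneOn (fun r => (⟪φ, toCLM (Δ r) φ⟫_ℂ).re) (Icc 0 T) := by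
    refine monotoneOn_of_deriv_nonneg (convex_Icc 0 T) ?_ ?_ ?_
    · exact (Complex.reCLM.continuous.comp (innerSL ℂ φ).continuous).comp_continuousOn
        (continuousOn_toCLM_apply hu.continuousOn_fst φ)
    · rw [interior_Icc]
      exact fun s hs => (hd s hs).differentiableAt.differentiableWithinAt
    · rw [interior_Icc]
      intro s hs
      rw [(hd s hs).deriv]
      positivity
  have := hm ⟨le_rfl, ht.1.trans ht.2⟩ ht ht.1
  simpa [hΔ] using this

/-- The dissipation estimate makes `e^{-8 (c - 1) t} ‖D t‖²` nonincreasing; only interior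
derivatives and continuity up to the endpoints enter. -/
theorem norm_sq_snd_le (hu : IsHilbertSchmidtFlowOn C Υ T Δ D) (hR : IsShiftedInverse Υ c R)
    (hΥ : IsSelfAdjoint Υ) (hΔ : Δ 0 = 0) {t : ℝ} (ht : t ∈ Icc 0 T) :
    ‖D t‖ ^ 2 ≤ Real.exp (8 * (c - 1) * t) * ‖D 0‖ ^ 2 := by
  have hexp : ∀ s : ℝ, HasDerivAt (fun r => Real.exp (-(8 * (c - 1)) * r))
      (Real.exp (-(8 * (c - 1)) * s) * -(8 * (c - 1))) s := fun s => by
    have : HasDerivAt (fun r : ℝ => -(8 * (c - 1)) * r) (-(8 * (c - 1))) s := by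
      simpa using (hasDerivAt_id s).const_mul (-(8 * (c - 1)))
    exact this.exp
  have hd : ∀ s ∈ Ioo 0 T, ∃ y ≤ 0,
      HasDerivAt (fun r => Real.exp (-(8 * (c - 1)) * r) * ‖D r‖ ^ 2) y s := fun s hs => by
    obtain ⟨B, hB, hd⟩ := hu.deriv_snd s hs
    refine ⟨_, ?_, (hexp s).mul (hasDerivAt_norm_sq hd)⟩
    have h1 := hR.reInner_le hΥ hB fun x => hu.re_inner_nonneg hΔ (Ioo_subset_Icc_self hs) x
    have h2 := mul_le_mul_of_nonneg_left h1 (Real.exp_pos (-(8 * (c - 1)) * s)).le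
    nlinarith
  have hm : AntitoneOn (fun r => Real.exp (-(8 * (c - 1)) * r) * ‖D r‖ ^ 2) (Icc 0 T) := by
    refine antitoneOn_of_deriv_nonpos (convex_Icc 0 T) ?_ ?_ ?_
    · exact (Continuous.continuousOn (by fun_prop)).mul (hu.continuousOn_snd.norm.pow 2)
    · rw [interior_Icc]
      intro s hs
      obtain ⟨y, -, hy⟩ := hd s hs
      exact hy.differentiableAt.differentiableWithinAt
    · rw [interior_Icc]
      intro s hs
      obtain ⟨y, hy0, hy⟩ := hd s hs
      rwa [hy.deriv]
  have h1 : Real.exp (-(8 * (c - 1)) * t) * ‖D t‖ ^ 2 ≤ ‖D 0‖ ^ 2 := by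
    simpa using hm ⟨le_rfl, ht.1.trans ht.2⟩ ht ht.1
  calc ‖D t‖ ^ 2
      = Real.exp (8 * (c - 1) * t) * (Real.exp (-(8 * (c - 1)) * t) * ‖D t‖ ^ 2) := by
        rw [← mul_assoc, ← Real.exp_add]
        simp
    _ ≤ _ := by gcongr

end IsHilbertSchmidtFlowOn

/-- The a priori bound for the flow. -/
theorem IsShiftedInverse.exists_norm_flow_le (hR : IsShiftedInverse Υ c R) (hΥ : IsSelfAdjoint Υ)
    (T : ℝ) (D₀ : HilbertSchmidt h) :
    ∃ M, ∀ S ≤ T, ∀ Δ D : ℝ → HilbertSchmidt h, IsHilbertSchmidtFlowOn C Υ S Δ D → Δ 0 = 0 →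
      D 0 = D₀ → ∀ t ∈ Icc 0 S, ‖Δ t‖ ≤ M ∧ ‖D t‖ ≤ M := by
  set K := Real.exp (8 * |c - 1| * |T|) * ‖D₀‖ ^ 2 with hK
  have hK0 : 0 ≤ K := by positivity
  -- `16 K |T|` bounds `Δ` by integration of `16 D D*`, and `K + 1` bounds `‖D‖` because `x ≤ x² +
  -- 1`.
  refine ⟨16 * K * |T| + K + 1, fun S hS Δ D hu hΔ hD t ht => ?_⟩
  have htT : ∀ s ∈ Icc 0 S, s ≤ |T| := fun s hs => hs.2.trans (hS.trans (le_abs_self T))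
  have h1 : ∀ s ∈ Icc 0 S, ‖D s‖ ^ 2 ≤ K := fun s hs => by
    refine (hu.norm_sq_snd_le hR hΥ hΔ hs).trans ?_
    rw [hD, hK]
    have h2 : (c - 1) * s ≤ |c - 1| * |T| := by
      calc (c - 1) * s ≤ |c - 1| * s := mul_le_mul_of_nonneg_right (le_abs_self _) hs.1
        _ ≤ |c - 1| * |T| := by
          gcongr
          exact htT s hs
    refine mul_le_mul_of_nonneg_right (Real.exp_le_exp.2 ?_) (sq_nonneg _)
    linarith
  have h3 : 0 ≤ 16 * K * |T| := by positivity
  constructor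
  · have h4 := norm_sub_le_of_hasDerivAt_Ioo ht.1
      (hu.continuousOn_fst.mono (Icc_subset_Icc_right ht.2))
      (fun s hs => hu.deriv_fst s (Ioo_subset_Ioo_right ht.2 hs)) (B := fun s => 16 * K * s)
      (B' := fun _ => 16 * K) (fun s => by simpa using (hasDerivAt_id s).const_mul (16 * K))
      fun s hs => (norm_smul_lmul_adj_le _).trans (by
        gcongr
        exact h1 s ⟨hs.1.le, hs.2.le.trans ht.2⟩)
    rw [hΔ, sub_zero, mul_zero, sub_zero] at h4
    have h5 : 16 * K * t ≤ 16 * K * |T| := by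
      gcongr
      exact htT t ht
    linarith
  · nlinarith [h1 t ht, sq_nonneg (‖D t‖ - 1)]

theorem IsShiftedInverse.exists_flowOn (hR : IsShiftedInverse Υ c R) (hΥ : IsSelfAdjoint Υ)
    (T : ℝ) (D₀ : HilbertSchmidt h) :
    ∃ Δ D : ℝ → HilbertSchmidt h, IsHilbertSchmidtFlowOn C Υ T Δ D ∧ Δ 0 = 0 ∧ D 0 = D₀ := by
  obtain ⟨M, hM⟩ := hR.exists_norm_flow_le (C := C) hΥ T D₀
  obtain ⟨τ, hτ, H⟩ := hR.exists_local_flow (C := C) hΥ (max M ‖D₀‖)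
  -- A solution up to `(n + 1) τ / 2` is restarted at `n τ / 2` and reaches `(n + 2) τ / 2`. Half
  -- steps give the overlap needed for gluing, and the a priori bound keeps `τ` the same throughout.
  have key : ∀ n : ℕ, ∃ Δ D : ℝ → HilbertSchmidt h,
      IsHilbertSchmidtFlowOn C Υ (min T ((n + 1) * (τ / 2))) Δ D ∧ Δ 0 = 0 ∧ D 0 = D₀ := by
    intro n
    induction n with
    | zero =>
      obtain ⟨Δ, D, hu, hΔ, hD⟩ := H 0 D₀ (by simp) (le_max_right _ _)
      refine ⟨Δ, D, hu.mono ((min_le_right _ _).trans ?_), hΔ, hD⟩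
      simp
      linarith
    | succ n ih =>
      obtain ⟨Δ, D, hu, hΔ, hD⟩ := ih
      rcases le_or_gt T ((n + 1) * (τ / 2)) with hT | hT
      · rw [min_eq_left hT] at hu
        exact ⟨Δ, D, hu.mono (min_le_left _ _), hΔ, hD⟩
      · rw [min_eq_right hT.le] at hu
        have hn : (0 : ℝ) ≤ n * (τ / 2) := by positivity
        have hb := hM _ hT.le Δ D hu hΔ hD (n * (τ / 2)) ⟨hn, by linarith⟩
        obtain ⟨Δ', D', hv, hΔ', hD'⟩ := H _ _ (hb.1.trans (le_max_left _ _))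
          (hb.2.trans (le_max_left _ _))
        obtain ⟨Δ'', D'', hw, hΔ'', hD''⟩ := hu.exists_extension hv hΥ hR hn (by linarith)
          (by linarith) hΔ' hD'
        refine ⟨Δ'', D'', hw.mono ((min_le_right _ _).trans ?_), hΔ''.trans hΔ, hD''.trans hD⟩
        push_cast
        linarith
  obtain ⟨n, hn⟩ := exists_nat_ge (T / (τ / 2))
  obtain ⟨Δ, D, hu, hΔ, hD⟩ := key n
  rw [div_le_iff₀ (by positivity)] at hn
  exact ⟨Δ, D, hu.mono (le_min le_rfl (by linarith)), hΔ, hD⟩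

theorem IsShiftedInverse.exists_global_flow (hR : IsShiftedInverse Υ c R) (hΥ : IsSelfAdjoint Υ)
    (D₀ : HilbertSchmidt h) :
    ∃ Δ D : ℝ → HilbertSchmidt h, (∀ T, IsHilbertSchmidtFlowOn C Υ T Δ D) ∧ Δ 0 = 0 ∧
      D 0 = D₀ := by
  choose U V hU hU0 hV0 using fun n : ℕ => hR.exists_flowOn (C := C) hΥ (n + 1) D₀
  -- By uniqueness all finite-time solutions agree where they overlap, so the choice of the index
  -- `⌈t⌉₊` at time `t` is harmless.
  have key : ∀ n : ℕ, ∀ t ∈ Icc (0 : ℝ) (n + 1), U ⌈t⌉₊ t = U n t ∧ V ⌈t⌉₊ t = V n t :=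
    fun n t ht => ((hU ⌈t⌉₊).mono (S := t) (by linarith [Nat.le_ceil t])).unique
      ((hU n).mono ht.2) hΥ hR (by rw [hU0, hU0]) (by rw [hV0, hV0]) t ⟨ht.1, le_rfl⟩
  refine ⟨fun t => U ⌈t⌉₊ t, fun t => V ⌈t⌉₊ t, fun T => ?_, hU0 _, hV0 _⟩
  obtain ⟨n, hn⟩ := exists_nat_ge T
  exact ((hU n).congr (fun t ht => (key n t ht).1) fun t ht => (key n t ht).2).mono (by linarith)

theorem continuousOn_Ici_of_forall_Icc {E : Type*} [TopologicalSpace E] {u : ℝ → E}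
    (hu : ∀ T, ContinuousOn u (Icc 0 T)) : ContinuousOn u (Ici 0) := fun t ht => by
  refine (hu (t + 1) t ⟨ht, by linarith⟩).mono_of_mem_nhdsWithin ?_
  filter_upwards [self_mem_nhdsWithin, mem_nhdsWithin_of_mem_nhds (Iic_mem_nhds (lt_add_one t))]
    with s h1 h2 using ⟨h1, h2⟩

theorem isHilbertSchmidtFlow_of_forall (hu : ∀ T, IsHilbertSchmidtFlowOn C Υ T Δ D) (hΔ : Δ 0 = 0) :
    IsHilbertSchmidtFlow C Υ (D 0) Δ D := by
  have c1 := continuousOn_Ici_of_forall_Icc fun T => (hu T).continuousOn_fst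
  have c2 := continuousOn_Ici_of_forall_Icc fun T => (hu T).continuousOn_snd
  have hd : ∀ t, 0 < t → HasDerivAt Δ ((16 : ℝ) • lmul (toCLM (D t)) (adj (D t))) t :=
    fun t ht => (hu (t + 1)).deriv_fst t ⟨ht, by linarith⟩
  refine ⟨c1, c2, hΔ, rfl, fun t ht => ⟨_, toCLM_smul_lmul_adj (D t), ?_⟩, fun t ht =>
    (hu (t + 1)).deriv_snd t ⟨ht, by linarith⟩⟩
  rcases ht.eq_or_lt with rfl | ht
  -- At `t = 0` the one-sided derivative of `Δ` is the limit of `16 D D*` from the right, by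
  -- continuity of `D`.
  · refine hasDerivWithinAt_Ici_of_tendsto_deriv (s := Ioi 0)
      (fun s hs => (hd s hs).differentiableAt.differentiableWithinAt)
      ((c1 0 self_mem_Ici).mono Ioi_subset_Ici_self) self_mem_nhdsWithin ?_
    have l := ((continuous_smul_lmul_adj C).tendsto (D 0)).comp
      ((c2 0 self_mem_Ici).mono Ioi_subset_Ici_self)
    refine l.congr' ?_
    filter_upwards [self_mem_nhdsWithin] with s hs
    exact (hd s hs).deriv.symm
  · exact (hd t ht).hasDerivWithinAt

theorem IsHilbertSchmidtFlow.isStrongFlow {D₀ : HilbertSchmidt h}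
    (hu : IsHilbertSchmidtFlow C Υ D₀ Δ D) :
    IsStrongFlow C Υ (toCLM D₀) (fun t => toCLM (Δ t)) (fun t => toCLM (D t)) where
  continuousOn_Δ := continuousOn_toCLM_apply hu.continuousOn_Δ
  continuousOn_D := continuousOn_toCLM_apply hu.continuousOn_D
  Δ_zero := by rw [hu.Δ_zero, map_zero]
  D_zero := congrArg _ hu.D_zero
  deriv_Δ t ht φ := by
    obtain ⟨A, hA, hd⟩ := hu.deriv_Δ t ht
    have := hasDerivWithinAt_toCLM_apply hd φ
    rwa [hA] at this
  deriv_D t ht φ := by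
    obtain ⟨B, hB, hd⟩ := hu.deriv_D t ht
    obtain ⟨hφ, e⟩ := hB φ
    exact ⟨hφ, e ▸ hasDerivAt_toCLM_apply hd φ⟩

theorem IsStrongFlow.unique {D₀ : h →L[ℂ] h} {X Y X' Y' : ℝ → h →L[ℂ] h}
    (hXY : IsStrongFlow C Υ D₀ X Y) (hXY' : IsStrongFlow C Υ D₀ X' Y') (hΥ : IsSelfAdjoint Υ)
    (hR : IsShiftedInverse Υ c R) {t : ℝ} (ht : 0 ≤ t) : X t = X' t ∧ Y t = Y' t :=
  (hXY.isStrongFlowOn t).unique (hXY'.isStrongFlowOn t) hΥ hR (by rw [hXY.Δ_zero, hXY'.Δ_zero])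
    (by rw [hXY.D_zero, hXY'.D_zero]) t ⟨ht, le_rfl⟩

end GlobalExistence

/-! ### Conclusion. -/

theorem mainTheorem2 {h : Type*} [NormedAddCommGroup h] [InnerProductSpace ℂ h]
    [CompleteSpace h] [TopologicalSpace.SeparableSpace h]
    (C : Conjugation h) (Υ₀ : h →ₗ.[ℂ] h) (hΥ₀ : IsSelfAdjoint Υ₀)
    (μ : ℝ) (hμ : ∀ φ : Υ₀.domain, -μ * ‖(φ : h)‖ ^ 2 ≤ (⟪(φ : h), Υ₀ φ⟫_ℂ).re)
    (D₀ : HilbertSchmidt h) (hD₀ : D₀ ≠ 0) :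
    ∃ Δ D : ℝ → HilbertSchmidt h,
      -- `(Δ, D)` is the unique solution of the flow for the strong topology,
      (IsStrongFlow C Υ₀ D₀.toCLM (fun t => (Δ t).toCLM) (fun t => (D t).toCLM) ∧
        ∀ X Y : ℝ → h →L[ℂ] h, IsStrongFlow C Υ₀ D₀.toCLM X Y →
          ∀ t : ℝ, 0 ≤ t → X t = (Δ t).toCLM ∧ Y t = (D t).toCLM) ∧
      -- and it is the unique solution of the flow for the Hilbert-Schmidt topology.
      (IsHilbertSchmidtFlow C Υ₀ D₀ Δ D ∧
        (∀ t : ℝ, 0 < t → HasHilbertSchmidtTerms C Υ₀ (Δ t) (D t)) ∧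
        ∀ X Y : ℝ → HilbertSchmidt h, IsHilbertSchmidtFlow C Υ₀ D₀ X Y →
          ∀ t : ℝ, 0 ≤ t → X t = Δ t ∧ Y t = D t) := by
  obtain ⟨R, hR⟩ := exists_isShiftedInverse hΥ₀ hμ
  obtain ⟨Δ, D, hu, hΔ, rfl⟩ := hR.exists_global_flow (C := C) hΥ₀ D₀
  have hHS := isHilbertSchmidtFlow_of_forall hu hΔ
  -- Every Hilbert-Schmidt solution is a strong one, so uniqueness in the strong class settles both
  -- uniqueness claims.
  refine ⟨Δ, D, ⟨hHS.isStrongFlow, fun X Y hXY t ht => hXY.unique hHS.isStrongFlow hΥ₀ hR ht⟩,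
    hHS, fun t ht => ?_, fun X Y hXY t ht => ?_⟩
  · obtain ⟨B, hB, -⟩ := hHS.deriv_D t ht
    exact hR.hasHilbertSchmidtTerms hΥ₀ hB
  · obtain ⟨h1, h2⟩ := hXY.isStrongFlow.unique hHS.isStrongFlow hΥ₀ hR ht
    exact ⟨HilbertSchmidt.toCLM_injective h1, HilbertSchmidt.toCLM_injective h2⟩
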